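/- Let $N$ be a free abelian group of rank $2$, $M=\mathrm{Hom}(N,\mathbb Z)$, $N_{\mathbb R}=N\otimes_{\mathbb Z}\mathbb R\cong\mathbb R^2$. Let $\Sigma$ be a fan in $N_{\mathbb R}$ (a finite set of strongly convex rational polyhedral cones, closed under taking faces, any two of which meet in a common face), and let $\widetilde\Sigma$ be a smooth fan (each cone is generated by part of a $\mathbb Z$-basis of $N$) that refines $\Sigma$: every cone of $\widetilde\Sigma$ is contained in a cone of $\Sigma$, and both fans have the same support. (As $N$ has rank $2$, this means that $\widetilde\Sigma$ is obtained from $\Sigma$ by adding rays.) For a fan $\Sigma$ let $X_\Sigma$ denote the complex toric variety obtained by gluing the $\mathrm{Spec}\,\mathbb C[\sigma^\vee\cap M]$, $\sigma\in\Sigma$, and let $f\colon X_{\widetilde\Sigma}\to X_\Sigma$ be the toric morphism induced by the identity of $N$. Let $E\subset X_{\widetilde\Sigma}$ be the exceptional locus of $f$, that is, the closed set of the points at which $f$ is not a local isomorphism, with its reduced scheme structure. Then: 1. $E$ is a disjoint union of finitely many (possibly zero) trees of projective lines, where a tree of projective lines is a reduced scheme over $\mathbb C$ that is the union of closed subschemes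 $L_0,\dots,L_k$ ($k\ge 0$), each isomorphic to $\mathbb P^1_{\mathbb C}$, such that for $0\le i<k$ the lines $L_i$ and $L_{i+1}$ meet transversally in exactly one point (their scheme-theoretic intersection is isomorphic to $\mathrm{Spec}\,\mathbb C$), and $L_i\cap L_j=\emptyset$ whenever $|i-j|\ge 2$. 2. $E$ is cellular: there is a filtration $\emptyset=Z_0\subseteq Z_1\subseteq\dots\subseteq Z_n=E$ by closed subvarieties such that each $Z_{i+1}\setminus Z_i$, with its reduced structure, is a disjoint union of finitely many varieties isomorphic to affine spaces over $\mathbb C$. 3. If $f$ is an isomorphism over the smooth locus of $X_\Sigma$, then $E$ is the preimage under $f$ of the singular locus of $X_\Sigma$. -/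

import Mathlib

open CategoryTheory CategoryTheory.Limits AlgebraicGeometry TopologicalSpace
open scoped TensorProduct

noncomputable section

namespace ToricSurface

/-! ### Cones and fans in `N_ℝ = ℝ ⊗ N`, for a lattice `N` with dual lattice `M = Hom(N, ℤ)` -/

section Cones

variable {N : Type} [AddCommGroup N]

/-- The pairing `⟨m, x⟩` of `m ∈ M` with `x ∈ N_ℝ`, the `ℝ`-linear extension of `m : N → ℤ`. -/
def pairing (m : Module.Dual ℤ N) : (ℝ ⊗[ℤ] N) →ₗ[ℝ] ℝ :=
  Module.Dual.baseChange ℝ m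

/-- The semigroup `S_σ = σ^∨ ∩ M` of a cone `σ`. -/
def dualMonoid (σ : PointedCone ℝ (ℝ ⊗[ℤ] N)) : AddSubmonoid (Module.Dual ℤ N) where
  carrier := {m | ∀ x ∈ σ, 0 ≤ pairing m x}
  zero_mem' := fun x _ => by simp [pairing]
  add_mem' := fun {a b} ha hb x hx => by
    have := add_nonneg (ha x hx) (hb x hx)
    simpa [pairing] using this

/-- The cone in `N_ℝ` generated by a set of lattice vectors. -/
def latticeCone (s : Set N) : PointedCone ℝ (ℝ ⊗[ℤ] N) :=
  PointedCone.hull ℝ ((fun v : N => (1 : ℝ) ⊗ₜ[ℤ] v) '' s)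

/-- `σ` is a rational polyhedral cone. -/
def IsRationalPolyhedral (σ : PointedCone ℝ (ℝ ⊗[ℤ] N)) : Prop :=
  ∃ s : Set N, s.Finite ∧ σ = latticeCone s

/-- `σ` is strongly convex: it contains no line. -/
def IsStronglyConvex (σ : PointedCone ℝ (ℝ ⊗[ℤ] N)) : Prop :=
  ∀ x ∈ σ, -x ∈ σ → x = 0

/-- `τ` is a face of `σ`: `τ = σ ∩ m^⊥` for some `m ∈ σ^∨`. As the cones considered are rational
polyhedral, `m` may be (and is) taken in `σ^∨ ∩ M`. -/
def IsFace (τ σ : PointedCone ℝ (ℝ ⊗[ℤ] N)) : Prop :=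
  ∃ m ∈ dualMonoid σ, ∀ x, x ∈ τ ↔ x ∈ σ ∧ pairing m x = 0

/-- `σ` is smooth: it is generated by a part of a `ℤ`-basis of `N`. -/
def IsSmoothCone (σ : PointedCone ℝ (ℝ ⊗[ℤ] N)) : Prop :=
  ∃ (ι : Type) (b : Module.Basis ι ℤ N) (s : Set ι), σ = latticeCone (b '' s)

variable (N) in
/-- A fan in `N_ℝ`: a finite set of strongly convex rational polyhedral cones that contains the
faces of its members, and in which any two members meet in a common face. -/
structure Fan where
  cones : Set (PointedCone ℝ (ℝ ⊗[ℤ] N))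
  finite : cones.Finite
  rational : ∀ σ ∈ cones, IsRationalPolyhedral σ
  stronglyConvex : ∀ σ ∈ cones, IsStronglyConvex σ
  face_mem : ∀ σ ∈ cones, ∀ τ, IsFace τ σ → τ ∈ cones
  inter_face : ∀ σ ∈ cones, ∀ τ ∈ cones, IsFace (σ ⊓ τ) σ ∧ IsFace (σ ⊓ τ) τ

/-- The fan is smooth: all its cones are. -/
def Fan.IsSmooth (F : Fan N) : Prop := ∀ σ ∈ F.cones, IsSmoothCone σ

/-- The support of a fan, the union of its cones. -/
def Fan.support (F : Fan N) : Set (ℝ ⊗[ℤ] N) := ⋃ σ ∈ F.cones, (σ : Set (ℝ ⊗[ℤ] N))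

/-- `F'` refines `F`: every cone of `F'` lies in a cone of `F` and the supports agree. -/
structure Fan.Refines (F' F : Fan N) : Prop where
  exists_le : ∀ τ ∈ F'.cones, ∃ σ ∈ F.cones, τ ≤ σ
  support_eq : F'.support = F.support

/-! Helper facts on semigroups of faces -/

lemma pairing_add (m m' : Module.Dual ℤ N) (x : ℝ ⊗[ℤ] N) :
    pairing (m + m') x = pairing m x + pairing m' x := by
  simp [pairing]

lemma pairing_neg (m : Module.Dual ℤ N) (x : ℝ ⊗[ℤ] N) :
    pairing (-m) x = -pairing m x := by
  simp [pairing]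

lemma pairing_tmul (m : Module.Dual ℤ N) (v : N) :
    pairing m ((1 : ℝ) ⊗ₜ[ℤ] v) = m v := by
  simp [pairing]

lemma dualMonoid_anti {τ σ : PointedCone ℝ (ℝ ⊗[ℤ] N)} (h : τ ≤ σ) :
    dualMonoid σ ≤ dualMonoid τ := fun _ hm x hx => hm x (h hx)

lemma mem_dualMonoid_latticeCone {s : Set N} {m : Module.Dual ℤ N} :
    m ∈ dualMonoid (latticeCone s) ↔ ∀ v ∈ s, 0 ≤ m v := by
  constructor
  · intro h v hv
    have := h _ (Submodule.subset_span (Set.mem_image_of_mem _ hv))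
    rw [pairing_tmul] at this
    exact_mod_cast this
  · intro h x hx
    refine Submodule.span_induction (p := fun x _ => 0 ≤ pairing m x) ?_ ?_ ?_ ?_ hx
    · rintro _ ⟨v, hv, rfl⟩
      simp only [pairing_tmul]
      exact_mod_cast h v hv
    · simp
    · intro x y _ _ hx hy
      simpa using add_nonneg hx hy
    · intro a x _ hx
      have : pairing m (a • x) = (a : ℝ) * pairing m x := by
        rw [show a • x = (a : ℝ) • x from rfl, map_smul, smul_eq_mul]
      rw [this]
      exact mul_nonneg a.2 hx

/-- If `τ = σ ∩ m^⊥`, then every element of `S_τ` becomes an element of `S_σ` after adding a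
multiple of `m`. -/
lemma exists_add_nsmul_mem {τ σ : PointedCone ℝ (ℝ ⊗[ℤ] N)} (hσ : IsRationalPolyhedral σ)
    {m : Module.Dual ℤ N} (hm : m ∈ dualMonoid σ)
    (hτ : ∀ x, x ∈ τ ↔ x ∈ σ ∧ pairing m x = 0) {w : Module.Dual ℤ N} (hw : w ∈ dualMonoid τ) :
    ∃ k : ℕ, w + k • m ∈ dualMonoid σ := by
  obtain ⟨s, hs, rfl⟩ := hσ
  have hms := mem_dualMonoid_latticeCone.1 hm
  refine ⟨∑ v ∈ hs.toFinset, (w v).natAbs, mem_dualMonoid_latticeCone.2 fun v hv => ?_⟩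
  have hle : (w v).natAbs ≤ ∑ v ∈ hs.toFinset, (w v).natAbs :=
    Finset.single_le_sum (f := fun v => (w v).natAbs) (fun _ _ => Nat.zero_le _)
      (hs.mem_toFinset.2 hv)
  generalize ∑ v ∈ hs.toFinset, (w v).natAbs = k at hle
  simp only [LinearMap.add_apply, LinearMap.smul_apply, nsmul_eq_mul]
  rcases (hms v hv).eq_or_lt with h0 | h1
  · have : (1 : ℝ) ⊗ₜ[ℤ] v ∈ τ := (hτ _).2
      ⟨Submodule.subset_span (Set.mem_image_of_mem _ hv), by rw [pairing_tmul, ← h0]; simp⟩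
    have := hw _ this
    rw [pairing_tmul] at this
    have : 0 ≤ w v := by exact_mod_cast this
    rw [← h0]
    simpa using this
  · have h2 : (k : ℤ) ≤ k * m v := by nlinarith
    have h3 : -w v ≤ (w v).natAbs := by omega
    have h4 : ((w v).natAbs : ℤ) ≤ k := by exact_mod_cast hle
    linarith

end Cones

/-! ### The toric variety of a fan -/

section Toric

variable {N : Type} [AddCommGroup N]

/-- The ring `ℂ[σ^∨ ∩ M]`. -/
abbrev coneRing (σ : PointedCone ℝ (ℝ ⊗[ℤ] N)) : Type := AddMonoidAlgebra ℂ (dualMonoid σ)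

/-- The inclusion `ℂ[S_σ] → ℂ[S_τ]` for `τ ⊆ σ`. -/
def coneRingMap {τ σ : PointedCone ℝ (ℝ ⊗[ℤ] N)} (h : τ ≤ σ) : coneRing σ →+* coneRing τ :=
  AddMonoidAlgebra.mapDomainRingHom ℂ (AddSubmonoid.inclusion (dualMonoid_anti h))

variable (N) in
/-- The functor `σ ↦ U_σ = Spec ℂ[S_σ]` on cones ordered by inclusion. -/
def affineToric : PointedCone ℝ (ℝ ⊗[ℤ] N) ⥤ Scheme.{0} where
  obj σ := Spec (.of (coneRing σ))
  map f := Spec.map (CommRingCat.ofHom (coneRingMap (leOfHom f)))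
  map_id σ := by
    rw [← Spec.map_id]
    congr 1
    ext1
    exact AddMonoidAlgebra.mapDomainRingHom_id
  map_comp f g := by
    rw [← Spec.map_comp]
    congr 1
    ext1
    exact AddMonoidAlgebra.mapDomainRingHom_comp (R := ℂ)
      (AddSubmonoid.inclusion (dualMonoid_anti (leOfHom f)))
      (AddSubmonoid.inclusion (dualMonoid_anti (leOfHom g)))

lemma isLocalization_coneRing {τ σ : PointedCone ℝ (ℝ ⊗[ℤ] N)} (hσ : IsRationalPolyhedral σ)
    (h : τ ≤ σ) {m : Module.Dual ℤ N} (hm : m ∈ dualMonoid σ)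
    (hτ : ∀ x, x ∈ τ ↔ x ∈ σ ∧ pairing m x = 0) :
    letI := (coneRingMap h).toAlgebra
    IsLocalization.Away (AddMonoidAlgebra.single (⟨m, hm⟩ : dualMonoid σ) (1 : ℂ))
      (coneRing τ) := by
  let := (coneRingMap h).toAlgebra
  have hinj : Function.Injective (coneRingMap h) :=
    AddMonoidAlgebra.mapDomain_injective (AddSubmonoid.inclusion_injective _)
  have hsingle (w : dualMonoid σ) (a : ℂ) : coneRingMap h (AddMonoidAlgebra.single w a) =
      AddMonoidAlgebra.single (AddSubmonoid.inclusion (dualMonoid_anti h) w) a := by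
    simp [coneRingMap]
  have hneg : -m ∈ dualMonoid τ := fun x hx => by
    rw [pairing_neg, ((hτ x).1 hx).2, neg_zero]
  refine IsLocalization.Away.mk _ ?_ ?_ ?_
  · refine IsUnit.of_mul_eq_one (AddMonoidAlgebra.single (⟨-m, hneg⟩ : dualMonoid τ) (1 : ℂ)) ?_
    change coneRingMap h _ * _ = 1
    rw [hsingle, AddMonoidAlgebra.single_mul_single, AddMonoidAlgebra.one_def]
    congr 1
    · ext1
      simp
    · simp
  · intro z
    change ∃ n a, z * coneRingMap h _ ^ n = coneRingMap h a
    induction z using AddMonoidAlgebra.induction_linear with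
    | zero => exact ⟨0, 0, by simp⟩
    | add x y hx hy =>
      obtain ⟨n, a, ha⟩ := hx
      obtain ⟨k, b, hb⟩ := hy
      refine ⟨n + k, a * AddMonoidAlgebra.single (⟨m, hm⟩ : dualMonoid σ) (1 : ℂ) ^ k +
        b * AddMonoidAlgebra.single (⟨m, hm⟩ : dualMonoid σ) (1 : ℂ) ^ n, ?_⟩
      rw [map_add, map_mul, map_mul, map_pow, map_pow, ← ha, ← hb]
      ring
    | single w a =>
      obtain ⟨k, hk⟩ := exists_add_nsmul_mem hσ hm hτ w.2
      refine ⟨k, AddMonoidAlgebra.single ⟨_, hk⟩ a, ?_⟩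
      rw [hsingle, hsingle, AddMonoidAlgebra.single_pow, AddMonoidAlgebra.single_mul_single]
      congr 1
      simp
  · intro a b hab
    exact ⟨0, by rw [hinj hab]⟩

lemma isOpenImmersion_affineToric {τ σ : PointedCone ℝ (ℝ ⊗[ℤ] N)} (hσ : IsRationalPolyhedral σ)
    (hf : IsFace τ σ) (h : τ ⟶ σ) : IsOpenImmersion ((affineToric N).map h) := by
  obtain ⟨m, hm, hτ⟩ := hf
  let := (coneRingMap (leOfHom h)).toAlgebra
  have := isLocalization_coneRing hσ (leOfHom h) hm hτ
  exact IsOpenImmersion.of_isLocalization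
    (AddMonoidAlgebra.single (⟨m, hm⟩ : dualMonoid σ) (1 : ℂ))

lemma range_affineToric {τ σ : PointedCone ℝ (ℝ ⊗[ℤ] N)} (hσ : IsRationalPolyhedral σ)
    {m : Module.Dual ℤ N} (hm : m ∈ dualMonoid σ)
    (hτ : ∀ x, x ∈ τ ↔ x ∈ σ ∧ pairing m x = 0) (h : τ ⟶ σ) :
    Set.range ((affineToric N).map h) =
      (PrimeSpectrum.basicOpen (AddMonoidAlgebra.single (⟨m, hm⟩ : dualMonoid σ) (1 : ℂ)) :
        Set (PrimeSpectrum (coneRing σ))) := by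
  let := (coneRingMap (leOfHom h)).toAlgebra
  have := isLocalization_coneRing hσ (leOfHom h) hm hτ
  exact PrimeSpectrum.localization_away_comap_range _ _

/-- The structure morphism of `U_σ` over `Spec ℂ`. -/
def affineToSpecC (σ : PointedCone ℝ (ℝ ⊗[ℤ] N)) : (affineToric N).obj σ ⟶ Spec (.of ℂ) :=
  Spec.map (CommRingCat.ofHom (algebraMap ℂ (coneRing σ)))

lemma affineToSpecC_w {τ σ : PointedCone ℝ (ℝ ⊗[ℤ] N)} (h : τ ⟶ σ) :
    (affineToric N).map h ≫ affineToSpecC σ = affineToSpecC τ := by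
  change Spec.map _ ≫ Spec.map _ = Spec.map _
  rw [← Spec.map_comp, ← CommRingCat.ofHom_comp]
  congr 2
  ext1 a
  simp [coneRingMap]

namespace Fan

variable (F : Fan N)

/-- The diagram of the affine toric varieties `U_σ`, for `σ` in the fan. -/
def diagram : F.cones ⥤ Scheme.{0} :=
  (Subtype.mono_coe (· ∈ F.cones)).functor ⋙ affineToric N

lemma isFace_of_le {σ τ : F.cones} (h : τ ≤ σ) : IsFace τ.1 σ.1 := by
  have := (F.inter_face σ σ.2 τ τ.2).1
  rwa [inf_eq_right.2 (show τ.1 ≤ σ.1 from h)] at this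

instance (σ τ : F.cones) (f : τ ⟶ σ) : IsOpenImmersion (F.diagram.map f) :=
  isOpenImmersion_affineToric (F.rational _ σ.2) (F.isFace_of_le (leOfHom f))
    (homOfLE (show τ.1 ≤ σ.1 from leOfHom f))

instance : (F.diagram ⋙ Scheme.forget).IsLocallyDirected where
  cond {i j k} fi fj xi xj hx := by
    obtain ⟨mi, hmi, hi⟩ := F.isFace_of_le (leOfHom fi)
    obtain ⟨mj, hmj, hj⟩ := F.isFace_of_le (leOfHom fj)
    have hl : i.1 ⊓ j.1 ∈ F.cones :=
      F.face_mem _ i.2 _ (F.inter_face _ i.2 _ j.2).1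
    let l : F.cones := ⟨i.1 ⊓ j.1, hl⟩
    let fli : l ⟶ i := homOfLE (show l.1 ≤ i.1 from inf_le_left)
    let flj : l ⟶ j := homOfLE (show l.1 ≤ j.1 from inf_le_right)
    have hlk : ∀ x, x ∈ l.1 ↔ x ∈ k.1 ∧ pairing (mi + mj) x = 0 := by
      intro x
      change x ∈ i.1 ∧ x ∈ j.1 ↔ _
      rw [hi, hj, pairing_add]
      constructor
      · rintro ⟨⟨h1, h2⟩, -, h3⟩
        exact ⟨h1, by rw [h2, h3, add_zero]⟩
      · rintro ⟨h1, h2⟩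
        have h3 := hmi x h1
        have h4 := hmj x h1
        exact ⟨⟨h1, by linarith⟩, h1, by linarith⟩
    have hk := F.rational _ k.2
    have h1 : F.diagram.map fi xi ∈ Set.range (F.diagram.map fi) := ⟨xi, rfl⟩
    have h2 : F.diagram.map fi xi ∈ Set.range (F.diagram.map fj) := ⟨xj, hx.symm⟩
    have h3 : F.diagram.map fi xi ∈ Set.range (F.diagram.map (fli ≫ fi)) := by
      rw [show Set.range (F.diagram.map fi) = _ from range_affineToric hk hmi hi
        (homOfLE (show i.1 ≤ k.1 from leOfHom fi))] at h1
      rw [show Set.range (F.diagram.map fj) = _ from range_affineToric hk hmj hj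
        (homOfLE (show j.1 ≤ k.1 from leOfHom fj))] at h2
      rw [show Set.range (F.diagram.map (fli ≫ fi)) = _ from
        range_affineToric hk (add_mem hmi hmj) hlk
        (homOfLE (show l.1 ≤ k.1 from leOfHom (fli ≫ fi)))]
      have hmul : AddMonoidAlgebra.single (⟨mi + mj, add_mem hmi hmj⟩ : dualMonoid k.1) (1 : ℂ) =
          AddMonoidAlgebra.single ⟨mi, hmi⟩ 1 * AddMonoidAlgebra.single ⟨mj, hmj⟩ 1 := by
        rw [AddMonoidAlgebra.single_mul_single, one_mul]
        rfl
      rw [hmul, PrimeSpectrum.basicOpen_mul]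
      exact ⟨h1, h2⟩
    obtain ⟨x, hxl⟩ := h3
    refine ⟨l, fli, flj, x, ?_, ?_⟩
    · refine (F.diagram.map fi).isOpenEmbedding.injective ?_
      rw [← hxl, Functor.map_comp]
      rfl
    · refine (F.diagram.map fj).isOpenEmbedding.injective ?_
      refine Eq.trans ?_ hx
      change _ = F.diagram.map fi xi
      rw [← hxl, show fli ≫ fi = flj ≫ fj from rfl, Functor.map_comp]
      rfl

/-- The toric variety `X_F` of a fan: the affine varieties `U_σ = Spec ℂ[σ^∨ ∩ M]`, glued along
the open immersions `U_τ → U_σ` for the faces `τ` of `σ`. -/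
def toricVariety : Scheme.{0} := colimit F.diagram

/-- The open immersion `U_σ → X_F`. -/
def chart (σ : F.cones) : (affineToric N).obj σ.1 ⟶ F.toricVariety := colimit.ι F.diagram σ

lemma map_chart {σ τ : F.cones} (h : τ ≤ σ) :
    (affineToric N).map (homOfLE (show τ.1 ≤ σ.1 from h)) ≫ F.chart σ = F.chart τ :=
  colimit.w F.diagram (homOfLE h)

/-- The structure morphism of `X_F` over `Spec ℂ`. -/
def toSpecC : F.toricVariety ⟶ Spec (.of ℂ) :=
  colimit.desc F.diagram
    { pt := Spec (.of ℂ)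
      ι :=
        { app := fun σ => affineToSpecC σ.1
          naturality := fun τ σ f =>
            (affineToSpecC_w (homOfLE (show τ.1 ≤ σ.1 from leOfHom f))).trans
              (Category.comp_id _).symm } }

variable {F} {F' : Fan N}

lemma chart_wd (τ : PointedCone ℝ (ℝ ⊗[ℤ] N)) (σ₁ σ₂ : F.cones) (h₁ : τ ≤ σ₁.1) (h₂ : τ ≤ σ₂.1) :
    (affineToric N).map (homOfLE h₁) ≫ F.chart σ₁ =
      (affineToric N).map (homOfLE h₂) ≫ F.chart σ₂ := by
  let l : F.cones := ⟨σ₁.1 ⊓ σ₂.1, F.face_mem _ σ₁.2 _ (F.inter_face _ σ₁.2 _ σ₂.2).1⟩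
  have h : τ ≤ l.1 := le_inf h₁ h₂
  have e₁ : homOfLE h₁ = homOfLE h ≫ homOfLE (inf_le_left : l.1 ≤ σ₁.1) := rfl
  have e₂ : homOfLE h₂ = homOfLE h ≫ homOfLE (inf_le_right : l.1 ≤ σ₂.1) := rfl
  rw [e₁, e₂, Functor.map_comp, Functor.map_comp, Category.assoc, Category.assoc,
    F.map_chart (σ := σ₁) (τ := l) (inf_le_left : l.1 ≤ σ₁.1),
    F.map_chart (σ := σ₂) (τ := l) (inf_le_right : l.1 ≤ σ₂.1)]

/-- A cone of `F` that contains `τ ∈ F'`, for a refinement `F'` of `F`. -/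
def refineCone (h : F'.Refines F) (τ : F'.cones) : F.cones :=
  ⟨(h.exists_le τ.1 τ.2).choose, (h.exists_le τ.1 τ.2).choose_spec.1⟩

lemma le_refineCone (h : F'.Refines F) (τ : F'.cones) : τ.1 ≤ (refineCone h τ).1 :=
  (h.exists_le τ.1 τ.2).choose_spec.2

/-- The morphism `U_τ → U_σ → X_F` for `τ ∈ F'`; it is the same for all `σ ∈ F` that contain `τ`,
see `refineChart_eq`. -/
def refineChart (h : F'.Refines F) (τ : F'.cones) :
    (affineToric N).obj τ.1 ⟶ F.toricVariety :=
  (affineToric N).map (homOfLE (le_refineCone h τ)) ≫ F.chart (refineCone h τ)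

lemma refineChart_eq (h : F'.Refines F) (τ : F'.cones) (σ : F.cones) (hτ : τ.1 ≤ σ.1) :
    refineChart h τ = (affineToric N).map (homOfLE hτ) ≫ F.chart σ :=
  chart_wd τ.1 (refineCone h τ) σ (le_refineCone h τ) hτ

lemma refineChart_w (h : F'.Refines F) {τ τ' : F'.cones} (f : τ.1 ⟶ τ'.1) :
    (affineToric N).map f ≫ refineChart h τ' = refineChart h τ := by
  rw [refineChart_eq h τ (refineCone h τ') ((leOfHom f).trans (le_refineCone h τ')), refineChart,
    ← Category.assoc, ← Functor.map_comp]
  rfl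

/-- The toric morphism `X_F' → X_F` induced by the identity of `N`, for a refinement `F'` of
`F`. -/
def toricMorphism (h : F'.Refines F) : F'.toricVariety ⟶ F.toricVariety :=
  colimit.desc F'.diagram
    { pt := F.toricVariety
      ι :=
        { app := fun τ => refineChart h τ
          naturality := fun τ τ' f =>
            (refineChart_w h (homOfLE (show τ.1 ≤ τ'.1 from leOfHom f))).trans
              (Category.comp_id _).symm } }

end Fan

end Toric

/-! ### Exceptional locus, trees of projective lines, cellular varieties -/

section Geometry

/-- The reduced closed subscheme on a closed subset. -/
def reducedSubscheme {X : Scheme.{0}} (Z : Closeds X) : Scheme.{0} :=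
  (Scheme.IdealSheafData.vanishingIdeal Z).subscheme

/-- Its inclusion. -/
def reducedSubschemeι {X : Scheme.{0}} (Z : Closeds X) : reducedSubscheme Z ⟶ X :=
  (Scheme.IdealSheafData.vanishingIdeal Z).subschemeι

/-- The exceptional locus of `f : X ⟶ Y`: the closed set of the points of `X` at which `f` is not a
local isomorphism. -/
def exceptionalLocus {X Y : Scheme.{0}} (f : X ⟶ Y) : Closeds X :=
  (sSup {U : X.Opens | IsOpenImmersion (U.ι ≫ f)}).compl

/-- The largest open subscheme of `X` that is smooth over `S`. -/
def smoothLocus {X S : Scheme.{0}} (s : X ⟶ S) : X.Opens :=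
  sSup {U : X.Opens | Smooth (U.ι ≫ s)}

/-- The singular locus of a variety `s : X ⟶ Spec ℂ`. -/
def singularLocus {X S : Scheme.{0}} (s : X ⟶ S) : Closeds X := (smoothLocus s).compl

/-- The polynomial ring in two variables over `ℂ`, graded by the degree. -/
abbrev lineGrading : ℕ → Submodule ℂ (MvPolynomial (Fin 2) ℂ) :=
  MvPolynomial.homogeneousSubmodule (Fin 2) ℂ

instance : GradedAlgebra lineGrading := MvPolynomial.gradedAlgebra

/-- The complex projective line `Proj ℂ[x₀, x₁]`. -/
def projLine : Scheme.{0} := Proj lineGrading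

/-- Its structure morphism. -/
def projLineToSpecC : projLine ⟶ Spec (.of ℂ) :=
  Proj.toSpecZero lineGrading ≫ Spec.map (CommRingCat.ofHom (algebraMap ℂ (lineGrading 0)))

/-- `Y` is a "tree" of projective lines: a reduced scheme over `ℂ` which is the union of closed
subschemes `ℓ 0, …, ℓ k` isomorphic to `ℙ¹` such that the scheme-theoretic intersection of `ℓ i` and
`ℓ (i + 1)` is a reduced `ℂ`-rational point (so they meet transversally in one point) and there are
no other intersections; in particular no three of the lines have a common point. -/
def IsTreeOfLines (Y : Scheme.{0}) (s : Y ⟶ Spec (.of ℂ)) : Prop :=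
  IsReduced Y ∧ ∃ (k : ℕ) (ℓ : Fin (k + 1) → (projLine ⟶ Y)),
    (∀ i, IsClosedImmersion (ℓ i) ∧ ℓ i ≫ s = projLineToSpecC) ∧
    (⋃ i, Set.range (ℓ i)) = Set.univ ∧
    (∀ i : Fin k, IsIso (pullback.fst (ℓ i.castSucc) (ℓ i.succ) ≫ projLineToSpecC)) ∧
    (∀ i j : Fin (k + 1), i.val + 1 < j.val → Disjoint (Set.range (ℓ i)) (Set.range (ℓ j)))

/-- `Y` is a disjoint union of finitely many trees of projective lines. -/
def IsDisjointUnionOfTrees (Y : Scheme.{0}) (s : Y ⟶ Spec (.of ℂ)) : Prop :=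
  ∃ (n : ℕ) (U : Fin n → Y.Opens), Pairwise (fun a b => Disjoint (U a) (U b)) ∧ (⨆ a, U a) = ⊤ ∧
    ∀ a, IsTreeOfLines (U a).toScheme ((U a).ι ≫ s)

/-- `Y` is a disjoint union of finitely many affine spaces over `ℂ`, of any dimensions. -/
def IsDisjointUnionOfAffineSpaces (Y : Scheme.{0}) (s : Y ⟶ Spec (.of ℂ)) : Prop :=
  ∃ (n : ℕ) (U : Fin n → Y.Opens) (d : Fin n → ℕ),
    Pairwise (fun a b => Disjoint (U a) (U b)) ∧ (⨆ a, U a) = ⊤ ∧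
    ∀ a, ∃ e : (U a).toScheme ≅ 𝔸(Fin (d a); Spec (.of ℂ)),
      e.hom ≫ (𝔸(Fin (d a); Spec (.of ℂ)) ↘ Spec (.of ℂ)) = (U a).ι ≫ s

/-- The difference `Z' \ Z` of closed subsets, with its reduced structure: an open subscheme of the
reduced closed subscheme on `Z'`. -/
def reducedDifference {X : Scheme.{0}} (Z' Z : Closeds X) : (reducedSubscheme Z').Opens :=
  (reducedSubschemeι Z') ⁻¹ᵁ Z.compl

/-- `X` admits a cellular decomposition: a filtration `∅ = Z 0 ⊆ Z 1 ⊆ ⋯ ⊆ Z n = X` by closed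
subvarieties whose successive differences are disjoint unions of affine spaces. -/
def IsCellular (X : Scheme.{0}) (s : X ⟶ Spec (.of ℂ)) : Prop :=
  ∃ (n : ℕ) (Z : ℕ → Closeds X), Monotone Z ∧ Z 0 = ⊥ ∧ Z n = ⊤ ∧
    ∀ i < n, IsDisjointUnionOfAffineSpaces (reducedDifference (Z (i + 1)) (Z i)).toScheme
      ((reducedDifference (Z (i + 1)) (Z i)).ι ≫ reducedSubschemeι (Z (i + 1)) ≫ s)

end Geometry

end ToricSurface

end

open ToricSurface

noncomputable section

namespace ToricSurface

/-! ### Plane cones -/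

section PlaneCones

variable {N : Type} [AddCommGroup N]

/-! Fix a basis of `N` and let `area b u v` be the determinant of `u, v`. Its sign tells on which
side of `u` the vector `v` lies, and `area b u v = 1` says that `u, v` is an oriented basis. Call a
ray of `F'` new if it does not belong to `F`; all of `E` is read off from the new rays.

Convex geometry: a new ray `u` lies in the interior of a cone `σ` of `F`, because no non-zero `m` in
the dual monoid of `σ` vanishes on it (`IsNewRay.dual_eq_zero`). Hence `σ` is unique
(`IsNewRay.cone_unique`), and since the supports agree, `u` is the common edge of two cones `cone₂ u
v` and `cone₂ w u` of `F'` (`IsNewRay.exists_next`, `IsNewRay.exists_prev`). A cone of `F'` without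
new rays is a cone of `F` (`mem_cones_of_forall_not_isNewRay`).

Geometry: let `D_u` be the closure of the orbit of `u` (`Fan.orbitClosure`). It is an affine line in
each of the two charts, with coordinates inverse to each other because `v + w` is a multiple of `u`;
so `D_u` is a projective line (`HasNeighbours.exists_isOrbitLine`). On `σ` only `m = 0` satisfies `m
u = 0`, so `f` contracts `D_u` to a point, while `f` is a local isomorphism off the lines `D_u`.
Hence `E` is the union of the `D_u` over the new rays (`Fan.mem_exceptionalLocus_iff`).

Two lines `D_u`, `D_v` meet exactly when `u, v` span a cone of `F'`, and then transversally in one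
point (`isPushout_edgeHom`). The new rays in one cone of `F`, in angular order, therefore give a
chain of lines, and different cones of `F` give disjoint chains. For the cells, an angularly last
ray `u` is removed from a finite set of new rays: `D_u` contributes an affine line and at most one
further point (`hasCellularFiltration_sup`). Finally `X_F'` is smooth, so `f` maps its local
isomorphism locus to smooth points; if `f` is an isomorphism over the smooth locus, the two loci
correspond (`coe_exceptionalLocus_eq`). -/

/-- The image in `N_ℝ` of a lattice vector. -/
abbrev lat (v : N) : ℝ ⊗[ℤ] N := (1 : ℝ) ⊗ₜ[ℤ] v

lemma pairing_lat (m : Module.Dual ℤ N) (v : N) : pairing m (lat v) = m v := pairing_tmul m v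

lemma lat_mem_latticeCone {s : Set N} {v : N} (hv : v ∈ s) : lat v ∈ latticeCone s :=
  Submodule.subset_span (Set.mem_image_of_mem _ hv)

lemma real_smul_mem {σ : PointedCone ℝ (ℝ ⊗[ℤ] N)} {x : ℝ ⊗[ℤ] N} (hx : x ∈ σ) {c : ℝ}
    (hc : 0 ≤ c) : c • x ∈ σ :=
  Submodule.smul_mem σ (⟨c, hc⟩ : {c : ℝ // 0 ≤ c}) hx

lemma latticeCone_le {s : Set N} {σ : PointedCone ℝ (ℝ ⊗[ℤ] N)} (h : ∀ v ∈ s, lat v ∈ σ) :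
    latticeCone s ≤ σ :=
  Submodule.span_le.2 (by rintro _ ⟨v, hv, rfl⟩; exact h v hv)

/-- The ray generated by a lattice vector. -/
def ray (u : N) : PointedCone ℝ (ℝ ⊗[ℤ] N) := latticeCone {u}

/-- The cone generated by two lattice vectors. -/
def cone₂ (u v : N) : PointedCone ℝ (ℝ ⊗[ℤ] N) := latticeCone {u, v}

lemma left_mem_cone₂ (u v : N) : lat u ∈ cone₂ u v := lat_mem_latticeCone (by simp)
lemma right_mem_cone₂ (u v : N) : lat v ∈ cone₂ u v := lat_mem_latticeCone (by simp)
lemma mem_ray (u : N) : lat u ∈ ray u := lat_mem_latticeCone (by simp)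

lemma ray_le {u : N} {σ : PointedCone ℝ (ℝ ⊗[ℤ] N)} : ray u ≤ σ ↔ lat u ∈ σ :=
  ⟨fun h => h (mem_ray u), fun h => latticeCone_le (by simpa using h)⟩

lemma cone₂_le {u v : N} {σ : PointedCone ℝ (ℝ ⊗[ℤ] N)} :
    cone₂ u v ≤ σ ↔ lat u ∈ σ ∧ lat v ∈ σ :=
  ⟨fun h => ⟨h (left_mem_cone₂ u v), h (right_mem_cone₂ u v)⟩,
    fun h => latticeCone_le (by simpa using h)⟩

lemma mem_dualMonoid_ray {u : N} {m : Module.Dual ℤ N} : m ∈ dualMonoid (ray u) ↔ 0 ≤ m u := by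
  simp [ray, mem_dualMonoid_latticeCone]

lemma mem_dualMonoid_cone₂ {u v : N} {m : Module.Dual ℤ N} :
    m ∈ dualMonoid (cone₂ u v) ↔ 0 ≤ m u ∧ 0 ≤ m v := by
  simp [cone₂, mem_dualMonoid_latticeCone]

lemma nonneg_of_mem_dualMonoid {σ : PointedCone ℝ (ℝ ⊗[ℤ] N)} {m : Module.Dual ℤ N}
    (hm : m ∈ dualMonoid σ) {u : N} (hu : lat u ∈ σ) : 0 ≤ m u := by
  have := hm _ hu
  rw [pairing_lat] at this
  exact_mod_cast this

lemma isRationalPolyhedral_cone₂ (u v : N) : IsRationalPolyhedral (cone₂ u v) :=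
  ⟨_, Set.toFinite {u, v}, rfl⟩

lemma pairing_real_tmul (m : Module.Dual ℤ N) (r : ℝ) (v : N) :
    pairing m (r ⊗ₜ[ℤ] v) = r * m v := by
  simp [pairing, mul_comm]

variable (b : Module.Basis (Fin 2) ℤ N)

/-- The area form of a rank two lattice with respect to a basis. -/
def area (u : N) : Module.Dual ℤ N := b.coord 0 u • b.coord 1 - b.coord 1 u • b.coord 0

lemma area_apply (u v : N) :
    area b u v = b.coord 0 u * b.coord 1 v - b.coord 1 u * b.coord 0 v := by
  simp [area]

@[simp] lemma area_self (u : N) : area b u u = 0 := by rw [area_apply]; ring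

lemma area_swap (u v : N) : area b u v = -area b v u := by rw [area_apply, area_apply]; ring

lemma area_reindex_swap (u v : N) :
    area (b.reindex (Equiv.swap 0 1)) u v = area b v u := by
  simp [area_apply]; ring

lemma dual_apply_eq (m : Module.Dual ℤ N) (w : N) :
    m w = b.coord 0 w * m (b 0) + b.coord 1 w * m (b 1) := by
  conv_lhs => rw [← b.sum_repr w]
  rw [Fin.sum_univ_two, map_add, map_smul, map_smul]
  rfl

/-- Three vectors of a rank two lattice are dependent, with the areas as coefficients; this is `m`
applied to that relation. Most sign arguments on the angular order reduce to it. -/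
lemma area_mul_dual (m : Module.Dual ℤ N) (u v w : N) :
    area b u v * m w = m v * area b u w - m u * area b v w := by
  rw [dual_apply_eq b m u, dual_apply_eq b m v, dual_apply_eq b m w]
  simp only [area_apply]
  ring

variable {b}

lemma eq_combination {u v : N} (h : area b u v = 1) (w : N) :
    w = (-area b v w) • u + area b u w • v := by
  refine b.ext_elem fun i => ?_
  have := area_mul_dual b (b.coord i) u v w
  rw [h, one_mul] at this
  simp only [Module.Basis.coord_apply] at this
  rw [this]
  simp only [map_add, map_smul, Finsupp.add_apply, Finsupp.smul_apply, smul_eq_mul]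
  ring

lemma real_eq_combination {u v : N} (h : area b u v = 1) (x : ℝ ⊗[ℤ] N) :
    x = (-pairing (area b v) x) • lat u + pairing (area b u) x • lat v := by
  induction x using TensorProduct.induction_on with
  | zero => simp
  | add x y hx hy =>
    conv_lhs => rw [hx, hy]
    simp only [map_add]
    module
  | tmul r w =>
    conv_lhs => rw [eq_combination h w]
    simp only [pairing_real_tmul, TensorProduct.tmul_add, TensorProduct.tmul_smul]
    simp only [TensorProduct.smul_tmul', smul_eq_mul, mul_one, zsmul_eq_mul]
    push_cast
    congr 2 <;> ring

lemma pairing_eq_combination {u v : N} (h : area b u v = 1) (m : Module.Dual ℤ N)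
    (x : ℝ ⊗[ℤ] N) :
    pairing m x = m v * pairing (area b u) x - m u * pairing (area b v) x := by
  conv_lhs => rw [real_eq_combination h x]
  simp only [map_add, map_smul, pairing_lat, smul_eq_mul]
  ring

lemma dual_eq_zero_of_area_eq_one {u v : N} (h : area b u v = 1) {m : Module.Dual ℤ N}
    (hu : m u = 0) (hv : m v = 0) : m = 0 := by
  ext w
  have := area_mul_dual b m u v w
  simpa [h, hu, hv] using this

lemma mem_cone₂_iff {u v : N} (h : area b u v = 1) {x : ℝ ⊗[ℤ] N} :
    x ∈ cone₂ u v ↔ 0 ≤ pairing (area b u) x ∧ pairing (area b v) x ≤ 0 := by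
  constructor
  · intro hx
    have h1 : area b u ∈ dualMonoid (cone₂ u v) := mem_dualMonoid_cone₂.2 (by simp [h])
    have h2 : -area b v ∈ dualMonoid (cone₂ u v) :=
      mem_dualMonoid_cone₂.2 (by simp [area_swap b v u, h])
    have h2 := h2 x hx
    rw [pairing_neg] at h2
    exact ⟨h1 x hx, by linarith⟩
  · rintro ⟨h1, h2⟩
    rw [real_eq_combination h x]
    exact add_mem (real_smul_mem (left_mem_cone₂ u v) (by linarith))
      (real_smul_mem (right_mem_cone₂ u v) h1)

lemma lat_mem_cone₂_iff {u v : N} (h : area b u v = 1) {w : N} :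
    lat w ∈ cone₂ u v ↔ 0 ≤ area b u w ∧ area b v w ≤ 0 := by
  rw [mem_cone₂_iff h, pairing_lat, pairing_lat]
  norm_cast

lemma mem_ray_iff {u v : N} (h : area b u v = 1) {x : ℝ ⊗[ℤ] N} :
    x ∈ ray u ↔ pairing (area b u) x = 0 ∧ pairing (area b v) x ≤ 0 := by
  constructor
  · intro hx
    have h1 : area b u ∈ dualMonoid (ray u) := mem_dualMonoid_ray.2 (by simp)
    have h1' : -area b u ∈ dualMonoid (ray u) := mem_dualMonoid_ray.2 (by simp)
    have h2 : -area b v ∈ dualMonoid (ray u) :=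
      mem_dualMonoid_ray.2 (by simp [area_swap b v u, h])
    have h1 := h1 x hx
    have h2 := h2 x hx
    have h1' := h1' x hx
    rw [pairing_neg] at h2 h1'
    exact ⟨by linarith, by linarith⟩
  · rintro ⟨h1, h2⟩
    rw [real_eq_combination h x, h1, zero_smul, add_zero]
    exact real_smul_mem (mem_ray u) (by linarith)

lemma lat_mem_ray_iff {u v : N} (h : area b u v = 1) {w : N} :
    lat w ∈ ray u ↔ area b u w = 0 ∧ area b v w ≤ 0 := by
  rw [mem_ray_iff h, pairing_lat, pairing_lat]
  norm_cast

variable (b) in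
/-- A primitive lattice vector: one that belongs to a basis. -/
def IsPrim (u : N) : Prop := ∃ v, area b u v = 1

lemma isPrim_of_area_right {u v : N} (h : area b u v = 1) : IsPrim b v :=
  ⟨-u, by rw [map_neg, ← area_swap, h]⟩

/-- A primitive vector is determined by the ray that it generates. -/
lemma eq_of_lat_mem_ray {u w : N} (hu : IsPrim b u) (hw : IsPrim b w) (h : lat w ∈ ray u) :
    w = u := by
  obtain ⟨v, hv⟩ := hu
  obtain ⟨z, hz⟩ := hw
  obtain ⟨h1, h2⟩ := (lat_mem_ray_iff hv).1 h
  have hc := eq_combination hv w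
  rw [h1, zero_smul, add_zero] at hc
  generalize -area b v w = c at hc h2
  have h2 : 0 ≤ c := by simpa [hc, area_swap b v u, hv] using h2
  have h3 : 1 = c * area b u z := by
    rw [← hz, area_swap b w z, area_swap b u z, hc, map_smul, smul_eq_mul]
    ring
  rw [hc, Int.eq_one_of_mul_eq_one_right h2 h3.symm, one_smul]

lemma ray_injective {u w : N} (hu : IsPrim b u) (hw : IsPrim b w) (h : ray u = ray w) : u = w :=
  eq_of_lat_mem_ray hw hu (h ▸ mem_ray u)

lemma lat_ne_zero {u : N} (hu : IsPrim b u) : lat u ≠ 0 := by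
  obtain ⟨v, hv⟩ := hu
  intro h
  have := congrArg (pairing (area b v)) h
  rw [pairing_lat, area_swap, hv] at this
  simp at this

-- The determinant of a change of basis is `±1`, and exchanging the two vectors makes it `1`. A
-- single basis vector also has a partner of area `1`, possibly after a change of sign.
variable (b) in
lemma isSmoothCone_cases {σ : PointedCone ℝ (ℝ ⊗[ℤ] N)} (hσ : IsSmoothCone σ) :
    σ = ⊥ ∨ ∃ u v, area b u v = 1 ∧ (σ = ray u ∨ σ = cone₂ u v) := by
  obtain ⟨ι, c, s, rfl⟩ := hσ
  let e : ι ≃ Fin 2 := c.indexEquiv b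
  have hs : c '' s = (c.reindex e) '' (e '' s) := by
    rw [Set.image_image]; simp
  rw [hs]
  generalize e '' s = t
  generalize c.reindex e = c
  have hdet : area b (c 0) (c 1) = 1 ∨ area b (c 1) (c 0) = 1 := by
    have h1 := b.isUnit_det c
    rw [Module.Basis.det_apply, Matrix.det_fin_two, Int.isUnit_iff] at h1
    simp only [Module.Basis.toMatrix_apply] at h1
    rcases h1 with h1 | h1
    · left
      rw [area_apply]
      simp only [Module.Basis.coord_apply]
      linarith
    · right
      rw [area_apply]
      simp only [Module.Basis.coord_apply]
      linarith
  have hp : ∀ i, ∃ v, area b (c i) v = 1 := by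
    intro i
    fin_cases i <;> rcases hdet with h | h
    · exact ⟨_, h⟩
    · exact isPrim_of_area_right h
    · exact isPrim_of_area_right h
    · exact ⟨_, h⟩
  by_cases h0 : (0 : Fin 2) ∈ t <;> by_cases h1 : (1 : Fin 2) ∈ t
  · have : t = {0, 1} := by ext i; fin_cases i <;> simp [h0, h1]
    right
    rw [this, Set.image_pair]
    rcases hdet with h | h
    · exact ⟨_, _, h, Or.inr rfl⟩
    · exact ⟨_, _, h, Or.inr (by rw [Set.pair_comm]; rfl)⟩
  · have : t = {0} := by ext i; fin_cases i <;> simp [h0, h1]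
    right
    obtain ⟨v, hv⟩ := hp 0
    exact ⟨_, _, hv, Or.inl (by rw [this, Set.image_singleton]; rfl)⟩
  · have : t = {1} := by ext i; fin_cases i <;> simp [h0, h1]
    right
    obtain ⟨v, hv⟩ := hp 1
    exact ⟨_, _, hv, Or.inl (by rw [this, Set.image_singleton]; rfl)⟩
  · have : t = ∅ := by ext i; fin_cases i <;> simp [h0, h1]
    left
    simp [this, latticeCone]

end PlaneCones

/-! ### Smooth refinements of plane fans -/

section PlaneFans

variable {N : Type} [AddCommGroup N] {b : Module.Basis (Fin 2) ℤ N} {F F' : Fan N} {u v w : N}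
  {σ τ : PointedCone ℝ (ℝ ⊗[ℤ] N)}

lemma cone₂_comm (u v : N) : cone₂ u v = cone₂ v u := by rw [cone₂, cone₂, Set.pair_comm]

/-- A ray inside `σ` is its own intersection with `σ`, so the fan axiom makes it a face. -/
lemma exists_isFace_ray (hr : ray u ∈ F.cones) (hσ : σ ∈ F.cones) (hu : lat u ∈ σ) :
    ∃ m ∈ dualMonoid σ, ∀ x, x ∈ ray u ↔ x ∈ σ ∧ pairing m x = 0 := by
  have := (F.inter_face σ hσ _ hr).1
  rwa [inf_eq_right.2 (ray_le.2 hu)] at this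

lemma lat_mem_face_iff {m : Module.Dual ℤ N} (hm : ∀ x, x ∈ τ ↔ x ∈ σ ∧ pairing m x = 0) :
    lat w ∈ τ ↔ lat w ∈ σ ∧ m w = 0 := by
  rw [hm, pairing_lat]
  norm_cast

lemma not_neg_lat_mem (hu : IsPrim b u) (hσ : IsStronglyConvex σ) (hs : lat u ∈ σ) :
    -lat u ∉ σ := fun h => lat_ne_zero hu (hσ _ hs h)

/-- Vanishing area makes the vectors collinear. Opposite directions are excluded by strong
convexity, and equal directions give equal primitive vectors. -/
lemma eq_of_area_eq_zero (hu : IsPrim b u) (hw : IsPrim b w) (hσ : IsStronglyConvex σ)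
    (hus : lat u ∈ σ) (hws : lat w ∈ σ) (h : area b u w = 0) : u = w := by
  obtain ⟨v, hv⟩ := id hu
  by_cases hc : area b v w ≤ 0
  · exact (eq_of_lat_mem_ray hu hw ((lat_mem_ray_iff hv).2 ⟨h, hc⟩)).symm
  · exfalso
    push Not at hc
    refine not_neg_lat_mem hu hσ hus ?_
    have h1 : lat w = (-(area b v w : ℝ)) • lat u := by
      have := real_eq_combination hv (lat w)
      rwa [pairing_lat, pairing_lat, h, Int.cast_zero, zero_smul, add_zero] at this
    have hc' : (0 : ℝ) < area b v w := by exact_mod_cast hc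
    have h2 : -lat u = ((area b v w : ℝ)⁻¹) • lat w := by
      rw [h1, smul_smul, mul_neg, inv_mul_cancel₀ hc'.ne', neg_smul, one_smul]
    rw [h2]
    exact real_smul_mem hws (inv_nonneg.2 hc'.le)

/-- A ray of the plane on which some non-zero `m ∈ σ^∨` vanishes is a face of `σ`. -/
lemma ray_mem_of_dual_eq_zero (hu : IsPrim b u) (hσ : σ ∈ F.cones) (hus : lat u ∈ σ)
    {m : Module.Dual ℤ N} (hm : m ∈ dualMonoid σ) (hm0 : m ≠ 0) (hmu : m u = 0) :
    ray u ∈ F.cones := by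
  obtain ⟨v, hv⟩ := id hu
  have hmv : (m v : ℝ) ≠ 0 := by
    intro h
    exact hm0 (dual_eq_zero_of_area_eq_one hv hmu (by exact_mod_cast h))
  refine F.face_mem σ hσ _ ⟨m, hm, fun x => ?_⟩
  have hx := pairing_eq_combination hv m x
  rw [hmu, Int.cast_zero, zero_mul, sub_zero] at hx
  rw [mem_ray_iff hv, hx, mul_eq_zero, or_iff_right hmv]
  constructor
  · rintro ⟨h1, h2⟩
    exact ⟨ray_le.2 hus ((mem_ray_iff hv).2 ⟨h1, h2⟩), h1⟩
  · rintro ⟨h1, h2⟩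
    refine ⟨h2, ?_⟩
    by_contra hc
    push Not at hc
    -- Here `x` would be a negative multiple of `u`, against strong convexity.
    have hx' := real_eq_combination hv x
    rw [h2, zero_smul, add_zero] at hx'
    refine not_neg_lat_mem hu (F.stronglyConvex σ hσ) hus ?_
    have h3 : -lat u = ((pairing (area b v) x)⁻¹) • x := by
      generalize pairing (area b v) x = c at hx' hc
      rw [hx', smul_smul, mul_neg, inv_mul_cancel₀ hc.ne', neg_smul, one_smul]
    rw [h3]
    exact real_smul_mem h1 (inv_nonneg.2 hc.le)

/-- The rays of a fan that lie in one of its two-dimensional smooth cones are the edges. -/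
lemma eq_or_eq_of_mem_cone₂ {a c : N} (hac : area b a c = 1) (hτ : cone₂ a c ∈ F.cones)
    (hu : IsPrim b u) (hr : ray u ∈ F.cones) (hus : lat u ∈ cone₂ a c) : u = a ∨ u = c := by
  obtain ⟨m, hm, hf⟩ := exists_isFace_ray hr hτ hus
  obtain ⟨h1, h2⟩ := mem_dualMonoid_cone₂.1 hm
  obtain ⟨h3, h4⟩ := (lat_mem_cone₂_iff hac).1 hus
  have hmu : m u = 0 := ((lat_mem_face_iff hf).1 (mem_ray u)).2
  have key (e : N) (he : IsPrim b e) (hes : lat e ∈ cone₂ a c) (hme : m e = 0) : u = e :=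
    (eq_of_lat_mem_ray hu he ((lat_mem_face_iff hf).2 ⟨hes, hme⟩)).symm
  rcases h1.eq_or_lt with h1 | h1
  · exact Or.inl (key a ⟨c, hac⟩ (left_mem_cone₂ a c) h1.symm)
  rcases h2.eq_or_lt with h2 | h2
  · exact Or.inr (key c (isPrim_of_area_right hac) (right_mem_cone₂ a c) h2.symm)
  -- Now `m` is positive on both edges, hence positive on the cone away from the origin, but `m u =
  -- 0`.
  exfalso
  have h5 := area_mul_dual b m a c u
  rw [hac, hmu] at h5
  have h6 : 0 ≤ m c * area b a u := by positivity
  have h7 : m a * area b c u ≤ 0 := mul_nonpos_of_nonneg_of_nonpos h1.le h4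
  have h8 : area b a u = 0 := by
    have : m c * area b a u = 0 := by linarith
    simpa [h2.ne'] using this
  have h9 : area b c u = 0 := by
    have : m a * area b c u = 0 := by linarith
    simpa [h1.ne'] using this
  refine lat_ne_zero hu ?_
  have := real_eq_combination hac (lat u)
  simpa [pairing_lat, h8, h9] using this

lemma cases_of_ray_mem (hF : F.IsSmooth) (hu : IsPrim b u) (hr : ray u ∈ F.cones)
    (hτ : τ ∈ F.cones) (hus : lat u ∈ τ) :
    τ = ray u ∨ ∃ v, (area b u v = 1 ∧ τ = cone₂ u v) ∨ (area b v u = 1 ∧ τ = cone₂ v u) := by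
  rcases isSmoothCone_cases b (hF τ hτ) with rfl | ⟨a, c, hac, rfl | rfl⟩
  · exact absurd ((Submodule.mem_bot _).1 hus) (lat_ne_zero hu)
  · left
    rw [eq_of_lat_mem_ray ⟨c, hac⟩ hu hus]
  · right
    rcases eq_or_eq_of_mem_cone₂ hac hτ hu hr hus with rfl | rfl
    · exact ⟨c, Or.inl ⟨hac, rfl⟩⟩
    · exact ⟨a, Or.inr ⟨hac, rfl⟩⟩

/-- Two rays of a smooth fan that lie in a common cone span it. -/
lemma cases_of_two_rays_mem (hF : F.IsSmooth) (hu : IsPrim b u) (hr : ray u ∈ F.cones)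
    (hw : IsPrim b w) (hrw : ray w ∈ F.cones) (hne : u ≠ w)
    (hτ : τ ∈ F.cones) (hus : lat u ∈ τ) (hws : lat w ∈ τ) :
    (area b u w = 1 ∧ τ = cone₂ u w) ∨ (area b w u = 1 ∧ τ = cone₂ w u) := by
  rcases cases_of_ray_mem hF hu hr hτ hus with rfl | ⟨v, ⟨hv, rfl⟩ | ⟨hv, rfl⟩⟩
  · exact absurd (eq_of_lat_mem_ray hu hw hws).symm hne
  · rcases eq_or_eq_of_mem_cone₂ hv hτ hw hrw hws with rfl | rfl
    · exact absurd rfl hne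
    · exact Or.inl ⟨hv, rfl⟩
  · rcases eq_or_eq_of_mem_cone₂ hv hτ hw hrw hws with rfl | rfl
    · exact Or.inr ⟨hv, rfl⟩
    · exact absurd rfl hne

lemma not_ray_between (huv : area b u v = 1) (hτ : cone₂ u v ∈ F.cones) (hw : IsPrim b w)
    (hrw : ray w ∈ F.cones) (h1 : 0 < area b u w) (h2 : 0 < area b w v) : False := by
  have := (lat_mem_cone₂_iff huv).2 ⟨h1.le, by rw [area_swap]; linarith⟩
  rcases eq_or_eq_of_mem_cone₂ huv hτ hw hrw this with rfl | rfl
  · simp at h1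
  · simp at h2

/-- If `w` lies in `cone₂ u v`, the functional that cuts out the intersection of the two cones
vanishes on the basis `u, w`, so it is zero. Then `cone₂ u v` is contained in `cone₂ u w`, which
forces `v = w`. -/
lemma cone₂_unique_of_area_le (h : area b u v = 1) (h' : area b u w = 1) (hv : cone₂ u v ∈ F.cones)
    (hw : cone₂ u w ∈ F.cones) (hvw : area b v w ≤ 0) : v = w := by
  obtain ⟨m, hm, hf⟩ := (F.inter_face _ hv _ hw).1
  have h1 : m u = 0 := ((lat_mem_face_iff hf).1 ⟨left_mem_cone₂ u v, left_mem_cone₂ u w⟩).2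
  have h2 : m w = 0 := ((lat_mem_face_iff hf).1
    ⟨(lat_mem_cone₂_iff h).2 ⟨by omega, hvw⟩, right_mem_cone₂ u w⟩).2
  have h3 := dual_eq_zero_of_area_eq_one h' h1 h2
  have h4 : lat v ∈ cone₂ u v ⊓ cone₂ u w :=
    (lat_mem_face_iff hf).2 ⟨right_mem_cone₂ u v, by simp [h3]⟩
  have h5 := ((lat_mem_cone₂_iff h').1 h4.2).2
  rw [area_swap] at h5
  have h6 := eq_combination h w
  rw [h', show area b v w = 0 by omega] at h6
  simpa using h6.symm

lemma cone₂_right_unique (h : area b u v = 1) (h' : area b u w = 1) (hv : cone₂ u v ∈ F.cones)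
    (hw : cone₂ u w ∈ F.cones) : v = w := by
  rcases le_total (area b v w) 0 with h0 | h0
  · exact cone₂_unique_of_area_le h h' hv hw h0
  · exact (cone₂_unique_of_area_le h' h hw hv (by rw [area_swap]; omega)).symm

/-- Exchanging the basis vectors reverses the sign of `area` and so turns left into right. The same
device serves for all statements on the negative side. -/
lemma cone₂_left_unique (h : area b v u = 1) (h' : area b w u = 1) (hv : cone₂ v u ∈ F.cones)
    (hw : cone₂ w u ∈ F.cones) : v = w := by
  rw [← area_reindex_swap] at h h'
  rw [cone₂_comm] at hv hw
  exact cone₂_right_unique h h' hv hw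

lemma area_neg (u : N) : area b (-u) = -area b u := by
  ext w
  rw [LinearMap.neg_apply, area_swap, map_neg, area_swap b u]

lemma mem_ray_right_iff (huv : area b u v = 1) (x : ℝ ⊗[ℤ] N) :
    x ∈ ray v ↔ x ∈ cone₂ u v ∧ pairing (-area b v) x = 0 := by
  have huv' : area b v (-u) = 1 := by rw [map_neg, ← area_swap, huv]
  rw [mem_ray_iff huv', mem_cone₂_iff huv, pairing_neg, area_neg, pairing_neg]
  constructor
  · rintro ⟨h1, h2⟩
    exact ⟨⟨by linarith, by linarith⟩, by linarith⟩
  · rintro ⟨⟨h1, h2⟩, h3⟩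
    exact ⟨by linarith, by linarith⟩

lemma ray_right_mem (huv : area b u v = 1) (hv : cone₂ u v ∈ F.cones) : ray v ∈ F.cones :=
  F.face_mem _ hv _ ⟨-area b v, mem_dualMonoid_cone₂.2 (by simp [area_swap b v u, huv]),
    mem_ray_right_iff huv⟩

lemma ray_left_mem (huv : area b u v = 1) (hv : cone₂ u v ∈ F.cones) : ray u ∈ F.cones := by
  refine F.face_mem _ hv _ ⟨area b u, mem_dualMonoid_cone₂.2 (by simp [huv]), fun x => ?_⟩
  rw [mem_ray_iff huv, mem_cone₂_iff huv]
  constructor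
  · rintro ⟨h1, h2⟩
    exact ⟨⟨by linarith, by linarith⟩, by linarith⟩
  · rintro ⟨⟨h1, h2⟩, h3⟩
    exact ⟨by linarith, by linarith⟩

variable (b F F') in
/-- `u` is the primitive generator of a ray of `F'` that is not in `F`. -/
structure IsNewRay (u : N) : Prop where
  prim : IsPrim b u
  mem : ray u ∈ F'.cones
  notMem : ray u ∉ F.cones

variable (b F F') in
lemma finite_isNewRay : {u | IsNewRay b F F' u}.Finite :=
  Set.Finite.of_finite_image (f := ray) (F'.finite.subset (by rintro _ ⟨u, hu, rfl⟩; exact hu.mem))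
    fun _ hu _ hw h => ray_injective hu.prim hw.prim h

lemma IsNewRay.swap (hu : IsNewRay b F F' u) :
    IsNewRay (b.reindex (Equiv.swap 0 1)) F F' u := by
  obtain ⟨v, hv⟩ := hu.prim
  exact ⟨⟨-v, by rw [area_reindex_swap, area_swap, map_neg, neg_neg, hv]⟩, hu.mem, hu.notMem⟩

namespace IsNewRay

/-- A new ray is interior to `σ`: a non-zero supporting functional that vanishes on it would exhibit
it as a face, that is, as a ray of `F`. -/
lemma dual_eq_zero (hu : IsNewRay b F F' u) (hσ : σ ∈ F.cones) (hus : lat u ∈ σ)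
    {m : Module.Dual ℤ N} (hm : m ∈ dualMonoid σ) (hmu : m u = 0) : m = 0 := by
  by_contra h
  exact hu.notMem (ray_mem_of_dual_eq_zero hu.prim hσ hus hm h hmu)

/-- A new ray lies in only one cone of the coarser fan. -/
lemma cone_unique (hu : IsNewRay b F F' u) (hσ : σ ∈ F.cones) (hτ : τ ∈ F.cones)
    (hus : lat u ∈ σ) (hut : lat u ∈ τ) : σ = τ := by
  obtain ⟨⟨m, hm, hf⟩, ⟨m', hm', hf'⟩⟩ := F.inter_face σ hσ τ hτ
  have h := hu.dual_eq_zero hσ hus hm ((lat_mem_face_iff hf).1 ⟨hus, hut⟩).2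
  have h' := hu.dual_eq_zero hτ hut hm' ((lat_mem_face_iff hf').1 ⟨hus, hut⟩).2
  subst h h'
  -- With both functionals zero, the intersection is the whole of `σ` and the whole of `τ`.
  apply le_antisymm
  · exact fun x hx => ((hf x).2 ⟨hx, by simp [pairing]⟩).2
  · exact fun x hx => ((hf' x).2 ⟨hx, by simp [pairing]⟩).1

lemma exists_cone (hu : IsNewRay b F F' u) (href : F'.Refines F) : ∃ σ ∈ F.cones, lat u ∈ σ := by
  obtain ⟨σ, hσ, h⟩ := href.exists_le _ hu.mem
  exact ⟨σ, hσ, ray_le.1 h⟩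

/-- Otherwise `-area b u` would be a non-zero supporting functional of `σ` that vanishes on the
interior vector `u`. -/
lemma exists_area_pos (hu : IsNewRay b F F' u) (hσ : σ ∈ F.cones) (hus : lat u ∈ σ) :
    ∃ w, lat w ∈ σ ∧ 0 < area b u w := by
  obtain ⟨v, hv⟩ := hu.prim
  have h : -area b u ∉ dualMonoid σ := fun h => by
    have h0 := hu.dual_eq_zero hσ hus h (by simp)
    have := LinearMap.congr_fun h0 v
    simp [hv] at this
  obtain ⟨s, hs, rfl⟩ := F.rational σ hσ
  rw [mem_dualMonoid_latticeCone] at h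
  push Not at h
  obtain ⟨w, hw, hlt⟩ := h
  exact ⟨w, lat_mem_latticeCone hw, by simpa using hlt⟩

/-- A new ray has a neighbour on the positive side. -/
lemma exists_next (hu : IsNewRay b F F' u) (hF : F'.IsSmooth) (href : F'.Refines F) :
    ∃ v, area b u v = 1 ∧ cone₂ u v ∈ F'.cones := by
  obtain ⟨σ, hσ, hus⟩ := hu.exists_cone href
  obtain ⟨w, hws, hw⟩ := hu.exists_area_pos hσ hus
  -- The vectors `n • u + w` stay on the positive side of `u`, and their directions tend to that of
  -- `u`. Infinitely many of them lie in one cone `τ` of `F'`, which must contain `u`.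
  have hex (n : ℕ) : ∃ τ : F'.cones, lat (n • u + w) ∈ τ.1 := by
    have h1 : lat (n • u + w) ∈ σ := by
      rw [lat, TensorProduct.tmul_add, TensorProduct.tmul_smul]
      exact add_mem (nsmul_mem hus n) hws
    have h2 : lat (n • u + w) ∈ F'.support := by
      rw [href.support_eq]
      exact Set.mem_biUnion hσ h1
    obtain ⟨τ, hτ, h⟩ := Set.mem_iUnion₂.1 h2
    exact ⟨⟨τ, hτ⟩, h⟩
  choose T hT using hex
  have := F'.finite.to_subtype
  obtain ⟨⟨τ, hτ⟩, hinf⟩ := Finite.exists_infinite_fiber T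
  rw [Set.infinite_coe_iff] at hinf
  have hmem : ∀ n ∈ T ⁻¹' {⟨τ, hτ⟩}, lat (n • u + w) ∈ τ := by
    intro n hn
    have := hT n
    rwa [show T n = ⟨τ, hτ⟩ from hn] at this
  -- A functional that is non-negative at `n • u + w` for arbitrarily large `n` is non-negative at
  -- `u`.
  have hnonneg {m : Module.Dual ℤ N} (hm : m ∈ dualMonoid τ) : 0 ≤ m u := by
    by_contra hneg
    push Not at hneg
    obtain ⟨n, hn, hlt⟩ := hinf.exists_gt (m w).toNat
    have h1 := nonneg_of_mem_dualMonoid hm (hmem n hn)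
    rw [map_add, map_nsmul, nsmul_eq_mul] at h1
    have h2 : m w < n := by omega
    nlinarith
  rcases isSmoothCone_cases b (hF τ hτ) with rfl | ⟨a, c, hac, rfl | rfl⟩
  · obtain ⟨n, hn⟩ := hinf.nonempty
    have h := congrArg (pairing (area b u)) ((Submodule.mem_bot _).1 (hmem n hn))
    rw [pairing_lat] at h
    simp [hw.ne'] at h
  -- Two distinct vectors `n • u + w` on one ray would make `u` and `w` collinear.
  · have key : ∀ n ∈ T ⁻¹' {⟨ray a, hτ⟩}, (n : ℤ) * area b a u + area b a w = 0 := by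
      intro n hn
      have := ((lat_mem_ray_iff hac).1 (hmem n hn)).1
      simpa using this
    obtain ⟨n, hn⟩ := hinf.nonempty
    obtain ⟨k, hk, hlt⟩ := hinf.exists_gt n
    have h1 := key n hn
    have h2 := key k hk
    have h3 : area b a u = 0 := by
      have : ((k : ℤ) - n) * area b a u = 0 := by linarith
      rcases mul_eq_zero.1 this with h | h
      · omega
      · exact h
    have h4 : area b a w = 0 := by simpa [h3] using h1
    have h5 := area_mul_dual b (area b u) a c w
    rw [hac, h4, area_swap b u a, h3] at h5
    simp at h5
    omega
  · have h1 : 0 ≤ area b a u := hnonneg (mem_dualMonoid_cone₂.2 (by simp [hac]))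
    have h2 : 0 ≤ (-area b c) u :=
      hnonneg (mem_dualMonoid_cone₂.2 (by simp [area_swap b c a, hac]))
    have hus' : lat u ∈ cone₂ a c := (lat_mem_cone₂_iff hac).2 ⟨h1, by simpa using h2⟩
    rcases eq_or_eq_of_mem_cone₂ hac hτ hu.prim hu.mem hus' with rfl | rfl
    · exact ⟨c, hac, hτ⟩
    -- If `u` were the positive edge, the cone would lie on the negative side of `u`, where no `n •
    -- u + w` is.
    · obtain ⟨n, hn⟩ := hinf.nonempty
      have := ((lat_mem_cone₂_iff hac).1 (hmem n hn)).2
      simp at this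
      omega

/-- A new ray has a neighbour on the negative side. -/
lemma exists_prev (hu : IsNewRay b F F' u) (hF : F'.IsSmooth) (href : F'.Refines F) :
    ∃ v, area b v u = 1 ∧ cone₂ v u ∈ F'.cones := by
  obtain ⟨v, h, hv⟩ := hu.swap.exists_next hF href
  exact ⟨v, by rwa [area_reindex_swap] at h, by rwa [cone₂_comm]⟩

/-- Some cone of `F` contains `τ`, and it contains the new ray `u`, so by uniqueness it is `σ`. -/
lemma cone₂_le_of_mem (hu : IsNewRay b F F' u) (href : F'.Refines F) (hτ : τ ∈ F'.cones)
    (hut : lat u ∈ τ) (hσ : σ ∈ F.cones) (hus : lat u ∈ σ) : τ ≤ σ := by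
  obtain ⟨σ', hσ', h⟩ := href.exists_le _ hτ
  rwa [hu.cone_unique hσ hσ' hus (h hut)]

/-- The angular order of new rays is transitive on a cone of the coarser fan. -/
lemma area_pos_trans (hu : IsPrim b u) (hσ : IsStronglyConvex σ) (hus : lat u ∈ σ)
    (hvs : lat v ∈ σ) (hws : lat w ∈ σ) (huv : 0 < area b u v) (hvw : 0 < area b v w) :
    0 < area b u w := by
  by_contra h
  push Not at h
  -- If `area b u w ≤ 0`, this relation writes a negative multiple of `u` as a non-negative
  -- combination of `v` and `w`.
  have hid : area b u v • w + area b v w • u = area b u w • v := by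
    refine b.ext_elem fun i => ?_
    have := area_mul_dual b (b.coord i) u v w
    simp only [Module.Basis.coord_apply] at this
    simp only [map_add, map_smul, Finsupp.add_apply, Finsupp.smul_apply, smul_eq_mul]
    linarith
  have hid' : (area b u v : ℝ) • lat w + (area b v w : ℝ) • lat u
      = (area b u w : ℝ) • lat v := by
    have := congrArg lat hid
    simp only [lat, TensorProduct.tmul_add, TensorProduct.tmul_smul] at this
    simpa only [Int.cast_smul_eq_zsmul] using this
  have h1 : (0 : ℝ) < area b u v := by exact_mod_cast huv
  have h2 : (0 : ℝ) < area b v w := by exact_mod_cast hvw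
  have h3 : (area b u w : ℝ) ≤ 0 := by exact_mod_cast h
  refine not_neg_lat_mem hu hσ hus ?_
  have h4 : -((area b v w : ℝ) • lat u) ∈ σ := by
    have : -((area b v w : ℝ) • lat u) =
        (area b u v : ℝ) • lat w + (-(area b u w : ℝ)) • lat v := by
      rw [neg_smul, ← hid']
      abel
    rw [this]
    exact add_mem (real_smul_mem hws h1.le) (real_smul_mem hvs (by linarith))
  have h5 := real_smul_mem h4 (inv_nonneg.2 h2.le)
  rwa [smul_neg, smul_smul, inv_mul_cancel₀ h2.ne', one_smul] at h5

/-- Two new rays in a cone are either adjacent or have a new ray between them. -/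
lemma adjacent_or_exists_between (hu : IsNewRay b F F' u) (hw : IsNewRay b F F' w)
    (hF : F'.IsSmooth) (href : F'.Refines F) (hσ : σ ∈ F.cones) (hus : lat u ∈ σ)
    (hws : lat w ∈ σ) (huw : 0 < area b u w) :
    (area b u w = 1 ∧ cone₂ u w ∈ F'.cones) ∨
      ∃ v, IsNewRay b F F' v ∧ lat v ∈ σ ∧ 0 < area b u v ∧ 0 < area b v w := by
  obtain ⟨v, huv, hv⟩ := hu.exists_next hF href
  have hle := hu.cone₂_le_of_mem href hv (left_mem_cone₂ u v) hσ hus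
  have hvs : lat v ∈ σ := hle (right_mem_cone₂ u v)
  have hvp : IsPrim b v := isPrim_of_area_right huv
  have hrv := ray_right_mem huv hv
  -- The neighbour `v` of `u` cannot lie beyond `w`, since `w` would then be a ray inside `cone₂ u
  -- v`. It is either `w` itself or strictly between.
  rcases lt_trichotomy (area b v w) 0 with h | h | h
  · exact (not_ray_between huv hv hw.prim hw.mem huw (by rw [area_swap]; omega)).elim
  · obtain rfl := eq_of_area_eq_zero hvp hw.prim (F.stronglyConvex σ hσ) hvs hws h
    exact Or.inl ⟨huv, hv⟩
  · refine Or.inr ⟨v, ⟨hvp, hrv, fun hrF => ?_⟩, hvs, by omega, h⟩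
    -- If `v` were an old ray, its supporting functional would be non-negative at `u` and `w` and
    -- zero between them, hence zero at the new ray `u`.
    obtain ⟨m, hm, hf⟩ := exists_isFace_ray hrF hσ hvs
    have hmv : m v = 0 := ((lat_mem_face_iff hf).1 (mem_ray v)).2
    have h1 := nonneg_of_mem_dualMonoid hm hus
    have h2 := nonneg_of_mem_dualMonoid hm hws
    have h3 := area_mul_dual b m u w v
    rw [hmv, huv, area_swap b w v] at h3
    have hmu : m u = 0 := by nlinarith
    have hm0 := hu.dual_eq_zero hσ hus hm hmu
    have hur : lat u ∈ ray v := (lat_mem_face_iff hf).2 ⟨hus, hmu⟩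
    have := eq_of_lat_mem_ray hvp hu.prim hur
    rw [this] at huv
    simp at huv

end IsNewRay

lemma bot_mem_of_ray_mem (hu : IsPrim b u) (hr : ray u ∈ F.cones) : ⊥ ∈ F.cones := by
  obtain ⟨v, hv⟩ := hu
  refine F.face_mem _ hr _ ⟨-area b v, mem_dualMonoid_ray.2 (by simp [area_swap b v u, hv]),
    fun x => ?_⟩
  rw [Submodule.mem_bot, mem_ray_iff hv, pairing_neg]
  constructor
  · rintro rfl
    simp
  · rintro ⟨⟨h1, -⟩, h2⟩
    rw [real_eq_combination hv x, h1, h2]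
    simp

/-- A non-empty finite set of new rays has an element that is maximal in the angular order of the
cone that contains it. -/
lemma exists_maximal_newRay {S : Set N} (hS : ∀ u ∈ S, IsNewRay b F F' u) (hne : S.Nonempty) :
    ∃ u ∈ S, ∀ w ∈ S, ∀ σ ∈ F.cones, lat u ∈ σ → lat w ∈ σ → area b u w ≤ 0 := by
  have := ((finite_isNewRay b F F').subset hS).to_subtype
  -- `r w u` says that `w` comes after `u` in a common cone, so a minimal element for `r` is last in
  -- angular order. Transitivity needs the uniqueness of the cone containing the middle ray.
  let r : S → S → Prop := fun w u => (∃ σ ∈ F.cones, lat u.1 ∈ σ ∧ lat w.1 ∈ σ) ∧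
    0 < area b u.1 w.1
  have : Std.Irrefl r := ⟨fun u h => by simpa using h.2⟩
  have : IsTrans S r := by
    refine ⟨?_⟩
    rintro w v u ⟨⟨σ, hσ, h1, h2⟩, h3⟩ ⟨⟨σ', hσ', h1', h2'⟩, h3'⟩
    obtain rfl := (hS v v.2).cone_unique hσ hσ' h1 h2'
    exact ⟨⟨σ, hσ, h1', h2⟩, IsNewRay.area_pos_trans (hS u u.2).prim (F.stronglyConvex σ hσ)
      h1' h1 h2 h3' h3⟩
  have hwf : WellFounded r := Finite.wellFounded_of_trans_of_irrefl r
  obtain ⟨u, -, hu⟩ := hwf.has_min Set.univ ⟨⟨_, hne.some_mem⟩, trivial⟩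
  refine ⟨u, u.2, fun w hw σ hσ h1 h2 => ?_⟩
  have := hu ⟨w, hw⟩ trivial
  by_contra h
  exact this ⟨⟨σ, hσ, h1, h2⟩, by simpa using h⟩

/-- A non-empty finite set of new rays has an element whose positive neighbour is not in it. -/
lemma exists_next_notMem {S : Set N} (hS : ∀ u ∈ S, IsNewRay b F F' u) (hne : S.Nonempty)
    (hF : F'.IsSmooth) (href : F'.Refines F) :
    ∃ u ∈ S, ∃ v, area b u v = 1 ∧ cone₂ u v ∈ F'.cones ∧ v ∉ S := by
  obtain ⟨u, huS, hu⟩ := exists_maximal_newRay hS hne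
  obtain ⟨v, huv, hv⟩ := (hS u huS).exists_next hF href
  refine ⟨u, huS, v, huv, hv, fun hvS => ?_⟩
  obtain ⟨σ, hσ, h⟩ := href.exists_le _ hv
  have := hu v hvS σ hσ (h (left_mem_cone₂ u v)) (h (right_mem_cone₂ u v))
  omega

/-- If `F'` has a ray, then `F` has one too: the positive neighbour of a last new ray is old, and
the origin is a face of it. If `F'` has no rays, its support is the origin, so the cones of `F` are
zero. -/
lemma bot_mem_of_refines (b : Module.Basis (Fin 2) ℤ N) (hF : F'.IsSmooth) (href : F'.Refines F) (h : F'.cones.Nonempty) :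
    ⊥ ∈ F.cones := by
  by_cases hr : ∃ u, IsPrim b u ∧ ray u ∈ F'.cones
  · obtain ⟨u, hu, hr⟩ := hr
    by_cases hrF : ray u ∈ F.cones
    · exact bot_mem_of_ray_mem hu hrF
    · obtain ⟨w, hw, v, hwv, hv, hvS⟩ := exists_next_notMem (b := b) (S := {u | IsNewRay b F F' u})
        (fun _ h => h) ⟨u, hu, hr, hrF⟩ hF href
      have hvp : IsPrim b v := isPrim_of_area_right hwv
      by_contra hbot
      exact hvS ⟨hvp, ray_right_mem hwv hv, fun h => hbot (bot_mem_of_ray_mem hvp h)⟩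
  · have hall : ∀ τ ∈ F'.cones, τ = ⊥ := by
      intro τ hτ
      rcases isSmoothCone_cases b (hF τ hτ) with h | ⟨u, v, huv, rfl | rfl⟩
      · exact h
      · exact absurd ⟨u, ⟨v, huv⟩, hτ⟩ hr
      · exact absurd ⟨u, ⟨v, huv⟩, ray_left_mem huv hτ⟩ hr
    obtain ⟨τ, hτ⟩ := h
    obtain ⟨σ, hσ, -⟩ := href.exists_le τ hτ
    have : σ = ⊥ := by
      rw [eq_bot_iff]
      intro x hx
      have h1 : x ∈ F'.support := by
        rw [href.support_eq]
        exact Set.mem_biUnion hσ hx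
      obtain ⟨τ, hτ, h⟩ := Set.mem_iUnion₂.1 h1
      rwa [hall τ hτ] at h
    rwa [← this]

/-- A cone of the refinement without new rays belongs to the coarser fan. -/
lemma mem_cones_of_forall_not_isNewRay (hF : F'.IsSmooth) (href : F'.Refines F)
    (hτ : τ ∈ F'.cones) (h : ∀ u, IsNewRay b F F' u → lat u ∉ τ) : τ ∈ F.cones := by
  rcases isSmoothCone_cases b (hF τ hτ) with rfl | ⟨u, v, huv, rfl | rfl⟩
  · exact bot_mem_of_refines b hF href ⟨_, hτ⟩
  · by_contra hc
    exact h u ⟨⟨v, huv⟩, hτ, hc⟩ (mem_ray u)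
  · have hvp : IsPrim b v := isPrim_of_area_right huv
    have hu : ray u ∈ F.cones := by
      by_contra hc
      exact h u ⟨⟨v, huv⟩, ray_left_mem huv hτ, hc⟩ (left_mem_cone₂ u v)
    have hv : ray v ∈ F.cones := by
      by_contra hc
      exact h v ⟨hvp, ray_right_mem huv hτ, hc⟩ (right_mem_cone₂ u v)
    obtain ⟨σ, hσ, hle⟩ := href.exists_le _ hτ
    obtain ⟨hus, hvs⟩ := cone₂_le.1 hle
    obtain ⟨m, hm, hf⟩ := exists_isFace_ray hu hσ hus
    obtain ⟨m', hm', hf'⟩ := exists_isFace_ray hv hσ hvs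
    have hmu : m u = 0 := ((lat_mem_face_iff hf).1 (mem_ray u)).2
    have hmv' : m' v = 0 := ((lat_mem_face_iff hf').1 (mem_ray v)).2
    have hmv : 0 < m v := by
      refine (nonneg_of_mem_dualMonoid hm hvs).lt_of_ne' fun h0 => ?_
      have := eq_of_lat_mem_ray ⟨v, huv⟩ hvp ((lat_mem_face_iff hf).2 ⟨hvs, h0⟩)
      simp [this] at huv
    have hmu' : 0 < m' u := by
      refine (nonneg_of_mem_dualMonoid hm' hus).lt_of_ne' fun h0 => ?_
      have := eq_of_lat_mem_ray hvp ⟨v, huv⟩ ((lat_mem_face_iff hf').2 ⟨hus, h0⟩)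
      simp [this] at huv
    -- Both edges are faces of `σ`. Their supporting functionals are positive multiples of the two
    -- coordinates, so `σ` is no larger than the cone spanned by the edges.
    have : σ = cone₂ u v := by
      refine le_antisymm (fun x hx => (mem_cone₂_iff huv).2 ?_) hle
      have h1 := hm x hx
      have h2 := hm' x hx
      rw [pairing_eq_combination huv, hmu, Int.cast_zero, zero_mul, sub_zero] at h1
      rw [pairing_eq_combination huv, hmv', Int.cast_zero, zero_mul, zero_sub] at h2
      have hmv : (0 : ℝ) < m v := by exact_mod_cast hmv
      have hmu' : (0 : ℝ) < m' u := by exact_mod_cast hmu'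
      refine ⟨nonneg_of_mul_nonneg_right h1 hmv, ?_⟩
      by_contra hc
      push Not at hc
      have := mul_pos hmu' hc
      linarith
    rwa [← this]

end PlaneFans

/-! ### Reduced closed subschemes -/

section ReducedSubscheme

instance {X : Scheme.{0}} (Z : Closeds X) : IsClosedImmersion (reducedSubschemeι Z) := by
  unfold reducedSubschemeι
  exact inferInstanceAs (IsClosedImmersion (Scheme.IdealSheafData.subschemeι _))

@[simp] lemma range_reducedSubschemeι {X : Scheme.{0}} (Z : Closeds X) :
    Set.range (reducedSubschemeι Z) = (Z : Set X) :=
  (Scheme.IdealSheafData.range_subschemeι _).trans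
    (Scheme.IdealSheafData.coe_support_vanishingIdeal Z)

instance {X : Scheme.{0}} (Z : Closeds X) : IsReduced (reducedSubscheme Z) := by
  let I := Scheme.IdealSheafData.vanishingIdeal Z
  refine @IsReduced.of_openCover I.subscheme I.subschemeCover.openCover fun (U : X.affineOpens) => ?_
  have h : _root_.IsReduced (Γ(X, U) ⧸ I.ideal U) := by
    rw [← Ideal.isRadical_iff_quotient_reduced]
    simp only [I, Scheme.IdealSheafData.vanishingIdeal_ideal]
    exact PrimeSpectrum.isRadical_vanishingIdeal _
  exact inferInstanceAs (IsReduced (Spec (.of (Γ(X, U) ⧸ I.ideal U))))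

/-- A morphism from a reduced scheme kills the functions that vanish on its image. -/
lemma vanishingIdeal_le_ker {T X : Scheme.{0}} [IsReduced T] (g : T ⟶ X) {Z : Closeds X}
    (h : Set.range g ⊆ Z) : Scheme.IdealSheafData.vanishingIdeal Z ≤ g.ker := by
  -- The kernel is the largest ideal sheaf inside the kernels on affine opens, so the inclusion may
  -- be checked on each affine open.
  refine Scheme.IdealSheafData.gci.gc.le_iff_le.1 ?_
  intro U f hf
  rw [RingHom.mem_ker]
  -- On a reduced scheme a section that is invertible nowhere is zero.
  refine eq_zero_of_basicOpen_eq_bot _ ?_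
  rw [← Scheme.preimage_basicOpen, eq_bot_iff]
  intro t ht
  exfalso
  have hb : g t ∈ X.basicOpen f := ht
  have hUa : IsAffineOpen U.1 := U.2
  have hU : g t ∈ Set.range hUa.fromSpec := by
    rw [hUa.range_fromSpec]
    exact X.basicOpen_le f hb
  obtain ⟨p, hp⟩ := hU
  rw [Scheme.IdealSheafData.vanishingIdeal_ideal, PrimeSpectrum.mem_vanishingIdeal] at hf
  have h1 : f ∈ p.asIdeal := by
    refine hf p ?_
    change hUa.fromSpec p ∈ (Z : Set X)
    rw [hp]
    exact h ⟨t, rfl⟩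
  have h2 : p ∈ hUa.fromSpec ⁻¹ᵁ X.basicOpen f := by
    rw [← hp] at hb
    exact hb
  rw [hUa.fromSpec_preimage_basicOpen] at h2
  exact h2 h1

/-- A morphism from a reduced scheme into a closed set factors through the reduced subscheme. -/
lemma exists_lift_reducedSubscheme {T X : Scheme.{0}} [IsReduced T] (g : T ⟶ X) {Z : Closeds X}
    (h : Set.range g ⊆ Z) : ∃ l : T ⟶ reducedSubscheme Z, l ≫ reducedSubschemeι Z = g :=
  ⟨IsClosedImmersion.lift (reducedSubschemeι Z) g
    ((Scheme.IdealSheafData.ker_subschemeι _).trans_le (vanishingIdeal_le_ker g h)),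
    IsClosedImmersion.lift_fac _ _ _⟩

lemma preimage_range_of_comp {T X Y : Scheme.{0}} (l : T ⟶ Y) (i : Y ⟶ X)
    (hi : Function.Injective i) : Set.range l = i ⁻¹' Set.range (l ≫ i) := by
  ext y
  constructor
  · rintro ⟨t, rfl⟩
    exact ⟨t, rfl⟩
  · rintro ⟨t, ht⟩
    exact ⟨t, hi ht⟩

/-- A reduced immersed scheme is the difference of closed sets with its reduced structure. -/
lemma exists_iso_reducedDifference {T Y : Scheme.{0}} [IsReduced T] (g : T ⟶ Y) [IsImmersion g]
    {Z' Z : Closeds Y} (hg : Set.range g = (Z' : Set Y) \ Z) :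
    ∃ e : T ≅ (reducedDifference Z' Z).toScheme,
      e.hom ≫ (reducedDifference Z' Z).ι ≫ reducedSubschemeι Z' = g := by
  obtain ⟨l, hl⟩ := exists_lift_reducedSubscheme g (Z := Z')
    (hg.subset.trans Set.sdiff_subset)
  have hr : Set.range l ⊆ Set.range (reducedDifference Z' Z).ι := by
    rw [Scheme.Opens.range_ι]
    rintro _ ⟨t, rfl⟩
    change reducedSubschemeι Z' (l t) ∈ (Z : Set Y)ᶜ
    rw [← Scheme.Hom.comp_apply, hl]
    exact (hg.subset ⟨t, rfl⟩).2
  let h : T ⟶ (reducedDifference Z' Z).toScheme := IsOpenImmersion.lift _ l hr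
  have hh : h ≫ (reducedDifference Z' Z).ι ≫ reducedSubschemeι Z' = g := by
    rw [IsOpenImmersion.lift_fac_assoc, hl]
  have : IsImmersion (h ≫ (reducedDifference Z' Z).ι ≫ reducedSubschemeι Z') := by
    rw [hh]; infer_instance
  have : IsImmersion h := IsImmersion.of_comp h ((reducedDifference Z' Z).ι ≫ reducedSubschemeι Z')
  have hsurj : Function.Surjective h := by
    rw [← Set.range_eq_univ, preimage_range_of_comp h
      ((reducedDifference Z' Z).ι ≫ reducedSubschemeι Z')
      (IsPreimmersion.isEmbedding _).injective, hh, hg, Set.eq_univ_iff_forall]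
    intro y
    constructor
    · rw [← range_reducedSubschemeι]
      exact ⟨(reducedDifference Z' Z).ι y, rfl⟩
    · exact y.2
  have : Surjective h := ⟨hsurj⟩
  -- A surjective closed immersion into a reduced scheme is an isomorphism.
  have : IsClosedImmersion h := .of_isPreimmersion h (by
    rw [hsurj.range_eq]; exact isClosed_univ)
  have := isIso_of_isClosedImmersion_of_surjective h
  exact ⟨asIso h, hh⟩

lemma isDisjointUnionOfAffineSpaces_of_isEmpty {Y : Scheme.{0}} [IsEmpty Y]
    (s : Y ⟶ Spec (.of ℂ)) : IsDisjointUnionOfAffineSpaces Y s :=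
  ⟨0, Fin.elim0, Fin.elim0, fun a => a.elim0, by
    ext x; exact (IsEmpty.false x).elim, fun a => a.elim0⟩

lemma isDisjointUnionOfAffineSpaces_of_iso {Y : Scheme.{0}} {s : Y ⟶ Spec (.of ℂ)} {d : ℕ}
    (e : 𝔸(Fin d; Spec (.of ℂ)) ≅ Y)
    (he : e.hom ≫ s = 𝔸(Fin d; Spec (.of ℂ)) ↘ Spec (.of ℂ)) :
    IsDisjointUnionOfAffineSpaces Y s := by
  refine ⟨1, fun _ => ⊤, fun _ => d, fun a b h => (h (Subsingleton.elim a b)).elim, by simp,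
    fun _ => ⟨Scheme.topIso Y ≪≫ e.symm, ?_⟩⟩
  rw [← he]
  simp

/-- `Z' \ Z` with its reduced structure is a disjoint union of affine spaces. -/
def IsAffineStep {Y : Scheme.{0}} (s : Y ⟶ Spec (.of ℂ)) (Z Z' : Closeds Y) : Prop :=
  IsDisjointUnionOfAffineSpaces (reducedDifference Z' Z).toScheme
    ((reducedDifference Z' Z).ι ≫ reducedSubschemeι Z' ≫ s)

lemma isAffineStep_of_isImmersion {Y : Scheme.{0}} {s : Y ⟶ Spec (.of ℂ)}
    {d : ℕ} (g : 𝔸(Fin d; Spec (.of ℂ)) ⟶ Y) [IsImmersion g]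
    (hgs : g ≫ s = 𝔸(Fin d; Spec (.of ℂ)) ↘ Spec (.of ℂ)) {Z' Z : Closeds Y}
    (hg : Set.range g = (Z' : Set Y) \ Z) :
    IsAffineStep s Z Z' := by
  obtain ⟨e, he⟩ := exists_iso_reducedDifference g hg
  exact isDisjointUnionOfAffineSpaces_of_iso e (by rw [← hgs, ← he]; simp)

lemma isAffineStep_self {Y : Scheme.{0}} {s : Y ⟶ Spec (.of ℂ)} (Z : Closeds Y) :
    IsAffineStep s Z Z := by
  have : IsEmpty (reducedDifference Z Z).toScheme := by
    refine ⟨fun y => y.2 ?_⟩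
    exact (range_reducedSubschemeι Z).subset ⟨y.1, rfl⟩
  exact isDisjointUnionOfAffineSpaces_of_isEmpty _

/-- A closed subset of `Y` with a filtration by closed subsets with differences disjoint unions of
affine spaces. -/
def HasCellularFiltration {Y : Scheme.{0}} (s : Y ⟶ Spec (.of ℂ)) (C : Closeds Y) : Prop :=
  ∃ (n : ℕ) (Z : ℕ → Closeds Y), Monotone Z ∧ Z 0 = ⊥ ∧ Z n = C ∧
    ∀ i < n, IsAffineStep s (Z i) (Z (i + 1))

lemma hasCellularFiltration_bot {Y : Scheme.{0}} (s : Y ⟶ Spec (.of ℂ)) :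
    HasCellularFiltration s ⊥ :=
  ⟨0, fun _ => ⊥, monotone_const, rfl, rfl, fun _ h => (Nat.not_lt_zero _ h).elim⟩

lemma HasCellularFiltration.step {Y : Scheme.{0}} {s : Y ⟶ Spec (.of ℂ)} {C C' : Closeds Y}
    (h : HasCellularFiltration s C) (hle : C ≤ C')
    (hd : IsAffineStep s C C') : HasCellularFiltration s C' := by
  obtain ⟨n, Z, hm, h0, rfl, hZ⟩ := h
  refine ⟨n + 1, fun i => if i ≤ n then Z i else C', ?_, by simpa using h0, by simp, ?_⟩
  · intro i j hij
    dsimp only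
    split_ifs with h1 h2 h2
    · exact hm hij
    · exact (hm h1).trans hle
    · omega
    · exact le_rfl
  · intro i hi
    rcases Nat.lt_succ_iff_lt_or_eq.1 hi with h | rfl
    · have := hZ i h
      dsimp only
      rwa [if_pos h.le, if_pos (show i + 1 ≤ n from h)]
    · dsimp only
      rwa [if_pos le_rfl, if_neg (by omega)]

end ReducedSubscheme

/-! ### Closed immersions tested on charts -/

section Locality

lemma range_fst_of_isPullback {P X Y Z : Scheme.{0}} {fst : P ⟶ X} {snd : P ⟶ Y} {f : X ⟶ Z}
    {g : Y ⟶ Z} (h : IsPullback fst snd f g) : Set.range fst = f ⁻¹' Set.range g := by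
  ext x
  constructor
  · rintro ⟨p, rfl⟩
    exact ⟨snd p, by rw [← Scheme.Hom.comp_apply, ← h.w]; rfl⟩
  · rintro ⟨y, hy⟩
    obtain ⟨p, hp, -⟩ := Scheme.exists_preimage_of_isPullback h x y hy.symm
    exact ⟨p, hp⟩

/-- A morphism with closed range is a closed immersion if it restricts to closed immersions over
charts of the target that cover its range. -/
lemma isClosedImmersion_of_isPullback {X Y : Scheme.{0}} (f : X ⟶ Y) (hf : IsClosed (Set.range f))
    (h : ∀ x, ∃ (V W : Scheme.{0}) (j : V ⟶ Y) (k : W ⟶ X) (g : W ⟶ V), IsOpenImmersion j ∧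
      IsClosedImmersion g ∧ IsPullback k g f j ∧ f x ∈ Set.range j) :
    IsClosedImmersion f := by
  -- These two instances allow `IsImmersion` to be tested on preimages of opens that cover only the
  -- image of `f`.
  have : MorphismProperty.RespectsRight @IsImmersion @IsOpenImmersion :=
    ⟨fun i hi f hf => by
      have : IsOpenImmersion i := hi
      have : IsImmersion f := hf
      infer_instance⟩
  have : MorphismProperty.HasOfPostcompProperty @IsImmersion @IsOpenImmersion :=
    ⟨fun f g hg hfg => by
      have : IsImmersion (f ≫ g) := hfg
      exact IsImmersion.of_comp f g⟩
  have : IsImmersion f := by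
    refine IsZariskiLocalAtTarget.of_forall_source_exists_preimage f fun x => ?_
    obtain ⟨V, W, j, k, g, hj, hg, hp, hx⟩ := h x
    refine ⟨j.opensRange, hx, ?_⟩
    have hk : IsOpenImmersion k := MorphismProperty.of_isPullback hp.flip inferInstance
    have hr : Set.range k = Set.range (f ⁻¹ᵁ j.opensRange).ι := by
      rw [Scheme.Opens.range_ι, range_fst_of_isPullback hp]
      rfl
    -- `W` is the preimage of the chart, and there `f` is `g` followed by `j`.
    let e := IsOpenImmersion.isoOfRangeEq k _ hr
    have he : e.inv ≫ k = (f ⁻¹ᵁ j.opensRange).ι := IsOpenImmersion.isoOfRangeEq_inv_fac _ _ _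
    rw [← he, Category.assoc, hp.w]
    infer_instance
  exact .of_isPreimmersion f hf

end Locality

/-! ### Closures of orbits in charts -/

section EdgeHom

variable {N : Type} [AddCommGroup N] {σ τ : PointedCone ℝ (ℝ ⊗[ℤ] N)} {u v : N}
  {R S : Type} [CommRing R] [Algebra ℂ R] [CommRing S] [Algebra ℂ S]

lemma coneRing_algHom_ext {f g : coneRing σ →ₐ[ℂ] R}
    (h : ∀ m, f (AddMonoidAlgebra.single m 1) = g (AddMonoidAlgebra.single m 1)) : f = g :=
  AddMonoidAlgebra.algHom_ext h (by ext)

open Classical in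
/-- For `u, v ∈ σ` and `t ∈ R`, the homomorphism `ℂ[S_σ] → R` that sends `χ^m` to `t ^ ⟨m, v⟩` if
`⟨m, u⟩ = 0`, and to `0` otherwise. -/
def edgeHom (hu : lat u ∈ σ) (hv : lat v ∈ σ) (t : R) : coneRing σ →ₐ[ℂ] R :=
  AddMonoidAlgebra.lift ℂ R (dualMonoid σ)
    { toFun := fun m => if m.toAdd.1 u = 0 then t ^ (m.toAdd.1 v).toNat else 0
      map_one' := by simp
      map_mul' := fun m m' => by
        have h1 := nonneg_of_mem_dualMonoid m.toAdd.2 hu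
        have h2 := nonneg_of_mem_dualMonoid m'.toAdd.2 hu
        have h3 := nonneg_of_mem_dualMonoid m.toAdd.2 hv
        have h4 := nonneg_of_mem_dualMonoid m'.toAdd.2 hv
        simp only [toAdd_mul, AddSubmonoid.coe_add, LinearMap.add_apply]
        by_cases h : m.toAdd.1 u = 0
        · by_cases h' : m'.toAdd.1 u = 0
          · rw [if_pos h, if_pos h', if_pos (by omega), ← pow_add, Int.toNat_add h3 h4]
          · rw [if_neg h', if_neg (by omega), mul_zero]
        · rw [if_neg h, if_neg (by omega), zero_mul] }

open Classical in
lemma edgeHom_single (hu : lat u ∈ σ) (hv : lat v ∈ σ) (t : R) (m : dualMonoid σ) (a : ℂ) :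
    edgeHom hu hv t (AddMonoidAlgebra.single m a) =
      a • if m.1 u = 0 then t ^ (m.1 v).toNat else 0 :=
  AddMonoidAlgebra.lift_single _ _ _

open Classical in
lemma edgeHom_single_one (hu : lat u ∈ σ) (hv : lat v ∈ σ) (t : R) (m : dualMonoid σ) :
    edgeHom hu hv t (AddMonoidAlgebra.single m 1) =
      if m.1 u = 0 then t ^ (m.1 v).toNat else 0 := by
  rw [edgeHom_single, one_smul]

lemma comp_edgeHom (f : R →ₐ[ℂ] S) (hu : lat u ∈ σ) (hv : lat v ∈ σ) (t : R) :
    f.comp (edgeHom hu hv t) = edgeHom hu hv (f t) := by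
  refine coneRing_algHom_ext fun m => ?_
  rw [AlgHom.comp_apply, edgeHom_single_one, edgeHom_single_one]
  split_ifs <;> simp

lemma coneRingMap_single (h : τ ≤ σ) (m : dualMonoid σ) (a : ℂ) :
    coneRingMap h (AddMonoidAlgebra.single m a) =
      AddMonoidAlgebra.single (AddSubmonoid.inclusion (dualMonoid_anti h) m) a := by
  simp [coneRingMap]

/-- The inclusion `ℂ[S_σ] → ℂ[S_τ]` as an algebra homomorphism. -/
def coneAlgHom (h : τ ≤ σ) : coneRing σ →ₐ[ℂ] coneRing τ :=
  { coneRingMap h with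
    commutes' := fun a => by
      simp [coneRingMap] }

lemma edgeHom_comp_coneAlgHom (h : τ ≤ σ) (hu : lat u ∈ τ) (hv : lat v ∈ τ) (t : R) :
    (edgeHom hu hv t).comp (coneAlgHom h) = edgeHom (h hu) (h hv) t := by
  refine coneRing_algHom_ext fun m => ?_
  rw [AlgHom.comp_apply, edgeHom_single_one]
  change edgeHom hu hv t (coneRingMap h _) = _
  rw [coneRingMap_single, edgeHom_single_one]
  rfl

open Classical in
/-- For `u ∈ σ` and a unit `t` of `R`, the homomorphism `ℂ[S_σ] → R` that sends `χ^m` to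
`t ^ ⟨m, v⟩` if `⟨m, u⟩ = 0`, and to `0` otherwise. -/
def edgeUnitHom (hu : lat u ∈ σ) (v : N) (t : Rˣ) : coneRing σ →ₐ[ℂ] R :=
  AddMonoidAlgebra.lift ℂ R (dualMonoid σ)
    { toFun := fun m => if m.toAdd.1 u = 0 then ((t ^ (m.toAdd.1 v) : Rˣ) : R) else 0
      map_one' := by simp
      map_mul' := fun m m' => by
        have h1 := nonneg_of_mem_dualMonoid m.toAdd.2 hu
        have h2 := nonneg_of_mem_dualMonoid m'.toAdd.2 hu
        simp only [toAdd_mul, AddSubmonoid.coe_add, LinearMap.add_apply]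
        by_cases h : m.toAdd.1 u = 0
        · by_cases h' : m'.toAdd.1 u = 0
          · rw [if_pos h, if_pos h', if_pos (by omega), zpow_add, Units.val_mul]
          · rw [if_neg h', if_neg (by omega), mul_zero]
        · rw [if_neg h, if_neg (by omega), zero_mul] }

open Classical in
lemma edgeUnitHom_single_one (hu : lat u ∈ σ) (v : N) (t : Rˣ) (m : dualMonoid σ) :
    edgeUnitHom hu v t (AddMonoidAlgebra.single m 1) =
      if m.1 u = 0 then ((t ^ (m.1 v) : Rˣ) : R) else 0 := by
  refine (AddMonoidAlgebra.lift_single _ _ _).trans ?_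
  rw [one_smul]
  rfl

/-- A unit has negative powers, so the homomorphism extends to the larger monoid of `τ` although `τ`
need not contain `v`. This restricts the edge to the big orbit of the ray. -/
lemma edgeUnitHom_comp_coneAlgHom (h : τ ≤ σ) (hu : lat u ∈ τ) (hv : lat v ∈ σ) (t : Rˣ) :
    (edgeUnitHom hu v t).comp (coneAlgHom h) = edgeHom (h hu) hv (t : R) := by
  refine coneRing_algHom_ext fun m => ?_
  rw [AlgHom.comp_apply, edgeHom_single_one]
  change edgeUnitHom hu v t (coneRingMap h _) = _
  rw [coneRingMap_single, edgeUnitHom_single_one]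
  have h1 := nonneg_of_mem_dualMonoid m.2 hv
  change (if m.1 u = 0 then ((t ^ (m.1 v) : Rˣ) : R) else 0) = _
  split_ifs
  · obtain ⟨k, hk⟩ := Int.eq_ofNat_of_zero_le h1
    rw [hk]
    simp
  · rfl

/-- Both areas are `1`, so `v + w` is a multiple of `u`, and `m w = -m v` whenever `m u = 0`. This
is the transition `t ↦ t⁻¹` of the projective line. -/
lemma edgeUnitHom_inv (b : Module.Basis (Fin 2) ℤ N) {w : N} (huv : area b u v = 1)
    (hwu : area b w u = 1) (hu : lat u ∈ σ) (t : Rˣ) :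
    edgeUnitHom hu v t = edgeUnitHom hu w t⁻¹ := by
  refine coneRing_algHom_ext fun m => ?_
  rw [edgeUnitHom_single_one, edgeUnitHom_single_one]
  split_ifs with h
  · have := area_mul_dual b m.1 u v w
    rw [huv, h, area_swap b u w, hwu] at this
    rw [inv_zpow', show m.1 w = -m.1 v by linarith, neg_neg]
  · rfl

/-- The morphism `Spec R → U_σ` given by `edgeHom`. -/
def edgeMap (hu : lat u ∈ σ) (hv : lat v ∈ σ) (t : R) : Spec (.of R) ⟶ (affineToric N).obj σ :=
  Spec.map (CommRingCat.ofHom (edgeHom hu hv t).toRingHom)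

lemma SpecMap_edgeMap (f : R →ₐ[ℂ] S) (hu : lat u ∈ σ) (hv : lat v ∈ σ) (t : R) :
    Spec.map (CommRingCat.ofHom f.toRingHom) ≫ edgeMap hu hv t = edgeMap hu hv (f t) := by
  rw [edgeMap, edgeMap, ← comp_edgeHom]
  exact (Spec.map_comp _ _).symm

lemma edgeMap_map (h : τ ≤ σ) (hu : lat u ∈ τ) (hv : lat v ∈ τ) (t : R) :
    edgeMap hu hv t ≫ (affineToric N).map (homOfLE h) = edgeMap (h hu) (h hv) t := by
  rw [edgeMap, edgeMap, ← edgeHom_comp_coneAlgHom h hu hv]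
  exact (Spec.map_comp _ _).symm

lemma edgeMap_affineToSpecC (hu : lat u ∈ σ) (hv : lat v ∈ σ) (t : R) :
    edgeMap hu hv t ≫ affineToSpecC σ = Spec.map (CommRingCat.ofHom (algebraMap ℂ R)) := by
  rw [← (edgeHom hu hv t).comp_algebraMap]
  exact (Spec.map_comp _ _).symm

/-- The unit version factors through the chart of the ray. -/
lemma edgeMap_eq_of_le (h : τ ≤ σ) (hu : lat u ∈ τ) (hv : lat v ∈ σ) (t : Rˣ) :
    edgeMap (h hu) hv (t : R) =
      Spec.map (CommRingCat.ofHom (edgeUnitHom hu v t).toRingHom) ≫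
        (affineToric N).map (homOfLE h) := by
  rw [edgeMap, ← edgeUnitHom_comp_coneAlgHom h hu hv]
  exact Spec.map_comp (CommRingCat.ofHom (coneRingMap h))
    (CommRingCat.ofHom (edgeUnitHom hu v t).toRingHom)

variable {b : Module.Basis (Fin 2) ℤ N}

lemma neg_area_mem_dualMonoid (huv : area b u v = 1) : -area b v ∈ dualMonoid (cone₂ u v) :=
  mem_dualMonoid_cone₂.2 (by simp [area_swap b v u, huv])

lemma area_mem_dualMonoid (huv : area b u v = 1) : area b u ∈ dualMonoid (cone₂ u v) :=
  mem_dualMonoid_cone₂.2 (by simp [huv])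

/-- The kernel of `edgeHom` on a smooth cone is generated by the coordinate of the edge. -/
lemma sub_aeval_edgeHom_mem (huv : area b u v = 1) (z : coneRing (cone₂ u v)) :
    z - Polynomial.aeval (AddMonoidAlgebra.single ⟨_, area_mem_dualMonoid huv⟩ 1)
        (edgeHom (left_mem_cone₂ u v) (right_mem_cone₂ u v) (Polynomial.X : Polynomial ℂ) z) ∈
      Ideal.span {(AddMonoidAlgebra.single ⟨_, neg_area_mem_dualMonoid huv⟩ 1 :
        coneRing (cone₂ u v))} := by
  induction z using AddMonoidAlgebra.induction_linear with
  | zero => simp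
  | add x y hx hy =>
    rw [map_add, map_add, add_sub_add_comm]
    exact add_mem hx hy
  | single m a =>
    obtain ⟨h1, h2⟩ := mem_dualMonoid_cone₂.1 m.2
    have hm := area_mul_dual b m.1 u v
    rw [huv] at hm
    rw [edgeHom_single]
    -- A monomial with `m u = 0` is a power of the coordinate dual to `v` and is recovered by the
    -- section; any other one is divisible by the coordinate dual to `u`.
    by_cases h : m.1 u = 0
    · rw [if_pos h, map_smul, map_pow, Polynomial.aeval_X, AddMonoidAlgebra.single_pow,
        AddMonoidAlgebra.smul_single, one_pow, smul_eq_mul, mul_one, sub_eq_zero.2]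
      · exact zero_mem _
      · congr 1
        ext1
        rw [AddSubmonoidClass.coe_nsmul]
        ext w
        have := hm w
        rw [h] at this
        rw [LinearMap.smul_apply, nsmul_eq_mul, Int.toNat_of_nonneg h2]
        linarith
    · rw [if_neg h, smul_zero, map_zero, sub_zero]
      have h1 : 1 ≤ m.1 u := by omega
      have hd : m.1 - -area b v ∈ dualMonoid (cone₂ u v) := by
        refine mem_dualMonoid_cone₂.2 ?_
        simp only [LinearMap.sub_apply, LinearMap.neg_apply, area_self, area_swap b v u, huv]
        omega
      rw [Ideal.mem_span_singleton]
      refine ⟨AddMonoidAlgebra.single ⟨_, hd⟩ a, ?_⟩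
      rw [AddMonoidAlgebra.single_mul_single, one_mul]
      congr 1
      ext1
      simp

lemma edgeHom_surjective (huv : area b u v = 1) : Function.Surjective
    (edgeHom (left_mem_cone₂ u v) (right_mem_cone₂ u v) (Polynomial.X : Polynomial ℂ)) := by
  intro p
  refine ⟨Polynomial.aeval (AddMonoidAlgebra.single ⟨_, area_mem_dualMonoid huv⟩ 1) p, ?_⟩
  rw [← AlgHom.comp_apply]
  have : (edgeHom (left_mem_cone₂ u v) (right_mem_cone₂ u v) (Polynomial.X : Polynomial ℂ)).comp
      (Polynomial.aeval (AddMonoidAlgebra.single ⟨_, area_mem_dualMonoid huv⟩ 1)) =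
      AlgHom.id ℂ _ := by
    ext
    rw [AlgHom.comp_apply, Polynomial.aeval_X, edgeHom_single_one]
    simp [huv]
  rw [this]
  rfl

lemma isClosedImmersion_edgeMap (huv : area b u v = 1) : IsClosedImmersion
    (edgeMap (left_mem_cone₂ u v) (right_mem_cone₂ u v) (Polynomial.X : Polynomial ℂ)) :=
  IsClosedImmersion.spec_of_surjective _ (edgeHom_surjective huv)

lemma range_edgeMap (huv : area b u v = 1) :
    Set.range (edgeMap (left_mem_cone₂ u v) (right_mem_cone₂ u v) (Polynomial.X : Polynomial ℂ)) =
      (PrimeSpectrum.zeroLocus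
        {(AddMonoidAlgebra.single ⟨_, neg_area_mem_dualMonoid huv⟩ 1 : coneRing (cone₂ u v))} :
        Set (PrimeSpectrum (coneRing (cone₂ u v)))) := by
  refine (range_comap_of_surjective _ _ (edgeHom_surjective huv)).trans ?_
  rw [← PrimeSpectrum.zeroLocus_span {_}]
  congr 2
  apply le_antisymm
  · intro z hz
    have h0 : edgeHom (left_mem_cone₂ u v) (right_mem_cone₂ u v) (Polynomial.X : Polynomial ℂ) z
      = 0 := hz
    have := sub_aeval_edgeHom_mem huv z
    rwa [h0, map_zero, sub_zero] at this
  · rw [Ideal.span_singleton_le_iff_mem, RingHom.mem_ker]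
    refine (edgeHom_single_one _ _ _ _).trans (if_neg ?_)
    simp [area_swap b v u, huv]

end EdgeHom

/-! ### Toric charts, orbit closures and the exceptional locus -/

section Charts

variable {N : Type} [AddCommGroup N] {F : Fan N}

namespace Fan

instance (σ : F.cones) : IsOpenImmersion (F.chart σ) :=
  inferInstanceAs (IsOpenImmersion (colimit.ι F.diagram σ))

/-- The open subset `U_σ` of the toric variety. -/
def chartRange (σ : F.cones) : F.toricVariety.Opens := (F.chart σ).opensRange

lemma chart_mem_chartRange (σ : F.cones) (p : (affineToric N).obj σ.1) :
    F.chart σ p ∈ chartRange σ := ⟨p, rfl⟩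

lemma chartRange_mono {σ τ : F.cones} (h : τ.1 ≤ σ.1) : chartRange τ ≤ chartRange σ := by
  rintro _ ⟨p, rfl⟩
  rw [← F.map_chart (show τ ≤ σ from h), Scheme.Hom.comp_apply]
  exact chart_mem_chartRange _ _

lemma exists_mem_chartRange (x : F.toricVariety) : ∃ σ : F.cones, x ∈ chartRange σ := by
  obtain ⟨σ, p, hp⟩ := Scheme.IsLocallyDirected.ι_jointly_surjective F.diagram x
  exact ⟨σ, p, hp⟩

/-- The intersection of two cones of the fan, as a cone of the fan. -/
def infCone (σ τ : F.cones) : F.cones :=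
  ⟨σ.1 ⊓ τ.1, F.face_mem _ σ.2 _ (F.inter_face _ σ.2 _ τ.2).1⟩

/-- Points of two charts are identified only through the chart of a common subcone in the fan, and
that chart lies in the chart of the intersection. -/
lemma mem_chartRange_infCone {σ τ : F.cones} {x : F.toricVariety} (h : x ∈ chartRange σ)
    (h' : x ∈ chartRange τ) : x ∈ chartRange (infCone σ τ) := by
  obtain ⟨p, hp⟩ := h
  obtain ⟨q, hq⟩ := h'
  obtain ⟨ρ, fσ, fτ, y, hy, -⟩ :=
    (Scheme.IsLocallyDirected.ι_eq_ι_iff F.diagram).1 (hp.trans hq.symm)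
  refine chartRange_mono (τ := ρ) (le_inf (leOfHom fσ) (leOfHom fτ)) ⟨y, ?_⟩
  rw [← hp, ← hy]
  exact congrArg (fun f : (affineToric N).obj ρ.1 ⟶ F.toricVariety => f y)
    (F.map_chart (leOfHom fσ)).symm

/-- The orbit of `x` corresponds to the smallest cone whose chart contains `x`. -/
lemma exists_minimal_chartRange (x : F.toricVariety) :
    ∃ τ : F.cones, x ∈ chartRange τ ∧ ∀ σ : F.cones, x ∈ chartRange σ → τ.1 ≤ σ.1 := by
  have := F.finite.to_subtype
  obtain ⟨τ, hτ⟩ := (Set.toFinite {τ : F.cones | x ∈ chartRange τ}).exists_minimal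
    (exists_mem_chartRange x)
  refine ⟨τ, hτ.1, fun σ hσ => ?_⟩
  have h1 : infCone τ σ ≤ τ := show τ.1 ⊓ σ.1 ≤ τ.1 from inf_le_left
  have h2 : τ ≤ infCone τ σ := hτ.2 (mem_chartRange_infCone hτ.1 hσ) h1
  exact (show τ.1 ≤ τ.1 ⊓ σ.1 from h2).trans inf_le_right

/-- The chart of a face is the locus where the character of the supporting functional is invertible,
so membership becomes a condition on prime ideals. -/
lemma chart_mem_chartRange_iff {σ τ : F.cones} {m : Module.Dual ℤ N} (hm : m ∈ dualMonoid σ.1)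
    (hτ : ∀ x, x ∈ τ.1 ↔ x ∈ σ.1 ∧ pairing m x = 0) (p : PrimeSpectrum (coneRing σ.1)) :
    F.chart σ p ∈ chartRange τ ↔
      (AddMonoidAlgebra.single ⟨m, hm⟩ 1 : coneRing σ.1) ∉ p.asIdeal := by
  have hle : τ.1 ≤ σ.1 := fun x hx => ((hτ x).1 hx).1
  have hr := range_affineToric (F.rational _ σ.2) hm hτ (homOfLE hle)
  have h1 : F.chart σ p ∈ chartRange τ ↔
      p ∈ Set.range ((affineToric N).map (homOfLE hle)) := by
    constructor
    · rintro ⟨q, hq⟩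
      refine ⟨q, (F.chart σ).isOpenEmbedding.injective ?_⟩
      rw [← Scheme.Hom.comp_apply, F.map_chart (show τ ≤ σ from hle)]
      exact hq
    · rintro ⟨q, rfl⟩
      refine ⟨q, ?_⟩
      rw [← F.map_chart (show τ ≤ σ from hle)]
      rfl
  rw [h1, hr]
  rfl

variable (F) in
/-- The closure of the orbit of the ray through `u`: its points lie only in the charts of the cones
that contain `u`. -/
def orbitClosure (u : N) : Closeds F.toricVariety where
  carrier := {x | ∀ τ : F.cones, x ∈ chartRange τ → lat u ∈ τ.1}
  isClosed' := by
    have : {x : F.toricVariety | ∀ τ : F.cones, x ∈ chartRange τ → lat u ∈ τ.1} =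
        (⋃ τ : {τ : F.cones // lat u ∉ τ.1}, (chartRange τ.1 : Set F.toricVariety))ᶜ := by
      ext x
      simp only [Set.mem_ofPred_eq, Set.mem_compl_iff, Set.mem_iUnion, Subtype.exists, not_exists,
        SetLike.mem_coe]
      exact ⟨fun h τ hτ hu hx => hu (h _ hx), fun h τ hx => by
        by_contra hu
        exact h τ.1 τ.2 hu hx⟩
    rw [this, isClosed_compl_iff]
    exact isOpen_iUnion fun τ => (chartRange τ.1).isOpen

/-- The chart of a two-dimensional smooth cone meets the orbit closure of an edge in an affine
line. -/
lemma range_edgeMap_chart {b : Module.Basis (Fin 2) ℤ N} {u v : N} (huv : area b u v = 1)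
    (hF : cone₂ u v ∈ F.cones) :
    Set.range (edgeMap (left_mem_cone₂ u v) (right_mem_cone₂ u v) (Polynomial.X : Polynomial ℂ) ≫
        F.chart ⟨_, hF⟩) =
      (F.orbitClosure u : Set F.toricVariety) ∩ chartRange ⟨_, hF⟩ := by
  rw [Scheme.Hom.comp_base, TopCat.coe_comp, Set.range_comp]
  ext x
  constructor
  · rintro ⟨_, ⟨q, rfl⟩, rfl⟩
    refine ⟨fun τ hτ => ?_, chart_mem_chartRange _ _⟩
    by_contra hu
    have hx := mem_chartRange_infCone (chart_mem_chartRange (F := F) ⟨_, hF⟩ _) hτ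
    obtain ⟨m, hm, hf⟩ := (F.inter_face _ hF _ τ.2).1
    -- A chart whose cone omits `u` meets this one where the character of some `m` with `m u ≠ 0` is
    -- invertible, but that character vanishes on the edge.
    refine (chart_mem_chartRange_iff (σ := ⟨_, hF⟩) (τ := infCone ⟨_, hF⟩ τ) hm hf _).1 hx ?_
    change edgeHom (left_mem_cone₂ u v) (right_mem_cone₂ u v) (Polynomial.X : Polynomial ℂ) _ ∈
      q.asIdeal
    rw [edgeHom_single_one, if_neg]
    · exact zero_mem _
    · intro h0
      exact hu ((lat_mem_face_iff hf).2 ⟨left_mem_cone₂ u v, h0⟩).2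
  · rintro ⟨h1, p, rfl⟩
    refine ⟨p, ?_, rfl⟩
    -- The chart of the ray `v` is excluded because that ray omits `u`. Its complement in the chart
    -- of `cone₂ u v` is the zero locus of the coordinate dual to `u`, which is the edge.
    have hrv := ray_right_mem huv hF
    have h2 : F.chart ⟨_, hF⟩ p ∉ chartRange ⟨_, hrv⟩ := by
      intro h
      have huv' : area b v (-u) = 1 := by rw [map_neg, ← area_swap, huv]
      have := ((lat_mem_ray_iff huv').1 (h1 _ h)).1
      rw [area_swap, huv] at this
      omega
    rw [chart_mem_chartRange_iff (σ := ⟨_, hF⟩) (τ := ⟨_, hrv⟩) (neg_area_mem_dualMonoid huv)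
      (mem_ray_right_iff huv) p, not_not] at h2
    rw [range_edgeMap huv]
    exact (PrimeSpectrum.mem_zeroLocus _ _).2 (Set.singleton_subset_iff.2 h2)

end Fan

variable {b : Module.Basis (Fin 2) ℤ N} {F' : Fan N} {u v w : N}

variable (b F) in
/-- The ray through `u` is the common face of the smooth cones spanned by `u, v` and `w, u`, on the
positive and on the negative side. -/
structure HasNeighbours (u v w : N) : Prop where
  area_right : area b u v = 1
  right_mem : cone₂ u v ∈ F.cones
  area_left : area b w u = 1
  left_mem : cone₂ w u ∈ F.cones

lemma HasNeighbours.swap (h : HasNeighbours F b u v w) :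
    HasNeighbours F (b.reindex (Equiv.swap 0 1)) u w v where
  area_right := by rw [area_reindex_swap, h.area_left]
  right_mem := by rw [cone₂_comm]; exact h.left_mem
  area_left := by rw [area_reindex_swap, h.area_right]
  left_mem := by rw [cone₂_comm]; exact h.right_mem

lemma HasNeighbours.prim (h : HasNeighbours F b u v w) : IsPrim b u := ⟨v, h.area_right⟩

lemma HasNeighbours.ray_mem (h : HasNeighbours F b u v w) : ray u ∈ F.cones :=
  ray_left_mem h.area_right h.right_mem

lemma IsNewRay.exists_hasNeighbours (hu : IsNewRay b F F' u) (hF : F'.IsSmooth)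
    (href : F'.Refines F) : ∃ v w, HasNeighbours F' b u v w := by
  obtain ⟨v, hv, hv'⟩ := hu.exists_next hF href
  obtain ⟨w, hw, hw'⟩ := hu.exists_prev hF href
  exact ⟨v, w, hv, hv', hw, hw'⟩

namespace Fan

/-- The smallest cone for `x` contains `u`, and a ray of a smooth fan lies only in itself and in at
most one two-dimensional cone on each side. -/
lemma mem_chartRange_or_of_mem_orbitClosure (hF : F.IsSmooth) (h : HasNeighbours F b u v w)
    {x : F.toricVariety} (hx : x ∈ F.orbitClosure u) :
    x ∈ chartRange ⟨_, h.right_mem⟩ ∨ x ∈ chartRange ⟨_, h.left_mem⟩ := by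
  obtain ⟨τ, hτ, -⟩ := exists_minimal_chartRange x
  have hle : τ.1 ≤ cone₂ u v ∨ τ.1 ≤ cone₂ w u := by
    rcases cases_of_ray_mem hF h.prim h.ray_mem τ.2 (hx τ hτ) with h0 | ⟨z, ⟨hz, h0⟩ | ⟨hz, h0⟩⟩
    · exact Or.inl (h0.trans_le (ray_le.2 (left_mem_cone₂ u v)))
    · have := τ.2
      rw [h0] at this
      rw [h0, cone₂_right_unique hz h.area_right this h.right_mem]
      exact Or.inl le_rfl
    · have := τ.2
      rw [h0] at this
      rw [h0, cone₂_left_unique hz h.area_left this h.left_mem]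
      exact Or.inr le_rfl
  exact hle.imp (fun h0 => chartRange_mono (F := F) (σ := ⟨_, h.right_mem⟩) h0 hτ)
    (fun h0 => chartRange_mono (F := F) (σ := ⟨_, h.left_mem⟩) h0 hτ)

lemma chart_toSpecC (σ : F.cones) : F.chart σ ≫ F.toSpecC = affineToSpecC σ.1 :=
  colimit.ι_desc _ _

lemma chart_toricMorphism (href : F'.Refines F) (τ : F'.cones) (σ : F.cones) (h : τ.1 ≤ σ.1) :
    F'.chart τ ≫ toricMorphism href = (affineToric N).map (homOfLE h) ≫ F.chart σ :=
  (colimit.ι_desc _ _).trans (refineChart_eq href τ σ h)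

lemma chart_hom_ext {Y : Scheme.{0}} {f g : F.toricVariety ⟶ Y}
    (h : ∀ σ, F.chart σ ≫ f = F.chart σ ≫ g) : f = g := colimit.hom_ext h

lemma toricMorphism_toSpecC (href : F'.Refines F) :
    toricMorphism href ≫ F.toSpecC = F'.toSpecC := by
  refine chart_hom_ext fun τ => ?_
  rw [← Category.assoc, chart_toricMorphism href τ _ (le_refineCone href τ), Category.assoc,
    chart_toSpecC, chart_toSpecC, affineToSpecC_w]

instance : Subsingleton (Spec (.of ℂ)) := inferInstanceAs (Subsingleton (PrimeSpectrum ℂ))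

/-- The closure of the orbit of a new ray is contracted to a point. -/
lemma toricMorphism_edgeMap_eq (hu : IsNewRay b F F' u) (href : F'.Refines F) (τ : F'.cones)
    (hut : lat u ∈ τ.1) (hvt : lat v ∈ τ.1) {R : Type} [CommRing R] [Algebra ℂ R] (t : R)
    (q q' : Spec (.of R)) :
    toricMorphism href (F'.chart τ (edgeMap hut hvt t q)) =
      toricMorphism href (F'.chart τ (edgeMap hut hvt t q')) := by
  obtain ⟨σ, hσ, hle⟩ := href.exists_le τ.1 τ.2
  -- On the coarser cone `m u = 0` forces `m = 0`, so only the constant character survives and the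
  -- map does not depend on `t`.
  have h1 : edgeHom (hle hut) (hle hvt) t =
      (Algebra.ofId ℂ R).comp (edgeHom (hle hut) (hle hvt) (0 : ℂ)) := by
    rw [comp_edgeHom]
    refine coneRing_algHom_ext fun m => ?_
    rw [edgeHom_single_one, edgeHom_single_one]
    split_ifs with h
    · simp [hu.dual_eq_zero hσ (hle hut) m.2 h]
    · rfl
  have h2 : edgeMap hut hvt t ≫ F'.chart τ ≫ toricMorphism href =
      Spec.map (CommRingCat.ofHom (algebraMap ℂ R)) ≫
        edgeMap (hle hut) (hle hvt) (0 : ℂ) ≫ F.chart ⟨σ, hσ⟩ := by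
    rw [chart_toricMorphism href τ ⟨σ, hσ⟩ hle, ← Category.assoc, edgeMap_map hle, edgeMap, h1,
      ← Category.assoc]
    congr 1
    exact Spec.map_comp _ (CommRingCat.ofHom (algebraMap ℂ R))
  have h3 (q : Spec (.of R)) : toricMorphism href (F'.chart τ (edgeMap hut hvt t q)) =
      (edgeMap (hle hut) (hle hvt) (0 : ℂ) ≫ F.chart ⟨σ, hσ⟩)
        (Spec.map (CommRingCat.ofHom (algebraMap ℂ R)) q) :=
    congrArg (fun f : Spec (.of R) ⟶ F.toricVariety => f q) h2
  rw [h3, h3]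
  congr 1
  exact Subsingleton.elim (α := Spec (.of ℂ)) _ _

end Fan

lemma isOpenImmersion_opensRange_comp {X Y Z : Scheme.{0}} (f : X ⟶ Y) [IsOpenImmersion f]
    (g : Y ⟶ Z) (h : IsOpenImmersion (f ≫ g)) : IsOpenImmersion (f.opensRange.ι ≫ g) := by
  have : f.opensRange.ι ≫ g = f.isoOpensRange.inv ≫ f ≫ g := by
    rw [Scheme.Hom.isoOpensRange_inv_comp_assoc]
  rw [this]
  infer_instance

/-- A non-empty open subset of the affine line has at least two points. -/
lemma not_subsingleton_of_isOpen {O : Set (PrimeSpectrum (Polynomial ℂ))} (hO : IsOpen O)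
    (hne : O.Nonempty) : ¬ O.Subsingleton := by
  intro hs
  obtain ⟨q, hq⟩ := hne
  have h1 : O = {q} := hs.eq_singleton_of_mem hq
  rw [h1] at hO
  -- In a noetherian Jacobson spectrum an open point is also closed. By connectedness it would be
  -- the whole line, making `ℂ[X]` a field.
  have h2 := ((PrimeSpectrum.isOpen_singleton_tfae_of_isNoetherian_of_isJacobsonRing q).out 0 1).1 hO
  have h3 : ({q} : Set (PrimeSpectrum (Polynomial ℂ))) = Set.univ :=
    (isClopen_iff.1 h2).resolve_left (Set.singleton_ne_empty q)
  have h4 : Subsingleton (PrimeSpectrum (Polynomial ℂ)) := by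
    rw [← Set.subsingleton_univ_iff, ← h3]
    exact Set.subsingleton_singleton
  obtain ⟨m, hm⟩ := Ideal.exists_maximal (Polynomial ℂ)
  have h5 : (⟨m, hm.isPrime⟩ : PrimeSpectrum (Polynomial ℂ)) = ⟨⊥, Ideal.isPrime_bot⟩ :=
    Subsingleton.elim _ _
  have h6 : m = ⊥ := congrArg PrimeSpectrum.asIdeal h5
  rw [h6] at hm
  exact Polynomial.not_isField ℂ (Ring.isField_iff_maximal_bot.2 hm)

namespace Fan

/-- An open immersion is injective, but `f` is constant on the edge, and a neighbourhood of `x`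
meets the edge in more than one point. -/
lemma notMem_of_isOpenImmersion_of_mem_chartRange (hu : IsNewRay b F F' u) (href : F'.Refines F)
    (huv : area b u v = 1) (hv : cone₂ u v ∈ F'.cones) {x : F'.toricVariety}
    (hx : x ∈ F'.orbitClosure u) (hxv : x ∈ chartRange ⟨_, hv⟩) (U : F'.toricVariety.Opens)
    (hU : IsOpenImmersion (U.ι ≫ toricMorphism href)) : x ∉ U := by
  intro hxU
  let e := edgeMap (left_mem_cone₂ u v) (right_mem_cone₂ u v) (Polynomial.X : Polynomial ℂ)
  have he : IsClosedImmersion e := isClosedImmersion_edgeMap huv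
  let g := e ≫ F'.chart ⟨_, hv⟩
  have hginj : Function.Injective g := (IsPreimmersion.isEmbedding g).injective
  have hxg : x ∈ Set.range g := by
    rw [range_edgeMap_chart huv hv]
    exact ⟨hx, hxv⟩
  obtain ⟨q, rfl⟩ := hxg
  refine not_subsingleton_of_isOpen (O := ((g ⁻¹ᵁ U : (Spec (.of (Polynomial ℂ))).Opens) : Set (Spec (.of (Polynomial ℂ)))))
    (g ⁻¹ᵁ U).isOpen ⟨q, hxU⟩ ?_
  intro q₁ h₁ q₂ h₂
  apply hginj
  have h := toricMorphism_edgeMap_eq hu href ⟨_, hv⟩ (left_mem_cone₂ u v) (right_mem_cone₂ u v)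
    (Polynomial.X : Polynomial ℂ) q₁ q₂
  have h' : (⟨g q₁, h₁⟩ : U) = ⟨g q₂, h₂⟩ :=
    (U.ι ≫ toricMorphism href).isOpenEmbedding.injective h
  exact congrArg Subtype.val h'

/-- The exceptional locus is the union of the orbit closures of the new rays. -/
lemma mem_exceptionalLocus_iff (b : Module.Basis (Fin 2) ℤ N) (hF : F'.IsSmooth)
    (href : F'.Refines F) {x : F'.toricVariety} :
    x ∈ exceptionalLocus (toricMorphism href) ↔
      ∃ u, IsNewRay b F F' u ∧ x ∈ F'.orbitClosure u := by
  have hE : x ∈ exceptionalLocus (toricMorphism href) ↔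
      ∀ U : F'.toricVariety.Opens, IsOpenImmersion (U.ι ≫ toricMorphism href) → x ∉ U := by
    change ¬ x ∈ sSup {U : F'.toricVariety.Opens | IsOpenImmersion (U.ι ≫ toricMorphism href)} ↔ _
    rw [Opens.mem_sSup]
    push Not
    rfl
  rw [hE]
  constructor
  · intro h
    obtain ⟨τ, hτ, hmin⟩ := exists_minimal_chartRange x
    by_contra hc
    push Not at hc
    -- The smallest cone for `x` contains no new ray, so it belongs to both fans and `f` identifies
    -- its two charts.
    have hτF : τ.1 ∈ F.cones := by
      refine mem_cones_of_forall_not_isNewRay (b := b) hF href τ.2 fun u hu hut => ?_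
      exact hc u hu fun σ hσ => hmin σ hσ hut
    refine h (chartRange τ) ?_ hτ
    refine isOpenImmersion_opensRange_comp (F'.chart τ) (toricMorphism href) ?_
    rw [chart_toricMorphism href τ ⟨τ.1, hτF⟩ le_rfl]
    have h1 : (affineToric N).map (homOfLE (le_refl τ.1)) = 𝟙 _ := (affineToric N).map_id τ.1
    rw [h1, Category.id_comp]
    infer_instance
  · rintro ⟨u, hu, hx⟩ U hU
    obtain ⟨v, w, hn⟩ := hu.exists_hasNeighbours hF href
    rcases mem_chartRange_or_of_mem_orbitClosure hF hn hx with h | h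
    · exact notMem_of_isOpenImmersion_of_mem_chartRange hu href hn.area_right hn.right_mem hx h U hU
    · refine notMem_of_isOpenImmersion_of_mem_chartRange hu.swap href hn.swap.area_right hn.swap.right_mem hx
        ?_ U hU
      exact chartRange_mono (F := F') (σ := ⟨_, hn.swap.right_mem⟩) (τ := ⟨_, hn.left_mem⟩)
        (cone₂_comm _ _).le h

end Fan

end Charts

/-! ### Smoothness -/

section Smoothness

variable {N : Type} [AddCommGroup N] {b : Module.Basis (Fin 2) ℤ N} {F F' : Fan N} {u v : N}
  {σ τ : PointedCone ℝ (ℝ ⊗[ℤ] N)}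

/-- The coordinate ring of a smooth two-dimensional cone is a polynomial ring. -/
def coneRingEquiv (huv : area b u v = 1) :
    MvPolynomial (Fin 2) ℂ ≃ₐ[ℂ] coneRing (cone₂ u v) := by
  refine AlgEquiv.ofAlgHom
    (MvPolynomial.aeval ![AddMonoidAlgebra.single ⟨_, neg_area_mem_dualMonoid huv⟩ 1,
      AddMonoidAlgebra.single ⟨_, area_mem_dualMonoid huv⟩ 1])
    (AddMonoidAlgebra.lift ℂ _ (dualMonoid (cone₂ u v))
      { toFun := fun m => MvPolynomial.X 0 ^ (m.toAdd.1 u).toNat *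
          MvPolynomial.X 1 ^ (m.toAdd.1 v).toNat
        map_one' := by simp
        map_mul' := fun m m' => by
          obtain ⟨h1, h2⟩ := mem_dualMonoid_cone₂.1 m.toAdd.2
          obtain ⟨h3, h4⟩ := mem_dualMonoid_cone₂.1 m'.toAdd.2
          simp only [toAdd_mul, AddSubmonoid.coe_add, LinearMap.add_apply]
          rw [Int.toNat_add h1 h3, Int.toNat_add h2 h4]
          ring }) ?_ ?_
  · refine coneRing_algHom_ext fun m => ?_
    obtain ⟨h1, h2⟩ := mem_dualMonoid_cone₂.1 m.2
    rw [AlgHom.comp_apply, AddMonoidAlgebra.lift_single]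
    simp only [MonoidHom.coe_mk, OneHom.coe_mk, toAdd_ofAdd, one_smul, map_mul, map_pow,
      MvPolynomial.aeval_X, Matrix.cons_val_zero, Matrix.cons_val_one, AlgHom.id_apply,
      AddMonoidAlgebra.single_pow, AddMonoidAlgebra.single_mul_single, one_pow, mul_one]
    congr 1
    ext w
    have hm := area_mul_dual b m.1 u v w
    rw [huv] at hm
    simp only [AddSubmonoid.coe_add, AddSubmonoidClass.coe_nsmul, LinearMap.add_apply,
      LinearMap.smul_apply, nsmul_eq_mul, Int.toNat_of_nonneg h1, Int.toNat_of_nonneg h2,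
      LinearMap.neg_apply]
    linarith
  · refine MvPolynomial.algHom_ext fun i => ?_
    fin_cases i
    all_goals
      simp [AddMonoidAlgebra.lift_single, area_swap b v u, huv]

lemma smooth_affineToSpecC_cone₂ (huv : area b u v = 1) : Smooth (affineToSpecC (cone₂ u v)) := by
  refine (HasRingHomProperty.Spec_iff (P := @Smooth)
    (φ := CommRingCat.ofHom (algebraMap ℂ (coneRing (cone₂ u v))))).2 ?_
  change RingHom.Smooth (algebraMap ℂ (coneRing (cone₂ u v)))
  rw [RingHom.smooth_algebraMap]
  have : Algebra.Smooth ℂ (MvPolynomial (Fin 2) ℂ) := {}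
  exact Algebra.Smooth.of_equiv (coneRingEquiv huv)

lemma smooth_affineToSpecC_of_isFace (hσ : IsRationalPolyhedral σ) (hf : IsFace τ σ)
    (h : Smooth (affineToSpecC σ)) : Smooth (affineToSpecC τ) := by
  have hle : τ ≤ σ := by
    obtain ⟨m, -, hm⟩ := hf
    exact fun x hx => ((hm x).1 hx).1
  have := isOpenImmersion_affineToric hσ hf (homOfLE hle)
  rw [← affineToSpecC_w (homOfLE hle)]
  infer_instance

/-- A smooth cone of lower dimension is a face of a smooth two-dimensional cone, so its chart is
open in an affine plane. -/
lemma smooth_affineToSpecC (b : Module.Basis (Fin 2) ℤ N) (h : IsSmoothCone σ) :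
    Smooth (affineToSpecC σ) := by
  rcases isSmoothCone_cases b h with rfl | ⟨u, v, huv, rfl | rfl⟩
  · have hb : area b (b 0) (b 1) = 1 := by simp [area_apply]
    refine smooth_affineToSpecC_of_isFace (isRationalPolyhedral_cone₂ (b 0) (b 1))
      ⟨_, add_mem (area_mem_dualMonoid hb) (neg_area_mem_dualMonoid hb), fun x => ?_⟩
      (smooth_affineToSpecC_cone₂ hb)
    rw [Submodule.mem_bot, mem_cone₂_iff hb, pairing_add, pairing_neg]
    constructor
    · rintro rfl
      simp
    · rintro ⟨⟨h1, h2⟩, h3⟩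
      rw [real_eq_combination hb x, show pairing (area b (b 0)) x = 0 by linarith,
        show pairing (area b (b 1)) x = 0 by linarith]
      simp
  · have huv' : area b (-v) u = 1 := by rw [area_swap, map_neg, neg_neg, huv]
    exact smooth_affineToSpecC_of_isFace (isRationalPolyhedral_cone₂ (-v) u)
      ⟨_, neg_area_mem_dualMonoid huv', mem_ray_right_iff huv'⟩ (smooth_affineToSpecC_cone₂ huv')
  · exact smooth_affineToSpecC_cone₂ huv

lemma Fan.smooth_toSpecC (b : Module.Basis (Fin 2) ℤ N) (hF : F.IsSmooth) :
    Smooth F.toSpecC := by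
  have : IsZariskiLocalAtSource @Smooth.{0} :=
    HasRingHomProperty.instIsZariskiLocalAtSource (P := @Smooth) (Q := RingHom.Smooth)
  refine (IsZariskiLocalAtSource.iff_of_openCover (P := @Smooth)
    (Scheme.IsLocallyDirected.openCover F.diagram)).2 fun (σ : F.cones) => ?_
  have h : Smooth (F.chart σ ≫ F.toSpecC) := by
    rw [Fan.chart_toSpecC]
    exact smooth_affineToSpecC b (hF _ σ.2)
  exact h

/-- A refinement that is an isomorphism over the smooth locus contracts its exceptional locus to
the singular locus. -/
lemma coe_exceptionalLocus_eq (b : Module.Basis (Fin 2) ℤ N) (hF : F'.IsSmooth)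
    (href : F'.Refines F) (h : IsIso (Fan.toricMorphism href ∣_ smoothLocus F.toSpecC)) :
    (exceptionalLocus (Fan.toricMorphism href) : Set F'.toricVariety) =
      Fan.toricMorphism href ⁻¹' (singularLocus F.toSpecC : Set F.toricVariety) := by
  set f := Fan.toricMorphism href
  change ((sSup {U : F'.toricVariety.Opens | IsOpenImmersion (U.ι ≫ f)} :
    F'.toricVariety.Opens) : Set F'.toricVariety)ᶜ =
      ((f ⁻¹ᵁ smoothLocus F.toSpecC : F'.toricVariety.Opens) : Set F'.toricVariety)ᶜ
  congr 2
  apply le_antisymm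
  -- Where `f` is an open immersion, its image is isomorphic to an open subset of the smooth variety
  -- `X_F'`.
  · refine sSup_le fun U hU x hx => ?_
    have hU : IsOpenImmersion (U.ι ≫ f) := hU
    have hs := Fan.smooth_toSpecC b hF
    change f x ∈ sSup {V : F.toricVariety.Opens | Smooth (V.ι ≫ F.toSpecC)}
    rw [Opens.mem_sSup]
    refine ⟨(U.ι ≫ f).opensRange, ?_, ⟨⟨x, hx⟩, rfl⟩⟩
    change Smooth _
    have : (U.ι ≫ f).opensRange.ι ≫ F.toSpecC =
        (U.ι ≫ f).isoOpensRange.inv ≫ U.ι ≫ F'.toSpecC := by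
      rw [← Fan.toricMorphism_toSpecC href]
      change _ = (U.ι ≫ f).isoOpensRange.inv ≫ U.ι ≫ f ≫ F.toSpecC
      rw [← Category.assoc U.ι, Scheme.Hom.isoOpensRange_inv_comp_assoc]
    rw [this]
    infer_instance
  · refine le_sSup ?_
    change IsOpenImmersion _
    rw [← morphismRestrict_ι]
    infer_instance

end Smoothness

/-! ### The charts of the projective line -/

section ProjectiveLine

open HomogeneousLocalization

instance (f : MvPolynomial (Fin 2) ℂ) : Algebra ℂ (Away lineGrading f) :=
  ((fromZeroRingHom lineGrading (Submonoid.powers f)).comp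
    (algebraMap ℂ (lineGrading 0))).toAlgebra

lemma X_mem_lineGrading (i : Fin 2) : (MvPolynomial.X i : MvPolynomial (Fin 2) ℂ) ∈ lineGrading 1 :=
  MvPolynomial.isHomogeneous_X ℂ i

/-- The inclusion of the degree zero part of a localization. -/
def awayValHom (f : MvPolynomial (Fin 2) ℂ) : Away lineGrading f →ₐ[ℂ] Localization.Away f :=
  { algebraMap (Away lineGrading f) (Localization.Away f) with
    commutes' := fun a => by
      exact (Localization.mk_one_eq_algebraMap (M := Submonoid.powers f)
        (algebraMap ℂ (MvPolynomial (Fin 2) ℂ) a)).trans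
        (IsScalarTower.algebraMap_apply ℂ (MvPolynomial (Fin 2) ℂ) _ a).symm }

lemma awayValHom_injective (f : MvPolynomial (Fin 2) ℂ) : Function.Injective (awayValHom f) :=
  val_injective _

lemma awayValHom_mk {i : Fin 2} (n : ℕ) (a : MvPolynomial (Fin 2) ℂ) (ha) :
    awayValHom (MvPolynomial.X i) (Away.mk lineGrading (X_mem_lineGrading i) n a ha) =
      Localization.mk (S := Submonoid.powers (MvPolynomial.X i : MvPolynomial (Fin 2) ℂ)) a
        ⟨MvPolynomial.X i ^ n, n, rfl⟩ := Away.val_mk (hf := X_mem_lineGrading i) ..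

/-- The coordinate `X (i + 1) / X i` on the `i`-th chart of the projective line. -/
def lineCoord (i : Fin 2) : Away lineGrading (MvPolynomial.X i : MvPolynomial (Fin 2) ℂ) :=
  Away.mk lineGrading (X_mem_lineGrading i) 1 (MvPolynomial.X (i + 1)) (X_mem_lineGrading _)

/-- Setting `X i = 1`. -/
def dehomogenize (i : Fin 2) : MvPolynomial (Fin 2) ℂ →ₐ[ℂ] Polynomial ℂ :=
  MvPolynomial.aeval fun k => if k = i then 1 else Polynomial.X

lemma algebraMap_mul_lineCoord (i : Fin 2) :
    algebraMap (MvPolynomial (Fin 2) ℂ) (Localization.Away (MvPolynomial.X i : MvPolynomial (Fin 2) ℂ))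
      (MvPolynomial.X i) * awayValHom _ (lineCoord i) = algebraMap (MvPolynomial (Fin 2) ℂ) _ (MvPolynomial.X (i + 1)) := by
  rw [lineCoord, awayValHom_mk, ← Localization.mk_one_eq_algebraMap,
      ← Localization.mk_one_eq_algebraMap, Localization.mk_mul, Localization.mk_eq_mk_iff,
      Localization.r_iff_exists]
  exact ⟨1, by simp⟩

/-- A form of degree `n` is `X i ^ n` times its dehomogenization in the quotient coordinate. It
suffices to compare monomials, and for these it follows from the case of the two variables. -/
lemma algebraMap_eq_pow_mul {i : Fin 2} {n : ℕ} {a : MvPolynomial (Fin 2) ℂ}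
    (ha : a ∈ lineGrading n) :
    algebraMap (MvPolynomial (Fin 2) ℂ) (Localization.Away (MvPolynomial.X i : MvPolynomial (Fin 2) ℂ)) a =
      algebraMap (MvPolynomial (Fin 2) ℂ) _ (MvPolynomial.X i) ^ n *
        Polynomial.aeval (awayValHom _ (lineCoord i)) (dehomogenize i a) := by
  have hX (k : Fin 2) : algebraMap (MvPolynomial (Fin 2) ℂ) (Localization.Away (MvPolynomial.X i : MvPolynomial (Fin 2) ℂ))
      (MvPolynomial.X k) = algebraMap (MvPolynomial (Fin 2) ℂ) _ (MvPolynomial.X i) *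
        Polynomial.aeval (awayValHom _ (lineCoord i)) (dehomogenize i (MvPolynomial.X k)) := by
    rw [dehomogenize, MvPolynomial.aeval_X]
    split_ifs with h
    · rw [h, map_one, mul_one]
    · rw [Polynomial.aeval_X, algebraMap_mul_lineCoord]
      congr 2
      omega
  rw [← MvPolynomial.support_sum_monomial_coeff a]
  simp only [map_sum, Finset.mul_sum]
  refine Finset.sum_congr rfl fun d hd => ?_
  have hdeg : d 0 + d 1 = n := by
    have := ha (MvPolynomial.mem_support_iff.1 hd)
    rw [Finsupp.weight_apply, Finsupp.sum_fintype _ _ (by simp)] at this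
    simpa [Fin.sum_univ_two] using this
  rw [MvPolynomial.monomial_eq, Finsupp.prod_fintype _ _ (by simp), Fin.prod_univ_two, ← hdeg]
  simp only [map_mul, map_pow]
  rw [hX 0, hX 1, MvPolynomial.C_eq_algebraMap, AlgHom.commutes, AlgHom.commutes,
    ← IsScalarTower.algebraMap_apply]
  ring

/-- The `i`-th chart of the projective line is an affine line. -/
lemma aeval_lineCoord_bijective (i : Fin 2) :
    Function.Bijective (Polynomial.aeval (R := ℂ) (lineCoord i)) := by
  constructor
  -- Setting `X i = 1` extends to the localization and gives a left inverse.
  · let g : Localization.Away (MvPolynomial.X i : MvPolynomial (Fin 2) ℂ) →+* Polynomial ℂ :=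
      IsLocalization.Away.lift (MvPolynomial.X i) (g := (dehomogenize i).toRingHom)
        (by simp [dehomogenize])
    refine Function.LeftInverse.injective (g := fun z => g (awayValHom _ z)) fun p => ?_
    have h2 : g (awayValHom _ (lineCoord i)) = Polynomial.X := by
      have h := congrArg g (algebraMap_mul_lineCoord i)
      rw [map_mul, IsLocalization.Away.lift_eq, IsLocalization.Away.lift_eq] at h
      simpa [dehomogenize] using h
    have h3 (c : ℂ) : g (algebraMap ℂ _ c) = Polynomial.C c := by
      rw [IsScalarTower.algebraMap_apply ℂ (MvPolynomial (Fin 2) ℂ), IsLocalization.Away.lift_eq]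
      exact (dehomogenize i).commutes c
    change g (awayValHom _ _) = _
    rw [← Polynomial.aeval_algHom_apply, Polynomial.aeval_def, Polynomial.hom_eval₂, h2]
    have : g.comp (algebraMap ℂ _) = Polynomial.C := RingHom.ext h3
    rw [this, Polynomial.eval₂_C_X]
  · intro z
    obtain ⟨n, a, ha, rfl⟩ := Away.mk_surjective lineGrading (X_mem_lineGrading i) z
    refine ⟨dehomogenize i a, awayValHom_injective _ ?_⟩
    rw [awayValHom_mk, ← Polynomial.aeval_algHom_apply, Localization.mk_eq_mk',
      IsLocalization.eq_mk'_iff_mul_eq]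
    rw [algebraMap_eq_pow_mul (i := i) (n := n) (a := a) (by simpa using ha), mul_comm, map_pow]

/-- The coordinate as a homomorphism from the polynomial ring. -/
def lineCoordHom (i : Fin 2) : CommRingCat.of (Polynomial ℂ) ⟶
    CommRingCat.of (Away lineGrading (MvPolynomial.X i : MvPolynomial (Fin 2) ℂ)) :=
  CommRingCat.ofHom (Polynomial.aeval (R := ℂ) (lineCoord i)).toRingHom

instance (i : Fin 2) : IsIso (lineCoordHom i) :=
  (ConcreteCategory.isIso_iff_bijective (lineCoordHom i)).2 (aeval_lineCoord_bijective i)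

/-- The open immersion of the locus `X i ≠ 0` of the projective line. -/
def lineAwayι (i : Fin 2) : Spec (.of (Away lineGrading (MvPolynomial.X i : MvPolynomial (Fin 2) ℂ))) ⟶
    projLine :=
  Proj.awayι lineGrading (MvPolynomial.X i) (X_mem_lineGrading i) (m := 1) Nat.one_pos

instance (i : Fin 2) : IsOpenImmersion (lineAwayι i) := by
  unfold lineAwayι projLine
  infer_instance

/-- The affine line as a chart of the projective line, with coordinate `X (i + 1) / X i`. -/
def lineChart (i : Fin 2) : Spec (.of (Polynomial ℂ)) ⟶ projLine :=
  inv (Spec.map (lineCoordHom i)) ≫ lineAwayι i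

lemma SpecMap_lineChart (i : Fin 2) : Spec.map (lineCoordHom i) ≫ lineChart i = lineAwayι i :=
  IsIso.hom_inv_id_assoc _ _

instance (i : Fin 2) : IsOpenImmersion (lineChart i) := by
  unfold lineChart
  infer_instance

lemma lineChart_projLineToSpecC (i : Fin 2) : lineChart i ≫ projLineToSpecC =
    Spec.map (CommRingCat.ofHom (algebraMap ℂ (Polynomial ℂ))) := by
  rw [← cancel_epi (Spec.map (lineCoordHom i)), ← Category.assoc, SpecMap_lineChart]
  refine (Proj.awayι_toSpecZero_assoc lineGrading (MvPolynomial.X i) (X_mem_lineGrading i) (m := 1)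
    Nat.one_pos _).trans ?_
  rw [← Spec.map_comp, ← Spec.map_comp, lineCoordHom, ← CommRingCat.ofHom_comp,
    ← CommRingCat.ofHom_comp]
  congr 2
  exact (Polynomial.aeval (R := ℂ) (lineCoord i)).comp_algebraMap.symm

/-- The locus `X i ≠ 0`. -/
def lineBasicOpen (i : Fin 2) : projLine.Opens := Proj.basicOpen lineGrading (MvPolynomial.X i)

lemma range_lineChart (i : Fin 2) : Set.range (lineChart i) = (lineBasicOpen i : Set projLine) := by
  have h : (lineChart i).opensRange = lineBasicOpen i := by
    refine Eq.trans ?_ (Proj.opensRange_awayι lineGrading (MvPolynomial.X i) (X_mem_lineGrading i)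
      (m := 1) Nat.one_pos)
    change _ = (lineAwayι i).opensRange
    rw [← Scheme.Hom.opensRange_comp_of_isIso (Spec.map (lineCoordHom i))]
    simp only [SpecMap_lineChart]
  exact congrArg SetLike.coe h

lemma exists_lineChart_eq (x : projLine) : ∃ i q, lineChart i q = x := by
  have h : ⨆ i : Fin 2, Proj.basicOpen lineGrading (MvPolynomial.X i) = ⊤ := by
    refine Proj.iSup_basicOpen_eq_top' lineGrading _ (fun i => ⟨1, X_mem_lineGrading i⟩) ?_
    rw [← top_le_iff]
    intro p _
    have : p ∈ Algebra.adjoin ℂ (Set.range (MvPolynomial.X : Fin 2 → MvPolynomial (Fin 2) ℂ)) := by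
      rw [MvPolynomial.adjoin_range_X]
      trivial
    induction this using Algebra.adjoin_induction with
    | mem x hx => exact Algebra.subset_adjoin hx
    | algebraMap r =>
      exact Subalgebra.algebraMap_mem _ (algebraMap ℂ (lineGrading 0) r)
    | add x y _ _ hx hy => exact add_mem (hx trivial) (hy trivial)
    | mul x y _ _ hx hy => exact mul_mem (hx trivial) (hy trivial)
  have hx : x ∈ ⨆ i : Fin 2, Proj.basicOpen lineGrading (MvPolynomial.X i) := by
    rw [h]; trivial
  obtain ⟨i, hi⟩ := Opens.mem_iSup.1 hx
  have : x ∈ Set.range (lineChart i) := by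
    rw [range_lineChart]; exact hi
  exact ⟨i, this⟩

/-- On the `i`-th chart the other homogeneous coordinate is non-zero exactly where the affine
coordinate is. Indices are in `Fin 2`, so `i + 1` is the other chart. -/
lemma lineChart_mem_range_iff (i : Fin 2) (q : PrimeSpectrum (Polynomial ℂ)) :
    lineChart i q ∈ Set.range (lineChart (i + 1)) ↔ Polynomial.X ∉ q.asIdeal := by
  obtain ⟨p, rfl⟩ := (Spec.map (lineCoordHom i)).surjective q
  rw [range_lineChart, ← Scheme.Hom.comp_apply, SpecMap_lineChart]
  have h := Proj.awayι_preimage_basicOpen lineGrading (X_mem_lineGrading i) (m := 1) Nat.one_pos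
    (X_mem_lineGrading (i + 1)) Nat.one_pos
  have h1 : p ∈ Proj.awayι lineGrading (MvPolynomial.X i) (X_mem_lineGrading i) (m := 1) Nat.one_pos ⁻¹ᵁ
      Proj.basicOpen lineGrading (MvPolynomial.X (i + 1)) ↔ lineCoord i ∉ p.asIdeal := by
    rw [h, lineCoord]
    simp only [Away.isLocalizationElem, pow_one]
    rfl
  refine h1.trans (not_congr ?_)
  change _ ↔ Polynomial.aeval (R := ℂ) (lineCoord i) Polynomial.X ∈ p.asIdeal
  rw [Polynomial.aeval_X]

/-- The coordinate of the first chart on the intersection of the two charts. -/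
lemma exists_isPullback_lineChart : ∃ (R : Type) (_ : CommRing R) (_ : Algebra ℂ R) (s : Rˣ),
    IsPullback (Spec.map (CommRingCat.ofHom (Polynomial.aeval (R := ℂ) (s : R)).toRingHom))
      (Spec.map (CommRingCat.ofHom (Polynomial.aeval (R := ℂ) ((s⁻¹ : Rˣ) : R)).toRingHom))
      (lineChart 0) (lineChart 1) := by
  let x : MvPolynomial (Fin 2) ℂ := MvPolynomial.X 0 * MvPolynomial.X 1
  let α : Away lineGrading (MvPolynomial.X 0 : MvPolynomial (Fin 2) ℂ) →+* Away lineGrading x :=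
    awayMap lineGrading (X_mem_lineGrading 1) rfl
  let β : Away lineGrading (MvPolynomial.X 1 : MvPolynomial (Fin 2) ℂ) →+* Away lineGrading x :=
    awayMap lineGrading (X_mem_lineGrading 0) (mul_comm _ _)
  -- On the overlap the two affine coordinates are inverse to each other.
  have hs : α (lineCoord 0) * β (lineCoord 1) = 1 := by
    apply val_injective
    simp only [α, β, lineCoord, awayMap_mk, val_mul, Away.val_mk, val_one, Localization.mk_mul]
    rw [← Localization.mk_one, Localization.mk_eq_mk_iff, Localization.r_iff_exists]
    refine ⟨1, ?_⟩
    simp [x]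
    ring
  let s : (Away lineGrading x)ˣ := ⟨α (lineCoord 0), β (lineCoord 1), hs, (mul_comm _ _).trans hs⟩
  have hcomp {f g : MvPolynomial (Fin 2) ℂ} (γ : Away lineGrading f →+* Away lineGrading g)
      (hγ : ∀ c, γ (fromZeroRingHom lineGrading _ c) = fromZeroRingHom lineGrading _ c)
      (t : Away lineGrading f) : γ.comp (Polynomial.aeval (R := ℂ) t).toRingHom =
        (Polynomial.aeval (R := ℂ) (γ t)).toRingHom := by
    refine Polynomial.ringHom_ext (fun c => ?_) ?_
    · change γ (Polynomial.aeval (R := ℂ) t (Polynomial.C c)) =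
        Polynomial.aeval (R := ℂ) (γ t) (Polynomial.C c)
      rw [Polynomial.aeval_C, Polynomial.aeval_C]
      exact hγ (algebraMap ℂ (lineGrading 0) c)
    · change γ (Polynomial.aeval (R := ℂ) t Polynomial.X) =
        Polynomial.aeval (R := ℂ) (γ t) Polynomial.X
      rw [Polynomial.aeval_X, Polynomial.aeval_X]
  have hα : lineCoordHom 0 ≫ CommRingCat.ofHom α =
      CommRingCat.ofHom (Polynomial.aeval (R := ℂ) (s : Away lineGrading x)).toRingHom :=
    CommRingCat.hom_ext (hcomp α (awayMap_fromZeroRingHom lineGrading _ _) _)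
  have hβ : lineCoordHom 1 ≫ CommRingCat.ofHom β = CommRingCat.ofHom
      (Polynomial.aeval (R := ℂ) ((s⁻¹ : (Away lineGrading x)ˣ) : Away lineGrading x)).toRingHom :=
    CommRingCat.hom_ext (hcomp β (awayMap_fromZeroRingHom lineGrading _ _) _)
  have h : IsPullback (Spec.map (CommRingCat.ofHom α)) (Spec.map (CommRingCat.ofHom β))
      (lineAwayι 0)
      (lineAwayι 1) := by
    refine IsPullback.of_iso_pullback ⟨?_⟩ (Proj.pullbackAwayιIso lineGrading (X_mem_lineGrading 0)
      Nat.one_pos (X_mem_lineGrading 1) Nat.one_pos (x := x) rfl).symm ?_ ?_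
    · exact (Proj.SpecMap_awayMap_awayι lineGrading (X_mem_lineGrading 0) Nat.one_pos
        (X_mem_lineGrading 1) (x := x) rfl).trans (Proj.SpecMap_awayMap_awayι lineGrading
          (X_mem_lineGrading 1) Nat.one_pos (X_mem_lineGrading 0) (mul_comm _ _)).symm
    · exact Proj.pullbackAwayιIso_inv_fst lineGrading (X_mem_lineGrading 0) Nat.one_pos
        (X_mem_lineGrading 1) Nat.one_pos (x := x) rfl
    · exact Proj.pullbackAwayιIso_inv_snd lineGrading (X_mem_lineGrading 0) Nat.one_pos
        (X_mem_lineGrading 1) Nat.one_pos (x := x) rfl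
  refine ⟨Away lineGrading x, inferInstance, inferInstance, s, ?_⟩
  refine IsPullback.of_iso h (Iso.refl _) (asIso (Spec.map (lineCoordHom 0)))
    (asIso (Spec.map (lineCoordHom 1))) (Iso.refl _) ?_ ?_ ?_ ?_
  · rw [← hα, Spec.map_comp]
    simp
  · rw [← hβ, Spec.map_comp]
    simp
  · simp [SpecMap_lineChart]
  · simp [SpecMap_lineChart]

/-- The covering of the projective line by two affine lines. -/
def lineCover : projLine.AffineOpenCover where
  I₀ := Fin 2
  X _ := .of (Polynomial ℂ)
  f := lineChart
  idx x := (exists_lineChart_eq x).choose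
  covers x := (exists_lineChart_eq x).choose_spec

/-- Morphisms on the projective line are glued from morphisms on the two affine lines. -/
lemma exists_glue_lineChart {Y : Scheme.{0}} (f g : Spec (.of (Polynomial ℂ)) ⟶ Y)
    (h : ∀ (R : Type) [CommRing R] [Algebra ℂ R] (s : Rˣ),
      Spec.map (CommRingCat.ofHom (Polynomial.aeval (R := ℂ) (s : R)).toRingHom) ≫ f =
        Spec.map (CommRingCat.ofHom (Polynomial.aeval (R := ℂ) ((s⁻¹ : Rˣ) : R)).toRingHom) ≫ g) :
    ∃ l : projLine ⟶ Y, lineChart 0 ≫ l = f ∧ lineChart 1 ≫ l = g := by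
  let 𝒰 : projLine.OpenCover := lineCover.openCover
  let φ : Fin 2 → (Spec (.of (Polynomial ℂ)) ⟶ Y) := ![f, g]
  obtain ⟨R, _, _, s, hp⟩ := exists_isPullback_lineChart
  have h01 : pullback.fst (lineChart 0) (lineChart 1) ≫ f = pullback.snd _ _ ≫ g := by
    rw [← hp.isoPullback_inv_fst, ← hp.isoPullback_inv_snd, Category.assoc, Category.assoc, h R s]
  have h10 : pullback.fst (lineChart 1) (lineChart 0) ≫ g = pullback.snd _ _ ≫ f := by
    rw [← pullbackSymmetry_hom_comp_fst, ← pullbackSymmetry_hom_comp_snd, Category.assoc,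
      Category.assoc, h01]
  have hφ (i j : Fin 2) : pullback.fst (lineChart i) (lineChart j) ≫ φ i =
      pullback.snd (lineChart i) (lineChart j) ≫ φ j := by
    fin_cases i <;> fin_cases j
    · exact congrArg (· ≫ f) (fst_eq_snd_of_mono_eq (lineChart 0))
    · exact h01
    · exact h10
    · exact congrArg (· ≫ g) (fst_eq_snd_of_mono_eq (lineChart 1))
  exact ⟨𝒰.glueMorphisms φ hφ, 𝒰.ι_glueMorphisms φ hφ (0 : Fin 2),
    𝒰.ι_glueMorphisms φ hφ (1 : Fin 2)⟩

end ProjectiveLine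

/-! ### Closures of orbits as projective lines -/

section OrbitLines

variable {N : Type} [AddCommGroup N] {b : Module.Basis (Fin 2) ℤ N} {F : Fan N} {u v w : N}

namespace Fan

variable (F) in
/-- The affine line in the toric variety along the edge through `u` of a cone that contains
`u, v`. -/
def edgeLine (τ : F.cones) (hu : lat u ∈ τ.1) (hv : lat v ∈ τ.1) :
    Spec (.of (Polynomial ℂ)) ⟶ F.toricVariety :=
  edgeMap hu hv (Polynomial.X : Polynomial ℂ) ≫ F.chart τ

lemma edgeLine_toSpecC (τ : F.cones) (hu : lat u ∈ τ.1) (hv : lat v ∈ τ.1) :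
    F.edgeLine τ hu hv ≫ F.toSpecC = Spec.map (CommRingCat.ofHom (algebraMap ℂ (Polynomial ℂ))) := by
  rw [edgeLine, Category.assoc, chart_toSpecC, edgeMap_affineToSpecC]

lemma isClosedImmersion_edgeMap_of_eq {τ : PointedCone ℝ (ℝ ⊗[ℤ] N)} (hτ : τ = cone₂ u v)
    (huv : area b u v = 1) (hu : lat u ∈ τ) (hv : lat v ∈ τ) :
    IsClosedImmersion (edgeMap hu hv (Polynomial.X : Polynomial ℂ)) := by
  subst hτ
  exact isClosedImmersion_edgeMap huv

lemma range_edgeLine {τ : F.cones} (hτ : τ.1 = cone₂ u v)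
    (huv : area b u v = 1) (hu : lat u ∈ τ.1) (hv : lat v ∈ τ.1) :
    Set.range (F.edgeLine τ hu hv) = (F.orbitClosure u : Set F.toricVariety) ∩ chartRange τ := by
  obtain ⟨τ, h⟩ := τ
  obtain rfl : τ = cone₂ u v := hτ
  exact range_edgeMap_chart huv h

/-- A point of an edge of `τ` that lies in the chart of a cone without the end point of the edge is
in the big orbit of the edge. -/
lemma X_notMem_of_edgeLine_mem {τ τ' : F.cones} (hu : lat u ∈ τ.1) (hv : lat v ∈ τ.1)
    (hv' : lat v ∉ τ'.1) (q : PrimeSpectrum (Polynomial ℂ))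
    (h : F.edgeLine τ hu hv q ∈ chartRange τ') : Polynomial.X ∉ q.asIdeal := by
  have hx := mem_chartRange_infCone (chart_mem_chartRange τ _) h
  obtain ⟨m, hm, hf⟩ := (F.inter_face _ τ.2 _ τ'.2).1
  have h1 := (chart_mem_chartRange_iff (τ := infCone τ τ') hm hf _).1 hx
  intro hX
  apply h1
  change edgeHom hu hv (Polynomial.X : Polynomial ℂ) _ ∈ q.asIdeal
  rw [edgeHom_single_one]
  split_ifs
  · refine Ideal.pow_mem_of_mem _ hX _ ?_
    have h2 : 0 ≤ m v := nonneg_of_mem_dualMonoid hm hv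
    have h3 : m v ≠ 0 := fun h0 => hv' ((lat_mem_face_iff hf).2 ⟨hv, h0⟩).2
    simp only
    omega
  · exact zero_mem _

/-- The two edges along a ray agree on the big orbit of the ray. -/
lemma SpecMap_edgeLine_eq (b : Module.Basis (Fin 2) ℤ N) {τ τ' : F.cones} (hr : ray u ∈ F.cones)
    (huv : area b u v = 1) (hwu : area b w u = 1) (hu : lat u ∈ τ.1) (hv : lat v ∈ τ.1)
    (hu' : lat u ∈ τ'.1) (hw : lat w ∈ τ'.1) (R : Type) [CommRing R] [Algebra ℂ R] (s : Rˣ) :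
    Spec.map (CommRingCat.ofHom (Polynomial.aeval (R := ℂ) (s : R)).toRingHom) ≫
        F.edgeLine τ hu hv =
      Spec.map (CommRingCat.ofHom (Polynomial.aeval (R := ℂ) ((s⁻¹ : Rˣ) : R)).toRingHom) ≫
        F.edgeLine τ' hu' hw := by
  have key {z : N} (τ : F.cones) (hu : lat u ∈ τ.1) (hz : lat z ∈ τ.1) (t : Rˣ) :
      Spec.map (CommRingCat.ofHom (Polynomial.aeval (R := ℂ) (t : R)).toRingHom) ≫
        F.edgeLine τ hu hz = Spec.map (CommRingCat.ofHom
          (edgeUnitHom (mem_ray u) z t).toRingHom) ≫ F.chart ⟨_, hr⟩ := by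
    rw [edgeLine, ← Category.assoc, SpecMap_edgeMap, Polynomial.aeval_X,
      edgeMap_eq_of_le (ray_le.2 hu) (mem_ray u) hz]
    exact (Category.assoc _ _ _).trans
      (congrArg _ (F.map_chart (τ := ⟨_, hr⟩) (σ := τ) (ray_le.2 hu)))
  rw [key τ hu hv, key τ' hu' hw, edgeUnitHom_inv b huv hwu]

end Fan

open Fan

/-- This identifies the preimage of a toric chart with one affine chart of the line. By `h`, points
of the other affine line that reach the toric chart are already in the overlap. -/
lemma lineChart_isPullback {Y V : Scheme.{0}} (ℓ : projLine ⟶ Y) (c : V ⟶ Y) [IsOpenImmersion c]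
    (i : Fin 2) (g : Spec (.of (Polynomial ℂ)) ⟶ V) (hg : lineChart i ≫ ℓ = g ≫ c)
    (h : ∀ q : PrimeSpectrum (Polynomial ℂ), ℓ (lineChart (i + 1) q) ∈ Set.range c →
      Polynomial.X ∉ q.asIdeal) :
    IsPullback (lineChart i) g ℓ c := by
  refine (IsOpenImmersion.isPullback g (lineChart i) c ℓ hg ?_).flip
  ext x
  constructor
  · intro hx
    obtain ⟨k, q, rfl⟩ := exists_lineChart_eq x
    have hk : k = i ∨ k = i + 1 := by omega
    rcases hk with rfl | rfl
    · exact ⟨q, rfl⟩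
    · have h1 := (lineChart_mem_range_iff (i + 1) q).2 (h q hx)
      rwa [add_assoc, show (1 : Fin 2) + 1 = 0 from rfl, add_zero] at h1
  · rintro ⟨q, rfl⟩
    exact ⟨g q, congrArg (fun f : Spec (.of (Polynomial ℂ)) ⟶ Y => f q) hg.symm⟩

/-- The projective line `ℓ` is the closure of the orbit of the ray through `u`, with the standard
coordinates on the charts of the two adjacent cones. -/
structure IsOrbitLine (b : Module.Basis (Fin 2) ℤ N) (u v w : N) (ℓ : projLine ⟶ F.toricVariety) :
    Prop where
  neighbours : HasNeighbours F b u v w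
  isClosedImmersion : IsClosedImmersion ℓ
  toSpecC : ℓ ≫ F.toSpecC = projLineToSpecC
  range : Set.range ℓ = F.orbitClosure u
  right : IsPullback (lineChart 0) (edgeMap (left_mem_cone₂ u v) (right_mem_cone₂ u v)
        (Polynomial.X : Polynomial ℂ)) ℓ (F.chart ⟨_, neighbours.right_mem⟩)
  left : IsPullback (lineChart 1) (edgeMap (right_mem_cone₂ w u) (left_mem_cone₂ w u)
        (Polynomial.X : Polynomial ℂ)) ℓ (F.chart ⟨_, neighbours.left_mem⟩)

/-- The closure of the orbit of an inner ray of a smooth fan is a projective line. -/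
lemma HasNeighbours.exists_isOrbitLine (h : HasNeighbours F b u v w) (hF : F.IsSmooth) :
    ∃ ℓ : projLine ⟶ F.toricVariety, IsOrbitLine b u v w ℓ := by
  let ρ : F.cones := ⟨_, h.right_mem⟩
  let τ : F.cones := ⟨_, h.left_mem⟩
  have hswap : area (b.reindex (Equiv.swap 0 1)) u w = 1 := by
    rw [area_reindex_swap, h.area_left]
  -- The far neighbour lies outside each cone. Hence the end point of either affine line is outside
  -- the other toric chart.
  have hw : lat w ∉ ρ.1 := fun hw => by
    have := ((lat_mem_cone₂_iff h.area_right).1 hw).1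
    rw [area_swap, h.area_left] at this
    omega
  have hv : lat v ∉ τ.1 := fun hv => by
    have := ((lat_mem_cone₂_iff h.area_left).1 hv).2
    rw [h.area_right] at this
    omega
  obtain ⟨ℓ, h0, h1⟩ := exists_glue_lineChart
    (F.edgeLine ρ (left_mem_cone₂ u v) (right_mem_cone₂ u v))
    (F.edgeLine τ (right_mem_cone₂ w u) (left_mem_cone₂ w u))
    (SpecMap_edgeLine_eq b h.ray_mem h.area_right h.area_left _ _ _ _)
  have hp0 : IsPullback (lineChart 0) (edgeMap (left_mem_cone₂ u v) (right_mem_cone₂ u v)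
        (Polynomial.X : Polynomial ℂ)) ℓ (F.chart ρ) := by
    refine lineChart_isPullback ℓ (F.chart ρ) 0 _ h0 fun q hq => ?_
    refine X_notMem_of_edgeLine_mem (τ := τ) (τ' := ρ) (right_mem_cone₂ w u)
      (left_mem_cone₂ w u) hw q ?_
    rw [← h1]
    exact hq
  have hp1 : IsPullback (lineChart 1) (edgeMap (right_mem_cone₂ w u) (left_mem_cone₂ w u)
        (Polynomial.X : Polynomial ℂ)) ℓ (F.chart τ) := by
    refine lineChart_isPullback ℓ (F.chart τ) 1 _ h1 fun q hq => ?_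
    refine X_notMem_of_edgeLine_mem (τ := ρ) (τ' := τ) (left_mem_cone₂ u v)
      (right_mem_cone₂ u v) hv q ?_
    rw [← h0]
    exact hq
  have hr : Set.range ℓ = F.orbitClosure u := by
    have hr0 := range_edgeLine (τ := ρ) rfl h.area_right (left_mem_cone₂ u v) (right_mem_cone₂ u v)
    have hr1 := range_edgeLine (τ := τ) (cone₂_comm _ _) hswap (right_mem_cone₂ w u)
      (left_mem_cone₂ w u)
    rw [← h0] at hr0
    rw [← h1] at hr1
    apply Set.Subset.antisymm
    · rintro _ ⟨x, rfl⟩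
      obtain ⟨i, q, rfl⟩ := exists_lineChart_eq x
      fin_cases i
      · exact (hr0.subset ⟨q, rfl⟩).1
      · exact (hr1.subset ⟨q, rfl⟩).1
    · intro x hx
      rcases mem_chartRange_or_of_mem_orbitClosure hF h hx with hx' | hx'
      · obtain ⟨q, rfl⟩ := hr0.superset ⟨hx, hx'⟩
        exact ⟨_, rfl⟩
      · obtain ⟨q, rfl⟩ := hr1.superset ⟨hx, hx'⟩
        exact ⟨_, rfl⟩
  refine ⟨ℓ, h, ?_, ?_, hr, hp0, hp1⟩
  · have i0 : IsClosedImmersion (edgeMap (left_mem_cone₂ u v) (right_mem_cone₂ u v)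
        (Polynomial.X : Polynomial ℂ)) := isClosedImmersion_edgeMap h.area_right
    have i1 : IsClosedImmersion (edgeMap (right_mem_cone₂ w u) (left_mem_cone₂ w u)
        (Polynomial.X : Polynomial ℂ)) :=
      isClosedImmersion_edgeMap_of_eq (cone₂_comm _ _) hswap _ _
    refine isClosedImmersion_of_isPullback ℓ (hr ▸ (F.orbitClosure u).isClosed) fun x => ?_
    have hx : ℓ x ∈ F.orbitClosure u := hr.subset ⟨x, rfl⟩
    rcases mem_chartRange_or_of_mem_orbitClosure hF h hx with hx' | hx'
    · exact ⟨_, _, _, _, _, inferInstance, i0, hp0, hx'⟩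
    · exact ⟨_, _, _, _, _, inferInstance, i1, hp1, hx'⟩
  · refine lineCover.openCover.hom_ext _ _ fun (i : Fin 2) => ?_
    change lineChart i ≫ _ = lineChart i ≫ _
    rw [lineChart_projLineToSpecC]
    fin_cases i
    · exact (congrArg (· ≫ F.toSpecC) h0).trans (edgeLine_toSpecC _ _ _)
    · exact (congrArg (· ≫ F.toSpecC) h1).trans (edgeLine_toSpecC _ _ _)

end OrbitLines

/-! ### Cellular filtrations -/

section Cells

/-- The trace of a closed set on the reduced closed subscheme on `E`. -/
def traceOn {X : Scheme.{0}} (E Z : Closeds X) : Closeds (reducedSubscheme E) :=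
  Z.preimage (reducedSubschemeι E).continuous

lemma exists_iso_affineSpace {A : Type} [CommRing A] [Algebra ℂ A] {d : ℕ}
    (e : MvPolynomial (Fin d) ℂ ≃ₐ[ℂ] A) : ∃ φ : 𝔸(Fin d; Spec (.of ℂ)) ≅ Spec (.of A),
      φ.hom ≫ Spec.map (CommRingCat.ofHom (algebraMap ℂ A)) =
        𝔸(Fin d; Spec (.of ℂ)) ↘ Spec (.of ℂ) := by
  refine ⟨AffineSpace.SpecIso (Fin d) (.of ℂ) ≪≫
    (Scheme.Spec.mapIso e.toRingEquiv.toCommRingCatIso.op).symm, ?_⟩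
  rw [← cancel_epi (AffineSpace.SpecIso (Fin d) (.of ℂ)).inv, AffineSpace.SpecIso_inv_over,
    Iso.trans_hom, Category.assoc, Iso.inv_hom_id_assoc]
  refine (Spec.map_comp _ _).symm.trans ?_
  congr 1
  ext1
  exact RingHom.ext fun c => e.symm.commutes c

/-- Cells are constructed in the ambient variety. An affine space is reduced, so its immersion
factors through the reduced subscheme on `E`. -/
lemma isAffineStep_traceOn {X : Scheme.{0}} {s : X ⟶ Spec (.of ℂ)} {A : Type} [CommRing A]
    [Algebra ℂ A] {d : ℕ} (e : MvPolynomial (Fin d) ℂ ≃ₐ[ℂ] A) (g : Spec (.of A) ⟶ X)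
    [IsImmersion g] (hgs : g ≫ s = Spec.map (CommRingCat.ofHom (algebraMap ℂ A)))
    {E Z' Z : Closeds X} (hE : Z' ≤ E) (hg : Set.range g = (Z' : Set X) \ Z) :
    IsAffineStep (reducedSubschemeι E ≫ s) (traceOn E Z) (traceOn E Z') := by
  obtain ⟨φ, hφ⟩ := exists_iso_affineSpace e
  have hr : Set.range (φ.hom ≫ g) = (Z' : Set X) \ Z := by
    rw [← hg]
    ext x
    constructor
    · rintro ⟨y, rfl⟩
      exact ⟨φ.hom y, rfl⟩
    · rintro ⟨y, rfl⟩
      obtain ⟨z, rfl⟩ := φ.hom.surjective y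
      exact ⟨z, rfl⟩
  have : IsReduced (𝔸(Fin d; Spec (.of ℂ))) := by
    have : IsReduced (Spec (.of (MvPolynomial (Fin d) ℂ))) := inferInstance
    exact isReduced_of_isOpenImmersion (AffineSpace.SpecIso (Fin d) (.of ℂ)).hom
  obtain ⟨l, hl⟩ := exists_lift_reducedSubscheme (φ.hom ≫ g) (Z := E)
    (hr.subset.trans (Set.sdiff_subset.trans hE))
  have : IsImmersion (l ≫ reducedSubschemeι E) := by rw [hl]; infer_instance
  have : IsImmersion l := IsImmersion.of_comp l (reducedSubschemeι E)
  refine isAffineStep_of_isImmersion l ?_ ?_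
  · rw [← Category.assoc, hl, Category.assoc, hgs, hφ]
  · rw [preimage_range_of_comp l (reducedSubschemeι E)
      (IsPreimmersion.isEmbedding (reducedSubschemeι E)).injective, hl, hr]
    rfl

variable {N : Type} [AddCommGroup N] {b : Module.Basis (Fin 2) ℤ N} {F F' : Fan N} {u v w : N}

open Fan

lemma range_SpecMap_eval :
    Set.range (Spec.map (CommRingCat.ofHom (Polynomial.aeval (R := ℂ) (0 : ℂ)).toRingHom)) =
      {q : PrimeSpectrum (Polynomial ℂ) | Polynomial.X ∈ q.asIdeal} := by
  have hs : Function.Surjective (Polynomial.aeval (R := ℂ) (0 : ℂ)).toRingHom := fun c =>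
    ⟨Polynomial.C c, Polynomial.aeval_C _ _⟩
  refine (range_comap_of_surjective _ _ hs).trans ?_
  ext q
  rw [PrimeSpectrum.mem_zeroLocus]
  constructor
  · intro h
    exact h (Polynomial.aeval_X (R := ℂ) (0 : ℂ))
  · intro h p hp
    have hp : Polynomial.aeval (R := ℂ) (0 : ℂ) p = 0 := hp
    obtain ⟨p', rfl⟩ := Polynomial.X_dvd_iff.2
      ((Polynomial.coeff_zero_eq_aeval_zero p).trans hp)
    exact Ideal.mul_mem_right _ _ h

/-- The end point of the closure of an orbit. -/
lemma HasNeighbours.exists_point (h : HasNeighbours F b u v w) (hF : F.IsSmooth) :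
    ∃ g : Spec (.of ℂ) ⟶ F.toricVariety, IsImmersion g ∧
      g ≫ F.toSpecC = Spec.map (CommRingCat.ofHom (algebraMap ℂ ℂ)) ∧
      Set.range g = (F.orbitClosure u : Set F.toricVariety) \ chartRange ⟨_, h.right_mem⟩ := by
  obtain ⟨ℓ, hℓ⟩ := h.exists_isOrbitLine hF
  have hc := hℓ.isClosedImmersion
  have hr := hℓ.range
  have hr0 := range_fst_of_isPullback hℓ.right
  have hsurj : Function.Surjective (Polynomial.aeval (R := ℂ) (0 : ℂ)).toRingHom := fun c =>
    ⟨Polynomial.C c, Polynomial.aeval_C _ _⟩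
  have hev : IsClosedImmersion
      (Spec.map (CommRingCat.ofHom (Polynomial.aeval (R := ℂ) (0 : ℂ)).toRingHom)) :=
    IsClosedImmersion.spec_of_surjective _ hsurj
  -- The point is the origin of the second affine line, the only point of the projective line
  -- outside the first.
  refine ⟨Spec.map (CommRingCat.ofHom (Polynomial.aeval (R := ℂ) (0 : ℂ)).toRingHom) ≫
    lineChart 1 ≫ ℓ, ?_, ?_, ?_⟩
  · infer_instance
  · rw [Category.assoc, Category.assoc, hℓ.toSpecC, lineChart_projLineToSpecC, ← Spec.map_comp,
      ← CommRingCat.ofHom_comp]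
    congr 2
    exact (Polynomial.aeval (R := ℂ) (0 : ℂ)).comp_algebraMap
  · ext x
    constructor
    · rintro ⟨z, rfl⟩
      rw [Scheme.Hom.comp_apply]
      set q := Spec.map (CommRingCat.ofHom (Polynomial.aeval (R := ℂ) (0 : ℂ)).toRingHom) z
      have hq : Polynomial.X ∈ PrimeSpectrum.asIdeal q := range_SpecMap_eval.subset ⟨z, rfl⟩
      refine ⟨hr.subset ⟨lineChart 1 q, rfl⟩, fun hx => ?_⟩
      have h1 : lineChart 1 q ∈ Set.range (lineChart 0) := hr0.superset hx
      exact (lineChart_mem_range_iff 1 q).1 h1 hq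
    · rintro ⟨hx, hx'⟩
      obtain ⟨y, rfl⟩ := hr.superset hx
      obtain ⟨i, q, rfl⟩ := exists_lineChart_eq y
      fin_cases i
      · exact absurd (hr0.subset ⟨q, rfl⟩) hx'
      · have hq : Polynomial.X ∈ q.asIdeal := by
          by_contra hq
          exact hx' (hr0.subset ((lineChart_mem_range_iff 1 q).2 hq))
        obtain ⟨z, rfl⟩ := range_SpecMap_eval.superset hq
        exact ⟨z, rfl⟩

lemma mem_finset_sup {X ι : Type} [TopologicalSpace X] {S : Finset ι} {f : ι → Closeds X} {x : X} :
    x ∈ S.sup f ↔ ∃ i ∈ S, x ∈ f i := by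
  classical
  induction S using Finset.induction_on with
  | empty => exact ⟨fun h => (h : False).elim, by simp⟩
  | insert a S _ ih =>
    rw [Finset.sup_insert, Finset.exists_mem_insert, ← ih]
    rfl

/-- A set of orbit closures of new rays, without the closure of the last orbit, is completed by a
point and an affine line. -/
lemma hasCellularFiltration_sup (hF : F'.IsSmooth) (href : F'.Refines F) (E : Closeds F'.toricVariety)
    (S : Finset N) (hS : ∀ u ∈ S, IsNewRay b F F' u) (hE : ∀ u ∈ S, F'.orbitClosure u ≤ E) :
    HasCellularFiltration (reducedSubschemeι E ≫ F'.toSpecC)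
      (traceOn E (S.sup F'.orbitClosure)) := by
  classical
  induction S using Finset.strongInduction with
  | H S ih =>
  rcases S.eq_empty_or_nonempty with rfl | hne
  · exact hasCellularFiltration_bot _
  -- Since the positive neighbour `v` is not in `S`, the affine line of `u` in the chart of `cone₂ u
  -- v` avoids the closures of the other rays of `S`.
  obtain ⟨u, huS, v, huv, hv, hvS⟩ := exists_next_notMem (S := (S : Set N)) hS hne hF href
  obtain ⟨w, hwu, hw⟩ := (hS u huS).exists_prev hF href
  have hn : HasNeighbours F' b u v w := ⟨huv, hv, hwu, hw⟩
  set C := (S.erase u).sup F'.orbitClosure with hC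
  have hCS : S.sup F'.orbitClosure = C ⊔ F'.orbitClosure u := by
    rw [hC, sup_comm, ← Finset.sup_insert, Finset.insert_erase huS]
  have hCE : C ⊔ F'.orbitClosure u ≤ E := by
    rw [← hCS]
    exact Finset.sup_le hE
  have h0 : HasCellularFiltration (reducedSubschemeι E ≫ F'.toSpecC) (traceOn E C) :=
    ih _ (Finset.erase_ssubset huS) (fun z hz => hS z (Finset.mem_of_mem_erase hz))
      (fun z hz => hE z (Finset.mem_of_mem_erase hz))
  let P : Closeds F'.toricVariety := F'.orbitClosure u ⊓ (chartRange ⟨_, hv⟩).compl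
  have hPu : P ≤ F'.orbitClosure u := inf_le_left
  obtain ⟨g, hg, hgs, hgr⟩ := hn.exists_point hF
  have hgP : Set.range g = (P : Set F'.toricVariety) := hgr
  have h1 : HasCellularFiltration (reducedSubschemeι E ≫ F'.toSpecC) (traceOn E (C ⊔ P)) := by
    refine h0.step (fun y hy => Or.inl hy) ?_
    -- The end point may already lie on another line, and then this step adds nothing.
    by_cases hP : P ≤ C
    · rw [sup_eq_left.2 hP]
      exact isAffineStep_self _
    · refine isAffineStep_traceOn (MvPolynomial.isEmptyAlgEquiv ℂ (Fin 0)) g hgs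
        ((sup_le_sup_left hPu _).trans hCE) ?_
      have hsub : (P : Set F'.toricVariety).Subsingleton := by
        rw [← hgP]
        exact Set.subsingleton_range _
      rw [hgP]
      ext x
      refine ⟨fun hx => ⟨Or.inr hx, fun hxC => hP fun y hy => ?_⟩, fun hx => hx.1.resolve_left hx.2⟩
      rwa [hsub hy hx]
  rw [hCS]
  refine h1.step (fun y hy => hy.imp id fun h => hPu h) ?_
  have hcl := isClosedImmersion_edgeMap huv
  have him : IsImmersion (F'.edgeLine ⟨_, hv⟩ (left_mem_cone₂ u v) (right_mem_cone₂ u v)) := by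
    unfold edgeLine
    infer_instance
  refine isAffineStep_traceOn (MvPolynomial.uniqueAlgEquiv ℂ (Fin 1))
    (F'.edgeLine ⟨_, hv⟩ (left_mem_cone₂ u v) (right_mem_cone₂ u v)) (edgeLine_toSpecC _ _ _) hCE ?_
  rw [range_edgeLine rfl huv]
  ext x
  constructor
  · rintro ⟨hx, hx'⟩
    refine ⟨Or.inr hx, ?_⟩
    rintro (h | h)
    · obtain ⟨z, hz, hxz⟩ := mem_finset_sup.1 h
      have hzu := Finset.ne_of_mem_erase hz
      have hzS := Finset.mem_of_mem_erase hz
      rcases eq_or_eq_of_mem_cone₂ huv hv (hS z hzS).prim (hS z hzS).mem (hxz _ hx') with h' | h'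
      · exact hzu h'
      · exact hvS (h' ▸ hzS)
    · exact h.2 hx'
  · rintro ⟨h | h, h'⟩
    · exact absurd (Or.inl h) h'
    · refine ⟨h, ?_⟩
      by_contra hx'
      exact h' (Or.inr ⟨h, hx'⟩)

lemma isCellular_exceptionalLocus (b : Module.Basis (Fin 2) ℤ N) (hF : F'.IsSmooth)
    (href : F'.Refines F) :
    IsCellular (reducedSubscheme (exceptionalLocus (toricMorphism href)))
      (reducedSubschemeι (exceptionalLocus (toricMorphism href)) ≫ F'.toSpecC) := by
  have hS (u : N) : u ∈ (finite_isNewRay b F F').toFinset ↔ IsNewRay b F F' u :=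
    (finite_isNewRay b F F').mem_toFinset
  have h := hasCellularFiltration_sup hF href (exceptionalLocus (toricMorphism href))
    (finite_isNewRay b F F').toFinset (fun u hu => (hS u).1 hu)
    fun u hu x hx => (mem_exceptionalLocus_iff b hF href).2 ⟨u, (hS u).1 hu, hx⟩
  have htop : traceOn (exceptionalLocus (toricMorphism href))
      ((finite_isNewRay b F F').toFinset.sup F'.orbitClosure) = ⊤ := by
    rw [eq_top_iff]
    intro y _
    have hy : reducedSubschemeι _ y ∈ exceptionalLocus (toricMorphism href) :=
      (range_reducedSubschemeι _).subset ⟨y, rfl⟩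
    obtain ⟨u, hu, hyu⟩ := (mem_exceptionalLocus_iff b hF href).1 hy
    exact mem_finset_sup.2 ⟨u, (hS u).2 hu, hyu⟩
  rwa [htop] at h

end Cells

/-! ### Intersections of orbit closures -/

section Intersections

/-- The intersection of two closed subschemes can be computed on a chart that contains it. -/
lemma isPullback_of_isPullback_chart {A B Y X V A' B' T : Scheme.{0}} {l : A ⟶ Y} {l' : B ⟶ Y}
    {i : Y ⟶ X} [Mono i] {c : V ⟶ X} [IsOpenImmersion c] {k : A' ⟶ A} {g : A' ⟶ V} {k' : B' ⟶ B}
    {g' : B' ⟶ V} {p : T ⟶ A'} {q : T ⟶ B'} (h : IsPullback k g (l ≫ i) c)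
    (h' : IsPullback k' g' (l' ≫ i) c) (hT : IsPullback p q g g')
    (hc : ∀ a b, i (l a) = i (l' b) → i (l a) ∈ Set.range c) :
    IsPullback (p ≫ k) (q ≫ k') l l' := by
  have hk : IsOpenImmersion k := MorphismProperty.of_isPullback h.flip inferInstance
  have hk' : IsOpenImmersion k' := MorphismProperty.of_isPullback h'.flip inferInstance
  have w : (p ≫ k) ≫ l = (q ≫ k') ≫ l' := by
    rw [← cancel_mono i, Category.assoc, Category.assoc, Category.assoc, Category.assoc, h.w, h'.w,
      ← Category.assoc, hT.w, Category.assoc]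
  have key (s : PullbackCone l l') : ∃ m : s.pt ⟶ T, m ≫ p ≫ k = s.fst ∧ m ≫ q ≫ k' = s.snd := by
    have hr : Set.range s.fst ⊆ Set.range k := by
      rw [range_fst_of_isPullback h]
      rintro _ ⟨x, rfl⟩
      refine hc (s.fst x) (s.snd x) ?_
      exact congrArg (fun f : s.pt ⟶ Y => i (f x)) s.condition
    let a : s.pt ⟶ A' := IsOpenImmersion.lift k s.fst hr
    have ha : a ≫ k = s.fst := IsOpenImmersion.lift_fac _ _ _
    have hb : s.snd ≫ l' ≫ i = (a ≫ g) ≫ c := by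
      rw [← Category.assoc, ← s.condition, ← ha, Category.assoc, Category.assoc, h.w, Category.assoc]
    refine ⟨hT.lift a (h'.lift s.snd (a ≫ g) hb) (h'.lift_snd _ _ _).symm, ?_, ?_⟩
    · rw [← Category.assoc, hT.lift_fst, ha]
    · rw [← Category.assoc, hT.lift_snd, h'.lift_fst]
  choose m hm hm' using key
  refine ⟨⟨w⟩, ⟨PullbackCone.IsLimit.mk w m hm hm' fun s n hn hn' => hT.hom_ext ?_ ?_⟩⟩
  · rw [← cancel_mono k, Category.assoc, Category.assoc, hn, hm]
  · rw [← cancel_mono k', Category.assoc, Category.assoc, hn', hm']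

variable {N : Type} [AddCommGroup N] {b : Module.Basis (Fin 2) ℤ N} {F F' : Fan N} {u v w z : N}

open Fan

/-- The evaluation of polynomials at zero. -/
def evalZero : CommRingCat.of (Polynomial ℂ) ⟶ CommRingCat.of ℂ :=
  CommRingCat.ofHom (Polynomial.aeval (R := ℂ) (0 : ℂ)).toRingHom

/-- The edges of a smooth two-dimensional cone meet transversally. -/
lemma isPushout_edgeHom (huv : area b u v = 1) : IsPushout
    (CommRingCat.ofHom (edgeHom (left_mem_cone₂ u v) (right_mem_cone₂ u v)
      (Polynomial.X : Polynomial ℂ)).toRingHom)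
    (CommRingCat.ofHom (edgeHom (right_mem_cone₂ u v) (left_mem_cone₂ u v)
      (Polynomial.X : Polynomial ℂ)).toRingHom) evalZero evalZero := by
  set α := edgeHom (left_mem_cone₂ u v) (right_mem_cone₂ u v) (Polynomial.X : Polynomial ℂ)
  set β := edgeHom (right_mem_cone₂ u v) (left_mem_cone₂ u v) (Polynomial.X : Polynomial ℂ)
  let χu : coneRing (cone₂ u v) := AddMonoidAlgebra.single ⟨_, neg_area_mem_dualMonoid huv⟩ 1
  let χv : coneRing (cone₂ u v) := AddMonoidAlgebra.single ⟨_, area_mem_dualMonoid huv⟩ 1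
  have hvu : area b v u = -1 := by rw [area_swap, huv]
  have hαv : α χv = Polynomial.X := by
    refine (edgeHom_single_one _ _ _ _).trans ?_
    simp [huv]
  have hβv : β χv = 0 := by
    refine (edgeHom_single_one _ _ _ _).trans ?_
    simp [huv]
  have hαu : α χu = 0 := by
    refine (edgeHom_single_one _ _ _ _).trans ?_
    simp [hvu]
  have hβu : β χu = Polynomial.X := by
    refine (edgeHom_single_one _ _ _ _).trans ?_
    simp [hvu]
  have w : CommRingCat.ofHom α.toRingHom ≫ evalZero = CommRingCat.ofHom β.toRingHom ≫ evalZero := by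
    ext1
    have : (Polynomial.aeval (R := ℂ) (0 : ℂ)).comp α =
        (Polynomial.aeval (R := ℂ) (0 : ℂ)).comp β := by
      rw [comp_edgeHom, comp_edgeHom, Polynomial.aeval_X]
      refine coneRing_algHom_ext fun m => ?_
      obtain ⟨h1, h2⟩ := mem_dualMonoid_cone₂.1 m.2
      rw [edgeHom_single_one, edgeHom_single_one]
      by_cases h3 : m.1 u = 0 <;> by_cases h4 : m.1 v = 0
      · simp [h3, h4]
      · rw [if_pos h3, if_neg h4, zero_pow (by omega)]
      · rw [if_neg h3, if_pos h4, zero_pow (by omega)]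
      · rw [if_neg h3, if_neg h4]
    exact congrArg AlgHom.toRingHom this
  have key (s : PushoutCocone (CommRingCat.ofHom α.toRingHom) (CommRingCat.ofHom β.toRingHom)) :
      ∃ m : CommRingCat.of ℂ ⟶ s.pt, evalZero ≫ m = s.inl ∧ evalZero ≫ m = s.inr := by
    have hs (x : coneRing (cone₂ u v)) : s.inl.hom (α x) = s.inr.hom (β x) :=
      congrArg (fun f : CommRingCat.of (coneRing (cone₂ u v)) ⟶ s.pt => f.hom x) s.condition
    have h0 (f : CommRingCat.of (Polynomial ℂ) ⟶ s.pt) (hf : f.hom Polynomial.X = 0) :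
        evalZero ≫ CommRingCat.ofHom (f.hom.comp Polynomial.C) = f := by
      ext1
      refine Polynomial.ringHom_ext (fun c => ?_) ?_
      · change f.hom (Polynomial.C (Polynomial.aeval (R := ℂ) (0 : ℂ) (Polynomial.C c))) = _
        rw [Polynomial.aeval_C]
        rfl
      · change f.hom (Polynomial.C (Polynomial.aeval (R := ℂ) (0 : ℂ) Polynomial.X)) = _
        rw [Polynomial.aeval_X, map_zero, map_zero, hf]
    -- Each edge coordinate is a character that restricts to zero on the other edge, so both
    -- coordinates vanish on the intersection.
    have hl : s.inl.hom Polynomial.X = 0 := by rw [← hαv, hs, hβv, map_zero]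
    have hr : s.inr.hom Polynomial.X = 0 := by rw [← hβu, ← hs, hαu, map_zero]
    have hlr : s.inl.hom.comp Polynomial.C = s.inr.hom.comp Polynomial.C := by
      refine RingHom.ext fun c => ?_
      have := hs (algebraMap ℂ _ c)
      rwa [AlgHom.commutes, AlgHom.commutes] at this
    exact ⟨CommRingCat.ofHom (s.inl.hom.comp Polynomial.C), h0 _ hl, by rw [hlr]; exact h0 _ hr⟩
  have hsurj : Function.Surjective evalZero.hom := fun c =>
    ⟨Polynomial.C c, Polynomial.aeval_C _ _⟩
  have : Epi evalZero := ConcreteCategory.epi_of_surjective _ hsurj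
  choose m hm hm' using key
  exact ⟨⟨w⟩, ⟨PushoutCocone.IsColimit.mk w m hm hm' fun s n hn _ => by
    rw [← cancel_epi evalZero, hn, hm]⟩⟩

/-- The smallest cone for `x` contains both rays, so they span it, and the sign of the area fixes
their order. -/
lemma mem_orbitClosure_inter (hF : F.IsSmooth) (hu : IsPrim b u) (hru : ray u ∈ F.cones)
    (hv : IsPrim b v) (hrv : ray v ∈ F.cones) (huv : 0 < area b u v) {x : F.toricVariety}
    (hxu : x ∈ F.orbitClosure u) (hxv : x ∈ F.orbitClosure v) :
    area b u v = 1 ∧ ∃ h : cone₂ u v ∈ F.cones, x ∈ chartRange ⟨_, h⟩ := by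
  obtain ⟨τ, hτ, -⟩ := exists_minimal_chartRange x
  have hne : u ≠ v := by
    rintro rfl
    simp at huv
  rcases cases_of_two_rays_mem hF hu hru hv hrv hne τ.2 (hxu τ hτ) (hxv τ hτ) with h | h
  · obtain ⟨τ, hτF⟩ := τ
    obtain rfl := h.2
    exact ⟨h.1, hτF, hτ⟩
  · have := h.1
    rw [area_swap] at this
    omega

/-- The closures of the orbits of adjacent rays meet transversally in one point. -/
lemma isIso_pullback_fst_projLineToSpecC (hF : F.IsSmooth) {Y : Scheme.{0}} {i : Y ⟶ F.toricVariety}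
    [Mono i] {l l' : projLine ⟶ Y} (h : IsOrbitLine b u v w (l ≫ i))
    (h' : IsOrbitLine b v z u (l' ≫ i)) : IsIso (pullback.fst l l' ≫ projLineToSpecC) := by
  -- The common point is the origin of chart `0` on the first line and of chart `1` on the second.
  -- All intersections lie in the chart of `cone₂ u v`.
  have hp : IsPullback (Spec.map evalZero ≫ lineChart 0) (Spec.map evalZero ≫ lineChart 1) l l' := by
    refine isPullback_of_isPullback_chart h.right h'.left
      (isPullback_SpecMap_of_isPushout _ _ _ _ (isPushout_edgeHom h.neighbours.area_right)) ?_
    intro a a' ha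
    obtain ⟨-, _, hx⟩ := mem_orbitClosure_inter hF h.neighbours.prim h.neighbours.ray_mem
      h'.neighbours.prim h'.neighbours.ray_mem (by rw [h.neighbours.area_right]; exact one_pos)
      (h.range.subset ⟨a, rfl⟩) (ha ▸ h'.range.subset ⟨a', rfl⟩)
    exact hx
  have hid : (Spec.map evalZero ≫ lineChart 0) ≫ projLineToSpecC = 𝟙 _ := by
    rw [Category.assoc, lineChart_projLineToSpecC, ← Spec.map_comp, ← Spec.map_id]
    congr 1
    ext1
    exact (Polynomial.aeval (R := ℂ) (0 : ℂ)).comp_algebraMap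
  rw [← hp.isoPullback_inv_fst, Category.assoc, hid]
  infer_instance

end Intersections

/-! ### Trees of projective lines -/

section Trees

variable {N : Type} [AddCommGroup N] {b : Module.Basis (Fin 2) ℤ N} {F F' : Fan N} {u v w : N}
  {σ : PointedCone ℝ (ℝ ⊗[ℤ] N)}

open Fan

variable (b F F') in
/-- The new rays in a cone of the coarser fan, in their angular order. -/
lemma exists_enumeration (hσ : σ ∈ F.cones) (hne : ∃ u, IsNewRay b F F' u ∧ lat u ∈ σ) :
    ∃ (k : ℕ) (r : Fin (k + 1) → N), (∀ u, (∃ i, r i = u) ↔ IsNewRay b F F' u ∧ lat u ∈ σ) ∧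
      ∀ i j, i < j → 0 < area b (r i) (r j) := by
  classical
  let R := {u // IsNewRay b F F' u ∧ lat u ∈ σ}
  have : Finite R := ((finite_isNewRay b F F').subset fun u hu => hu.1).to_subtype
  have : Fintype R := Fintype.ofFinite R
  have : Nonempty R := ⟨⟨hne.choose, hne.choose_spec⟩⟩
  -- Strong convexity makes the sign of the area a strict total order on the new rays of `σ`.
  let lt : R → R → Prop := fun u v => 0 < area b u.1 v.1
  have hsc := F.stronglyConvex σ hσ
  have hirr : Std.Irrefl lt := ⟨fun u h => by simp [lt] at h⟩
  have htr : IsTrans R lt := ⟨fun u v w huv hvw =>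
    IsNewRay.area_pos_trans u.2.1.prim hsc u.2.2 v.2.2 w.2.2 huv hvw⟩
  have htri : Std.Trichotomous lt := ⟨fun u v huv hvu => Subtype.ext <|
    eq_of_area_eq_zero u.2.1.prim v.2.1.prim hsc u.2.2 v.2.2 (by
      simp only [lt] at huv hvu
      rw [area_swap] at hvu
      omega)⟩
  have hsto : IsStrictTotalOrder R lt := {}
  let := linearOrderOfSTO lt
  obtain ⟨k, hk⟩ := Nat.exists_eq_succ_of_ne_zero (Fintype.card_ne_zero (α := R))
  let e := Fintype.orderIsoFinOfCardEq R hk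
  refine ⟨k, fun i => (e i).1, fun u => ⟨?_, fun hu => ⟨e.symm ⟨u, hu⟩, by simp⟩⟩, fun i j hij => ?_⟩
  · rintro ⟨i, rfl⟩
    exact (e i).2
  · exact e.lt_iff_lt.2 hij

/-- The part of the exceptional locus that lies over a cone of the coarser fan. -/
def exceptionalPart (b : Module.Basis (Fin 2) ℤ N) (href : F'.Refines F)
    (σ : PointedCone ℝ (ℝ ⊗[ℤ] N)) :
    (reducedSubscheme (exceptionalLocus (toricMorphism href))).Opens :=
  reducedSubschemeι (exceptionalLocus (toricMorphism href)) ⁻¹ᵁ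
    ((((finite_isNewRay b F F').subset (fun _ h => h.1) :
      {u | IsNewRay b F F' u ∧ lat u ∉ σ}.Finite).toFinset.sup F'.orbitClosure).compl)

/-- Removing the closures for rays outside `σ` makes openness evident. What remains is the union for
the rays inside, because a cone of `F'` with a new ray in `σ` lies in `σ`, so closures of the two
kinds are disjoint. -/
lemma mem_exceptionalPart_iff (hF : F'.IsSmooth) (href : F'.Refines F) (hσ : σ ∈ F.cones)
    {y : reducedSubscheme (exceptionalLocus (toricMorphism href))} :
    y ∈ exceptionalPart b href σ ↔ ∃ u, IsNewRay b F F' u ∧ lat u ∈ σ ∧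
      reducedSubschemeι _ y ∈ F'.orbitClosure u := by
  have h1 : y ∈ exceptionalPart b href σ ↔
      ∀ u, IsNewRay b F F' u → lat u ∉ σ → reducedSubschemeι _ y ∉ F'.orbitClosure u := by
    change ¬ reducedSubschemeι _ y ∈ Finset.sup (α := Closeds F'.toricVariety) _ _ ↔ _
    rw [mem_finset_sup]
    simp only [Set.Finite.mem_toFinset, Set.mem_ofPred_eq, not_exists, not_and, and_imp]
  rw [h1]
  constructor
  · intro h
    have hy : reducedSubschemeι _ y ∈ exceptionalLocus (toricMorphism href) :=
      (range_reducedSubschemeι _).subset ⟨y, rfl⟩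
    obtain ⟨u, hu, hyu⟩ := (mem_exceptionalLocus_iff b hF href).1 hy
    exact ⟨u, hu, by_contra fun hus => h u hu hus hyu, hyu⟩
  · rintro ⟨u, hu, hus, hyu⟩ v hv hvs hyv
    obtain ⟨τ, hτ, -⟩ := exists_minimal_chartRange (reducedSubschemeι _ y)
    exact hvs (hu.cone₂_le_of_mem href τ.2 (hyu τ hτ) hσ hus (hyv τ hτ))

/-- The lines are the orbit closures of the new rays of `σ` in angular order; consecutive rays span
a cone of `F'` and no others do. -/
lemma isTreeOfLines_exceptionalPart (hF : F'.IsSmooth) (href : F'.Refines F) (hσ : σ ∈ F.cones)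
    (hne : ∃ u, IsNewRay b F F' u ∧ lat u ∈ σ) :
    IsTreeOfLines (exceptionalPart b href σ).toScheme
      ((exceptionalPart b href σ).ι ≫ reducedSubschemeι _ ≫ F'.toSpecC) := by
  obtain ⟨k, r, hr, hlt⟩ := exists_enumeration b F F' hσ hne
  have hnew (i) : IsNewRay b F F' (r i) := ((hr _).1 ⟨i, rfl⟩).1
  have hmem (i) : lat (r i) ∈ σ := ((hr _).1 ⟨i, rfl⟩).2
  choose v w hn using fun i => (hnew i).exists_hasNeighbours hF href
  choose ℓ hℓ using fun i => (hn i).exists_isOrbitLine hF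
  let U := exceptionalPart b href σ
  let ι : U.toScheme ⟶ F'.toricVariety := U.ι ≫ reducedSubschemeι _
  have hex (i) : ∃ l : projLine ⟶ U.toScheme, l ≫ ι = ℓ i := by
    have : IsReduced projLine := by
      refine @IsReduced.of_openCover _ lineCover.openCover fun _ => ?_
      exact inferInstanceAs (IsReduced (Spec (.of (Polynomial ℂ))))
    obtain ⟨l, hl⟩ := exists_lift_reducedSubscheme (ℓ i)
      (Z := exceptionalLocus (toricMorphism href)) (by
        rw [(hℓ i).range]
        exact fun x hx => (mem_exceptionalLocus_iff b hF href).2 ⟨_, hnew i, hx⟩)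
    have hlU : Set.range l ⊆ Set.range U.ι := by
      rw [Scheme.Opens.range_ι]
      rintro _ ⟨x, rfl⟩
      refine (mem_exceptionalPart_iff hF href hσ).2 ⟨_, hnew i, hmem i, ?_⟩
      rw [← Scheme.Hom.comp_apply, hl]
      exact (hℓ i).range.subset ⟨x, rfl⟩
    exact ⟨IsOpenImmersion.lift U.ι l hlU, by
      rw [← hl, ← Category.assoc, IsOpenImmersion.lift_fac]⟩
  choose l hl using hex
  have hinj : Function.Injective ι := (IsPreimmersion.isEmbedding ι).injective
  have hrange (i) : Set.range (l i) = ι ⁻¹' F'.orbitClosure (r i) := by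
    rw [preimage_range_of_comp (l i) ι hinj, hl, (hℓ i).range]
  refine ⟨inferInstance, k, l, fun i => ⟨?_, ?_⟩, ?_, fun i => ?_, fun i j hij => ?_⟩
  · have : IsClosedImmersion (l i ≫ ι) := by
      rw [hl]
      exact (hℓ i).isClosedImmersion
    exact IsClosedImmersion.of_comp (l i) ι
  · change l i ≫ U.ι ≫ _ = _
    rw [← (hℓ i).toSpecC, ← hl]
    simp [ι]
  · rw [Set.eq_univ_iff_forall]
    intro y
    obtain ⟨u, hu, hus, hyu⟩ := (mem_exceptionalPart_iff hF href hσ).1 y.2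
    obtain ⟨i, rfl⟩ := (hr u).2 ⟨hu, hus⟩
    exact Set.mem_iUnion.2 ⟨i, (hrange i).superset hyu⟩
  · have hlt' : i.castSucc < i.succ := Fin.castSucc_lt_succ
    have hadj : area b (r i.castSucc) (r i.succ) = 1 ∧
        cone₂ (r i.castSucc) (r i.succ) ∈ F'.cones := by
      -- A new ray between two consecutive ones would occur in the enumeration at an index strictly
      -- between theirs.
      refine ((hnew _).adjacent_or_exists_between (hnew _) hF href hσ (hmem _) (hmem _)
        (hlt _ _ hlt')).resolve_right ?_
      rintro ⟨z, hz, hzs, h1, h2⟩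
      obtain ⟨j, rfl⟩ := (hr z).2 ⟨hz, hzs⟩
      rcases le_or_gt j i.castSucc with hj | hj
      · rcases hj.eq_or_lt with rfl | hj
        · simp at h1
        · have := hlt _ _ hj
          rw [area_swap] at this
          omega
      · rcases (Fin.castSucc_lt_iff_succ_le.1 hj).eq_or_lt with rfl | hj
        · simp at h2
        · have := hlt _ _ hj
          rw [area_swap] at this
          omega
    -- The neighbours were chosen arbitrarily, but uniqueness identifies them with the adjacent rays
    -- of the enumeration.
    have hv : v i.castSucc = r i.succ :=
      cone₂_right_unique (hn _).area_right hadj.1 (hn _).right_mem hadj.2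
    have hw : w i.succ = r i.castSucc :=
      cone₂_left_unique (hn _).area_left hadj.1 (hn _).left_mem hadj.2
    have h1 := hℓ i.castSucc
    have h2 := hℓ i.succ
    rw [hv, ← hl] at h1
    rw [hw, ← hl] at h2
    exact isIso_pullback_fst_projLineToSpecC hF h1 h2
  · rw [Set.disjoint_left]
    intro y hy hy'
    obtain ⟨h1, h2, -⟩ := mem_orbitClosure_inter hF (hnew i).prim (hnew i).mem (hnew j).prim
      (hnew j).mem (hlt i j (Fin.lt_def.2 (by omega))) ((hrange i).subset hy) ((hrange j).subset hy')
    -- A common point would make `r i` and `r j` the edges of a cone of `F'`, with the ray `r (i +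
    -- 1)` strictly inside it.
    let m : Fin (k + 1) := ⟨i.1 + 1, by omega⟩
    exact not_ray_between h1 h2 (hnew m).prim (hnew m).mem
      (hlt i m (Fin.lt_def.2 (Nat.lt_succ_self _))) (hlt m j (Fin.lt_def.2 hij))

/-- The trees are indexed by the cones of `F` that contain a new ray. Each new ray lies in exactly
one cone of `F`, so the parts are disjoint and cover. -/
lemma isDisjointUnionOfTrees_exceptionalLocus (b : Module.Basis (Fin 2) ℤ N) (hF : F'.IsSmooth)
    (href : F'.Refines F) :
    IsDisjointUnionOfTrees (reducedSubscheme (exceptionalLocus (toricMorphism href)))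
      (reducedSubschemeι (exceptionalLocus (toricMorphism href)) ≫ F'.toSpecC) := by
  let T := {σ : F.cones // ∃ u, IsNewRay b F F' u ∧ lat u ∈ σ.1}
  have := F.finite.to_subtype
  obtain ⟨n, ⟨e⟩⟩ := Finite.exists_equiv_fin T
  refine ⟨n, fun a => exceptionalPart b href (e.symm a).1.1, fun a a' hne => ?_, ?_, fun a =>
    isTreeOfLines_exceptionalPart hF href (e.symm a).1.2 (e.symm a).2⟩
  · refine Opens.coe_disjoint.1 (Set.disjoint_left.2 fun y hy hy' => ?_)
    obtain ⟨u, hu, hus, hyu⟩ := (mem_exceptionalPart_iff hF href (e.symm a).1.2).1 hy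
    obtain ⟨u', hu', hus', hyu'⟩ := (mem_exceptionalPart_iff hF href (e.symm a').1.2).1 hy'
    obtain ⟨τ, hτ, -⟩ := exists_minimal_chartRange (reducedSubschemeι _ y)
    have hmem := hu.cone₂_le_of_mem href τ.2 (hyu τ hτ) (e.symm a).1.2 hus (hyu' τ hτ)
    have := hu'.cone_unique (e.symm a).1.2 (e.symm a').1.2 hmem hus'
    exact hne (e.symm.injective (Subtype.ext (Subtype.ext this)))
  · rw [eq_top_iff]
    intro y _
    have hy : reducedSubschemeι _ y ∈ exceptionalLocus (toricMorphism href) :=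
      (range_reducedSubschemeι _).subset ⟨y, rfl⟩
    obtain ⟨u, hu, hyu⟩ := (mem_exceptionalLocus_iff b hF href).1 hy
    obtain ⟨σ, hσ, hus⟩ := hu.exists_cone href
    refine Opens.mem_iSup.2 ⟨e ⟨⟨σ, hσ⟩, u, hu, hus⟩, ?_⟩
    beta_reduce
    rw [Equiv.symm_apply_apply]
    exact (mem_exceptionalPart_iff hF href hσ).2 ⟨u, hu, hus, hyu⟩

end Trees

end ToricSurface

end

theorem proposition3p2 {N : Type} [AddCommGroup N] [Module.Free ℤ N] [Module.Finite ℤ N]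
    (hN : Module.finrank ℤ N = 2) (F F' : Fan N) (hsmooth : F'.IsSmooth) (href : F'.Refines F)
    (E : Closeds F'.toricVariety) (hE : E = exceptionalLocus (Fan.toricMorphism href)) :
    IsDisjointUnionOfTrees (reducedSubscheme E) (reducedSubschemeι E ≫ F'.toSpecC) ∧
      IsCellular (reducedSubscheme E) (reducedSubschemeι E ≫ F'.toSpecC) ∧
      (IsIso (Fan.toricMorphism href ∣_ smoothLocus F.toSpecC) →
        (E : Set F'.toricVariety) =
          Fan.toricMorphism href ⁻¹' (singularLocus F.toSpecC : Set F.toricVariety)) := by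
  subst hE
  let b := Module.finBasisOfFinrankEq ℤ N hN
  exact ⟨isDisjointUnionOfTrees_exceptionalLocus b hsmooth href,
    isCellular_exceptionalLocus b hsmooth href, coe_exceptionalLocus_eq b hsmooth href⟩
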